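/- **Setting.** Let $\Gamma$ be a connected negative definite plumbing tree (all genera $0$) which is the dual graph of a minimal good resolution: the vertices $v\in\mathcal V$ carry integers $b_v$, and $b_v\le -2$ whenever the valency $\delta_v\le 2$. Let $L=\mathbb Z\langle E_v\rangle_{v\in\mathcal V}$ with its intersection form, $L'\subset L\otimes\mathbb Q$ the dual lattice, $E_v^*\in L'$ the vectors with $(E_v^*,E_w)=-\delta_{vw}$ (Kronecker delta), and $H=L'/L$. Let $\mathcal N=\{n:\delta_n\ge 3\}$ be the set of nodes, $\mathcal E=\{u:\delta_u=1\}$ the set of ends, $\mathcal N_n$ (resp. $\mathcal E_n$) the set of nodes (resp. ends) joined to the node $n$ by a possibly empty chain of vertices of valency $2$ (for ends, a leg), $\delta_{n,\mathcal N}=|\mathcal N_n|$ and $\widehat{\mathcal N}=\{n\in\mathcal N:\delta_{n,\mathcal N}\ge 2\}$. Assume $\mathcal N\ne\emptyset$ and $\delta_{n,\mathcal N}\ge 1$ for all $n\in\mathcal N$. Fix a partial order on $\mathcal N$ in which any two nodes joined by a chain are comparable; below, a sum over $n<n'$ runs over pairs joined by a chain. Let $\pi_{\mathcal N}$ be the projection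 to the coordinates of the $E_n$, $n\in\mathcal N$; write $\mathbf t^{x}=\prod_{n\in\mathcal N}t_n^{x_n}$. **Seifert invariants.** For a string $k_1,\dots,k_s$ let $\alpha/\omega=k_1-1/(k_2-\cdots-1/k_s)$ in lowest terms, with $(\alpha,\omega)=(1,0)$ for the empty string. Let $(\alpha_{n,n'},\omega_{n,n'})$ be the pair of the numbers $-b_v$ along the chain $(n,n')$ read from $n$, and $(\alpha_u,\omega_u)$ that of the leg $(n,u]$, $u\in\mathcal E_n$, read from $n$. **Series.** Let $\sum_{l'\in L'}p_{l'}[l']\mathbf t^{l'}$ be the Taylor expansion at the origin of $\prod_{v}(1-[E_v^*]\mathbf t^{E_v^*})^{\delta_v-2}$ and, for $h\in H$, let $Z_h(\mathbf t_{\mathcal N})=\sum_{[l']=h}p_{l'}\mathbf t^{\pi_{\mathcal N}(l')}$. **Polynomial parts.** Let $S\subseteq\mathcal N$, let $w_m\in\mathbb Z^{\mathcal N}$ ($m\in S$) be positive multiples of $\pi_{\mathcal N}(E_m^*)$, and let $F$ be a Laurent polynomial in the $t_n$ (all exponents of Laurent polynomials are in $\pi_{\mathcal N}(L')$). For $T\subseteq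 S$ put $D_T=\prod_{m\in T}(1-\mathbf t^{w_m})$ and $\Box_T=\sum_{m\in T}[0,1)w_m$, with $\Box_\emptyset:=\emptyset$. * The polynomial part of $F/D_S$ with respect to a node $n$ is the Laurent polynomial $P$ with $F=P D_S+R$, where $x_n\ge 0$ for all exponents $x$ of $P$ and $x_n\in\pi_n(\Box_S)$ for all exponents $x$ of $R$. * Let $n,n'$ be nodes joined by a chain, and let $S_n$ (resp. $S_{n'}$) be the set of those $m\in S$ that lie in the part of $\Gamma\setminus(n,n')$ containing $n$ (resp. $n'$). The polynomial part of $F/D_S$ with respect to $n,n'$ is the Laurent polynomial $P$ with $F=PD_S+R_1D_{S_{n'}}+R_2D_{S_n}+R$, where, after projection to the $(n,n')$ coordinates, the exponents of $P$ are not in $\mathbb Q_{<0}^2$, those of $R_1$ are in $\mathbb R_{\le 0}E_n+\pi_{n,n'}(\Box_{S_n})$, those of $R_2$ are in $\mathbb R_{\le 0}E_{n'}+\pi_{n,n'}(\Box_{S_{n'}})$, and those of $R$ are in $\pi_{n,n'}(\Box_{S_n})+\pi_{n,n'}(\Box_{S_{n'}})$ (so $R_1=R=0$ if $S_n=\emptyset$,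 and $R_2=R=0$ if $S_{n'}=\emptyset$). Write $Z_h=F/D_S$ in this way, i.e. $Z_h\cdot D_S=F$ as formal series, and let $P_h^n$, $P_h^{nn'}$ be its polynomial parts (independent of the choice of $F/D_S$). The polynomial part of the reduced Poincaré series is $$P_h(\mathbf t_{\mathcal N})=\sum_{n<n'}P_h^{nn'}-\sum_{n\in\mathcal N}(\delta_{n,\mathcal N}-1)P_h^{n}.$$ **Modules.** Let $a=\sum_{n\in\mathcal N}a_nE_n^*+\sum_{u\in\mathcal E}a_uE_u^*+\sum_{n<n'}a_{n_{n'}}E^*_{n_{n'}}$ (integer coefficients; $n_{n'}$ is the first vertex after $n$ on the path to $n'$) be a reduced lift of $h$, i.e. $[a]=h$, and $\mathbf c_a=\pi_{\mathcal N}(a)$. Let $\mathbb Z^{\mathcal N}(a)=\{\ell\in\mathbb Z^{\mathcal N}:\ell_n+\omega_{n',n}\ell_{n'}\equiv a_{n_{n'}}\ (\mathrm{mod}\ \alpha_{n,n'})\ \forall n<n'\}$, $$N_a(\ell,n)=a_n+\sum_{n'>n}\tfrac{\omega_{n,n'}}{\alpha_{n,n'}}a_{n_{n'}}+\sum_{n'<n}\tfrac1{\alpha_{n,n'}}a_{n'_{n}}-\Big(b_n+\sum_{n'\in\mathcal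 N_n}\tfrac{\omega_{n,n'}}{\alpha_{n,n'}}\Big)\ell_n-\sum_{n'\in\mathcal N_n}\tfrac{1}{\alpha_{n,n'}}\ell_{n'}+\sum_{u\in\mathcal E_n}\Big\lfloor\tfrac{a_u-\omega_u\ell_n}{\alpha_u}\Big\rfloor,$$ $\overline N_a(\ell,n)=N_a(\ell,n)+\sum_{u\in\mathcal E_n}\{\frac{a_u-\omega_u\ell_n}{\alpha_u}\}$ (fractional parts), $\mathcal M_a=\{\ell\in\mathbb Z^{\mathcal N}(a):N_a(\ell,n)\ge0\ \forall n\}$ and $\overline{\mathcal M}_a=\{\ell\in\mathbb Z^{\mathcal N}(a):\overline N_a(\ell,n)\ge0\ \forall n\}$. Let $\mathcal C^{orb}=\{y:-I^{orb}y\ge0\}$, where $I^{orb}_{n,n}=b_n+\sum_{u\in\mathcal E_n}\frac{\omega_u}{\alpha_u}+\sum_{n'\in\mathcal N_n}\frac{\omega_{n,n'}}{\alpha_{n,n'}}$, $I^{orb}_{n,n'}=\frac1{\alpha_{n,n'}}$ for $n'\in\mathcal N_n$, and $0$ otherwise. Write $0\le k\le\delta-2$ for $k=\sum_{n\in\widehat{\mathcal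 N}}k_nE_n^*$ with integers $0\le k_n\le\delta_{n,\mathcal N}-2$ (and $k_n=0$ for $n\in\mathcal N\setminus\widehat{\mathcal N}$), and $(-1)^k\binom{\delta-2}{k}=\prod_{n\in\widehat{\mathcal N}}(-1)^{k_n}\binom{\delta_{n,\mathcal N}-2}{k_n}$. Let $\mathfrak v_n\in\mathcal M_0$ ($n\in\mathcal N$) be vectors spanning the cone $\mathcal C^{orb}$ such that for every $0\le k\le\delta-2$, every $\ell\in\overline{\mathcal M}_{a-k}$ and every $n$: $N_{a-k}(\ell+\mathfrak v_n,n')=N_{a-k}(\ell,n')$ for $n'\ne n$, and $N_{a-k}(\ell+\mathfrak v_n,n)\ge1$. With $\Box=\sum_n[0,1)\mathfrak v_n$ and $\widehat{\mathcal N}\subseteq\mathcal I\subseteq\mathcal N$ put $$\mathrm{gr}_k\mathcal M^-_{a,\mathcal I}=\{\ell\in(\Box-\mathbf c_{a-k})\cap\mathbb Z^{\mathcal N}(a): N_a(\ell,n)<0\ \forall n\in\mathcal I\setminus\widehat{\mathcal N},\ N_a(\ell,n)=k_n\ \forall n\in\widehat{\mathcal N}\}.$$ For $\ell\in\overline{\mathcal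 M}_a$ and $\mathcal I\subseteq\mathcal N$ let $Pol^n$, $Pol^{nn'}$ be the polynomial parts of $\mathbf t^{\mathbf c_a+\ell}/\prod_{m\in\mathcal I}(1-\mathbf t^{\mathfrak v_m})$ with respect to $n$ and to $n,n'$, and $$Pol_{(\mathbf c_a+\ell,\mathcal I)}=\sum_{n<n'}Pol^{nn'}-\sum_{n\in\mathcal N}(\delta_{n,\mathcal N}-1)Pol^{n}.$$ **Theorem.** The coefficients of $Z_h(\mathbf t_{\mathcal N})$ are finite sums; all the polynomial parts above exist and are unique; the sets $\mathrm{gr}_k\mathcal M^-_{a,\mathcal I}$ are finite subsets of $\overline{\mathcal M}_a$; and $$P_h(\mathbf t_{\mathcal N})=\sum_{\widehat{\mathcal N}\subseteq\mathcal I\subseteq\mathcal N}(-1)^{|\mathcal I\setminus\widehat{\mathcal N}|}\sum_{0\le k\le\delta-2}(-1)^k\binom{\delta-2}{k}\sum_{\ell\in\mathrm{gr}_k\mathcal M^-_{a,\mathcal I}}Pol_{(\mathbf c_a+\ell,\,\mathcal N\setminus\mathcal I)}(\mathbf t_{\mathcal N}).$$ -/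

import Mathlib

noncomputable section

section PlumbingDefinitions

open scoped Classical

universe u

/-- The intersection matrix of a weighted graph: the weights on the diagonal, `1` for an edge. -/
def plumbingMatrix {V : Type u} [DecidableEq V] (G : SimpleGraph V) (b : V → ℤ) : Matrix V V ℤ :=
  Matrix.of fun v w => if v = w then b v else if G.Adj v w then 1 else 0

/-- A connected negative definite plumbing tree (all genera zero) which is the dual graph of a
minimal good resolution. -/
structure PlumbingTree (V : Type u) [Fintype V] [DecidableEq V] where
  graph : SimpleGraph V
  b : V → ℤ
  isTree : graph.IsTree
  negDef : ∀ x : V → ℤ, x ≠ 0 → dotProduct x (Matrix.mulVec (plumbingMatrix graph b) x) < 0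
  minimal : ∀ v, graph.degree v ≤ 2 → b v ≤ -2

/-- `contFrac [k₁, …, kₛ] = (α, ω)`, the numerator and the denominator of
`k₁ - 1/(k₂ - 1/(⋯ - 1/kₛ))`; the empty string gives `(1, 0)`. -/
def contFrac : List ℤ → ℤ × ℤ
  | [] => (1, 0)
  | k :: ks => (k * (contFrac ks).1 - (contFrac ks).2, (contFrac ks).1)

/-- The lattice `L` freely generated by the `E_v`: the integral vectors of `L ⊗ ℚ`. -/
def integerLattice (V : Type u) : AddSubgroup (V → ℚ) where
  carrier := {x | ∀ v, ∃ k : ℤ, x v = k}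
  zero_mem' := fun _ => ⟨0, by simp⟩
  add_mem' := fun {x y} hx hy v => by
    obtain ⟨k, hk⟩ := hx v
    obtain ⟨l, hl⟩ := hy v
    exact ⟨k + l, by simp [hk, hl]⟩
  neg_mem' := fun {x} hx v => by
    obtain ⟨k, hk⟩ := hx v
    exact ⟨-k, by simp [hk]⟩

namespace PlumbingTree

variable {V : Type u} [Fintype V] [DecidableEq V] (Γ : PlumbingTree V)

/-! ### Combinatorics of the tree -/

/-- The valency `δ_v`. -/
def valency (v : V) : ℕ := Γ.graph.degree v

/-- The set `𝒩` of nodes. -/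
abbrev Node : Type u := {v : V // 3 ≤ Γ.valency v}

/-- The set `ℰ` of end vertices. -/
abbrev Leaf : Type u := {v : V // Γ.valency v = 1}

/-- The vertices `[v₀ = v, v₁, …, vₖ = w]` of the unique minimal connected subgraph `[v, w]`,
in their order. -/
def path (v w : V) : List V := (Γ.isTree.existsUnique_path v w).choose.support

/-- The vertices of the open path `(v, w)`, starting on the side of `v`. -/
def interior (v w : V) : List V := (Γ.path v w).tail.dropLast

/-- `v` and `w` are joined by a (possibly empty) chain: no node lies strictly between them. -/
def Linked (v w : V) : Prop := ∀ x ∈ Γ.interior v w, Γ.valency x ≤ 2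

/-- The set `𝒩_n` of nodes which are connected to the node `n` by a chain. -/
def nbrs (n : Γ.Node) : Finset Γ.Node :=
  Finset.univ.filter fun n' => n' ≠ n ∧ Γ.Linked n n'

/-- The set `ℰ_n` of ends which are connected to the node `n` by a leg. -/
def leaves (n : Γ.Node) : Finset Γ.Leaf :=
  Finset.univ.filter fun u => Γ.Linked n u

/-- `δ_{n,𝒩} = |𝒩_n|`. -/
def nodeValency (n : Γ.Node) : ℕ := (Γ.nbrs n).card

/-- The set of the nodes with `δ_{n,𝒩} ≥ 2`. -/
def hatNodes : Finset Γ.Node := Finset.univ.filter fun n => 2 ≤ Γ.nodeValency n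

/-- For nodes `n`, `n'` joined by a chain, the nodes of the part `Γ_n` which contains `n` after the
chain `(n, n')` is removed. -/
def side (n n' : Γ.Node) : Finset Γ.Node :=
  Finset.univ.filter fun m => (n : V) ∈ Γ.path m n'

/-- The vertex `n_{n'}`: the first vertex after `n` on the way to `n'`. -/
def firstVertex (n n' : Γ.Node) : V := (Γ.path n n').getD 1 n

/-- The Seifert invariant `(α_{n,n'}, ω_{n,n'})` of the chain `(n, n')`, read from `n`. -/
def chainSeifert (n n' : Γ.Node) : ℤ × ℤ := contFrac ((Γ.interior n n').map fun v => -Γ.b v)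

/-- The Seifert invariant `(α_u, ω_u)` of the leg `(n, u]`, read from `n`. -/
def legSeifert (n : Γ.Node) (u : Γ.Leaf) : ℤ × ℤ :=
  contFrac ((Γ.path n u).tail.map fun v => -Γ.b v)

/-! ### The lattices `L ⊆ L'` inside `L ⊗ ℚ` (coordinates with respect to the basis `E_v`) -/

/-- The intersection matrix over `ℚ`. -/
def form : Matrix V V ℚ := (plumbingMatrix Γ.graph Γ.b).map (Int.cast : ℤ → ℚ)

/-- The dual lattice `L'`: all `x` with `(x, E_w) ∈ ℤ` for every `w`. -/
def dualLattice : AddSubgroup (V → ℚ) where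
  carrier := {x | ∀ w, ∃ k : ℤ, Matrix.vecMul x Γ.form w = k}
  zero_mem' := fun _ => ⟨0, by simp⟩
  add_mem' := fun {x y} hx hy v => by
    obtain ⟨k, hk⟩ := hx v
    obtain ⟨l, hl⟩ := hy v
    exact ⟨k + l, by simp [Matrix.add_vecMul, hk, hl]⟩
  neg_mem' := fun {x} hx v => by
    obtain ⟨k, hk⟩ := hx v
    exact ⟨-k, by simp [Matrix.neg_vecMul, hk]⟩

/-- The group `H = L'/L`. -/
abbrev H : Type u := Γ.dualLattice ⧸ (integerLattice V).addSubgroupOf Γ.dualLattice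

/-- The anti-dual vector `E_v^*`, with `(E_v^*, E_w) = -δ_{vw}`. -/
def dualVec (v : V) : V → ℚ := fun w => -(Γ.form⁻¹ v w)

theorem form_isUnit_det : IsUnit Γ.form.det := by
  rw [isUnit_iff_ne_zero]
  intro h0
  have h1 : Γ.form.det = (((plumbingMatrix Γ.graph Γ.b).det : ℤ) : ℚ) :=
    ((Int.castRingHom ℚ).map_det (plumbingMatrix Γ.graph Γ.b)).symm
  rw [h1] at h0
  have h2 : (plumbingMatrix Γ.graph Γ.b).det = 0 := by exact_mod_cast h0
  obtain ⟨x, hx, hx0⟩ := Matrix.exists_mulVec_eq_zero_iff.mpr h2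
  have := Γ.negDef x hx
  rw [hx0] at this
  simp at this

theorem dualVec_vecMul (v w : V) :
    Matrix.vecMul (Γ.dualVec v) Γ.form w = if v = w then -1 else 0 := by
  have h : Γ.form⁻¹ * Γ.form = 1 := Matrix.nonsing_inv_mul _ Γ.form_isUnit_det
  have h2 := congrFun (congrFun h v) w
  rw [Matrix.mul_apply, Matrix.one_apply] at h2
  simp only [Matrix.vecMul, dotProduct, dualVec, neg_mul, Finset.sum_neg_distrib, h2]
  split_ifs <;> simp

theorem dualVec_mem (v : V) : Γ.dualVec v ∈ Γ.dualLattice := by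
  intro w
  refine ⟨if v = w then -1 else 0, ?_⟩
  rw [dualVec_vecMul]
  split_ifs <;> simp

/-- `E_v^*` as an element of `L'`. -/
def Estar (v : V) : Γ.dualLattice := ⟨Γ.dualVec v, Γ.dualVec_mem v⟩

/-- The class `[l']` of `l' ∈ L'` in `H`. -/
def cls (x : Γ.dualLattice) : Γ.H := QuotientAddGroup.mk x

/-- The projection `π_𝒩` onto the node coordinates. -/
def proj (x : Γ.dualLattice) : Γ.Node → ℚ := fun n => (x : V → ℚ) n

/-! ### The Poincaré series -/

/-- The product `∏_v (1 - X_v)^{δ_v - 2}`, expanded at the origin.  As the `E_v^*` form a basis of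
`L'`, the coefficient of `∏_v X_v^{m_v}` is the coefficient `p_{l'}` of the topological Poincaré
series at `l' = ∑_v m_v E_v^*`. -/
def zeta : MvPowerSeries V ℤ :=
  ∏ v, ((1 - MvPowerSeries.X v) ^ Γ.valency v *
    (MvPowerSeries.invOfUnit (1 - MvPowerSeries.X v) 1) ^ 2)

/-- The exponents `m` for which `l' = ∑_v m_v E_v^*` satisfies `[l'] = h` and `π_𝒩(l') = x`. -/
def fiber (h : Γ.H) (x : Γ.Node → ℚ) : Set (V →₀ ℕ) :=
  {m | Γ.cls (∑ v, m v • Γ.Estar v) = h ∧ Γ.proj (∑ v, m v • Γ.Estar v) = x}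

/-- The reduced Poincaré series `Z_h(t_𝒩)`, given by its coefficient at each exponent `x`. -/
def reducedSeries (h : Γ.H) (x : Γ.Node → ℚ) : ℤ :=
  ∑ᶠ m ∈ Γ.fiber h x, MvPowerSeries.coeff m Γ.zeta

/-! ### Polynomial parts -/

/-- Laurent polynomials in the variables `t_n`, `n ∈ 𝒩`, with rational exponents. -/
abbrev Laurent : Type u := AddMonoidAlgebra ℤ (Γ.Node → ℚ)

/-- The monomial `t^x`. -/
def mono (x : Γ.Node → ℚ) : Γ.Laurent := AddMonoidAlgebra.single x 1

/-- An integral vector as a rational one. -/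
def toQ (l : Γ.Node → ℤ) : Γ.Node → ℚ := fun n => (l n : ℚ)

/-- `∏_{m ∈ S} (1 - t^{w_m})`. -/
def denom (w : Γ.Node → Γ.Node → ℤ) (S : Finset Γ.Node) : Γ.Laurent :=
  ∏ m ∈ S, (1 - Γ.mono (Γ.toQ (w m)))

/-- All exponents of `Q` belong to `π_𝒩(L')` and satisfy the condition `C`. -/
def SupportedOn (Q : Γ.Laurent) (C : Set (Γ.Node → ℚ)) : Prop :=
  ∀ x ∈ Q.coeff.support, x ∈ Set.range Γ.proj ∧ x ∈ C

/-- The semi-open box `∑_{m ∈ T} [0,1) w_m`; it is empty for `T = ∅` (nothing is a remainder of a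
division by `1`). -/
def semiBox (w : Γ.Node → Γ.Node → ℤ) (T : Finset Γ.Node) : Set (Γ.Node → ℚ) :=
  {y | T.Nonempty ∧ ∃ τ : Γ.Node → ℚ, (∀ m ∈ T, 0 ≤ τ m ∧ τ m < 1) ∧
    y = ∑ m ∈ T, τ m • Γ.toQ (w m)}

/-- `P` is the polynomial part, with respect to the variable `t_n`, of the fraction
`F / ∏_{m ∈ S} (1 - t^{w_m})`. -/
def IsNodeDivision (n : Γ.Node) (w : Γ.Node → Γ.Node → ℤ) (S : Finset Γ.Node)
    (F P : Γ.Laurent) : Prop :=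
  ∃ R : Γ.Laurent,
    F = P * Γ.denom w S + R ∧
    Γ.SupportedOn P {x | 0 ≤ x n} ∧
    Γ.SupportedOn R {x | ∃ y ∈ Γ.semiBox w S, x n = y n}

/-- `P` is the polynomial part, with respect to the variables `t_n`, `t_{n'}` of two nodes joined
by a chain, of the fraction `F / ∏_{m ∈ S} (1 - t^{w_m})`. -/
def IsChainDivision (n n' : Γ.Node) (w : Γ.Node → Γ.Node → ℤ) (S : Finset Γ.Node)
    (F P : Γ.Laurent) : Prop :=
  ∃ R₁ R₂ R : Γ.Laurent,
    F = P * Γ.denom w S + R₁ * Γ.denom w (S ∩ Γ.side n' n)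
      + R₂ * Γ.denom w (S ∩ Γ.side n n') + R ∧
    Γ.SupportedOn P {x | ¬ (x n < 0 ∧ x n' < 0)} ∧
    Γ.SupportedOn R₁ {x | ∃ y ∈ Γ.semiBox w (S ∩ Γ.side n n'), x n ≤ y n ∧ x n' = y n'} ∧
    Γ.SupportedOn R₂ {x | ∃ y ∈ Γ.semiBox w (S ∩ Γ.side n' n), x n = y n ∧ x n' ≤ y n'} ∧
    Γ.SupportedOn R {x | ∃ y ∈ Γ.semiBox w (S ∩ Γ.side n n'),
      ∃ y' ∈ Γ.semiBox w (S ∩ Γ.side n' n), x n = y n + y' n ∧ x n' = y n' + y' n'}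

/-- The formal series `z` is the fraction `F / ∏_{m ∈ S} (1 - t^{w_m})`, with `w_m` a positive
multiple of `π_𝒩(E_m^*)`: multiplying `z` by the denominator gives `F`. -/
def IsFraction (z : (Γ.Node → ℚ) → ℤ) (w : Γ.Node → Γ.Node → ℤ) (S : Finset Γ.Node)
    (F : Γ.Laurent) : Prop :=
  (∀ m ∈ S, ∃ c : ℚ, 0 < c ∧ Γ.toQ (w m) = c • Γ.proj (Γ.Estar m)) ∧
  ∀ x, (Γ.denom w S).coeff.sum (fun y c => c * z (x - y)) = F.coeff x

/-- `P` is the polynomial part of the series `z` with respect to `t_n`. -/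
def IsNodePart (z : (Γ.Node → ℚ) → ℤ) (n : Γ.Node) (P : Γ.Laurent) : Prop :=
  ∃ w S F, Γ.IsFraction z w S F ∧ Γ.IsNodeDivision n w S F P

/-- `P` is the polynomial part of the series `z` with respect to `t_n`, `t_{n'}`. -/
def IsChainPart (z : (Γ.Node → ℚ) → ℤ) (n n' : Γ.Node) (P : Γ.Laurent) : Prop :=
  ∃ w S F, Γ.IsFraction z w S F ∧ Γ.IsChainDivision n n' w S F P

/-- The element with the property `p`, when there is one (and `0` otherwise). -/
def pick (p : Γ.Laurent → Prop) : Γ.Laurent := if hp : ∃ P, p P then hp.choose else 0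

/-- `∑_{n<n'} A^{nn'} - ∑_n (δ_{n,𝒩} - 1) A^n`, where `n < n'` runs over the chains. -/
def assemble [PartialOrder Γ.Node] (A₂ : Γ.Node → Γ.Node → Γ.Laurent) (A₁ : Γ.Node → Γ.Laurent) :
    Γ.Laurent :=
  ∑ n, ∑ n' ∈ (Γ.nbrs n).filter (fun n' => n < n'), A₂ n n'
    - ∑ n, ((Γ.nodeValency n : ℤ) - 1) • A₁ n

/-- The polynomial part `P_h(t_𝒩)` of the reduced Poincaré series. -/
def polyPart [PartialOrder Γ.Node] (h : Γ.H) : Γ.Laurent :=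
  Γ.assemble (fun n n' => Γ.pick (Γ.IsChainPart (Γ.reducedSeries h) n n'))
    (fun n => Γ.pick (Γ.IsNodePart (Γ.reducedSeries h) n))

/-- The polynomial `Pol_{(x,I)}(t_𝒩)` of the fraction `t^x / ∏_{m ∈ I} (1 - t^{v_m})`. -/
def Pol [PartialOrder Γ.Node] (v : Γ.Node → Γ.Node → ℤ) (x : Γ.Node → ℚ) (I : Finset Γ.Node) :
    Γ.Laurent :=
  Γ.assemble (fun n n' => Γ.pick (Γ.IsChainDivision n n' v I (Γ.mono x)))
    (fun n => Γ.pick (Γ.IsNodeDivision n v I (Γ.mono x)))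

/-! ### Reduced lifts and the modules `𝓜_a` -/

/-- The integers `a_n` (`n ∈ 𝒩`), `a_u` (`u ∈ ℰ`) and `a_{n_{n'}}` (`n < n'` joined by a chain; the
other values of `chain` are never used). -/
structure LiftData where
  node : Γ.Node → ℤ
  leaf : Γ.Leaf → ℤ
  chain : Γ.Node → Γ.Node → ℤ

/-- The data `0`. -/
def zeroLift : Γ.LiftData := ⟨fun _ => 0, fun _ => 0, fun _ _ => 0⟩

/-- The data of `a - k`, where `k = ∑_n k_n E_n^*`. -/
def subLift (a : Γ.LiftData) (k : Γ.Node → ℕ) : Γ.LiftData :=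
  ⟨fun n => a.node n - k n, a.leaf, a.chain⟩

section Order

variable [PartialOrder Γ.Node]

/-- `a = ∑_n a_n E_n^* + ∑_u a_u E_u^* + ∑_{n<n'} a_{n_{n'}} E_{n_{n'}}^*`. -/
def liftElem (a : Γ.LiftData) : Γ.dualLattice :=
  ∑ n : Γ.Node, a.node n • Γ.Estar n + ∑ u : Γ.Leaf, a.leaf u • Γ.Estar u
    + ∑ n, ∑ n' ∈ (Γ.nbrs n).filter (fun n' => n < n'),
        a.chain n n' • Γ.Estar (Γ.firstVertex n n')

/-- `a` is a reduced lift of `h`. -/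
def IsReducedLift (a : Γ.LiftData) (h : Γ.H) : Prop := Γ.cls (Γ.liftElem a) = h

/-- `𝐜_a = π_𝒩(a)`. -/
def shift (a : Γ.LiftData) : Γ.Node → ℚ := Γ.proj (Γ.liftElem a)

/-- The affine lattice `ℤ^𝒩(a)`. -/
def affineLattice (a : Γ.LiftData) : Set (Γ.Node → ℤ) :=
  {l | ∀ n, ∀ n' ∈ Γ.nbrs n, n < n' →
    l n + (Γ.chainSeifert n' n).2 * l n' ≡ a.chain n n' [ZMOD (Γ.chainSeifert n n').1]}

/-- The quasilinear function `N_a(ℓ, n)`. -/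
def quasi (a : Γ.LiftData) (l : Γ.Node → ℤ) (n : Γ.Node) : ℚ :=
  a.node n
    + ∑ n' ∈ (Γ.nbrs n).filter (fun n' => n < n'),
        ((Γ.chainSeifert n n').2 : ℚ) / (Γ.chainSeifert n n').1 * a.chain n n'
    + ∑ n' ∈ (Γ.nbrs n).filter (fun n' => n' < n),
        1 / ((Γ.chainSeifert n n').1 : ℚ) * a.chain n' n
    - (Γ.b n + ∑ n' ∈ Γ.nbrs n, ((Γ.chainSeifert n n').2 : ℚ) / (Γ.chainSeifert n n').1) * l n
    - ∑ n' ∈ Γ.nbrs n, 1 / ((Γ.chainSeifert n n').1 : ℚ) * l n'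
    + ∑ u ∈ Γ.leaves n,
        (⌊((a.leaf u : ℚ) - (Γ.legSeifert n u).2 * l n) / (Γ.legSeifert n u).1⌋ : ℚ)

/-- The normalized function `N_a(ℓ, n) + ∑_{u ∈ ℰ_n} {(a_u - ω_u ℓ_n) / α_u}`. -/
def linear (a : Γ.LiftData) (l : Γ.Node → ℤ) (n : Γ.Node) : ℚ :=
  Γ.quasi a l n + ∑ u ∈ Γ.leaves n,
    Int.fract (((a.leaf u : ℚ) - (Γ.legSeifert n u).2 * l n) / (Γ.legSeifert n u).1)

/-- The module `𝓜_a` (a monoid for `a = 0`). -/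
def holeModule (a : Γ.LiftData) : Set (Γ.Node → ℤ) :=
  {l | l ∈ Γ.affineLattice a ∧ ∀ n, 0 ≤ Γ.quasi a l n}

/-- The normalization of `𝓜_a`. -/
def normModule (a : Γ.LiftData) : Set (Γ.Node → ℤ) :=
  {l | l ∈ Γ.affineLattice a ∧ ∀ n, 0 ≤ Γ.linear a l n}

/-- The orbifold intersection matrix `I^orb`. -/
def orbMatrix : Matrix Γ.Node Γ.Node ℚ := Matrix.of fun n n' =>
  if n = n' then
    Γ.b n + ∑ u ∈ Γ.leaves n, ((Γ.legSeifert n u).2 : ℚ) / (Γ.legSeifert n u).1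
      + ∑ m ∈ Γ.nbrs n, ((Γ.chainSeifert n m).2 : ℚ) / (Γ.chainSeifert n m).1
  else if n' ∈ Γ.nbrs n then 1 / ((Γ.chainSeifert n n').1 : ℚ) else 0

/-- The rational points of the cone `𝒞^orb = {y | -I^orb y ≥ 0}`. -/
def orbCone : Set (Γ.Node → ℚ) := {y | ∀ n, 0 ≤ (Matrix.mulVec (-Γ.orbMatrix) y) n}

/-- The vectors `v_n` belong to `𝓜_0`, span the cone `𝒞^orb`, and for every `ℓ` in the
normalization of `𝓜_a` one has `N_a(ℓ + v_n, n') = N_a(ℓ, n')` for `n' ≠ n` and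
`N_a(ℓ + v_n, n) ≥ κ`. -/
def IsGenerating (a : Γ.LiftData) (κ : ℚ) (v : Γ.Node → Γ.Node → ℤ) : Prop :=
  (∀ n, v n ∈ Γ.holeModule Γ.zeroLift) ∧
  {y : Γ.Node → ℚ | ∃ τ : Γ.Node → ℚ, (∀ n, 0 ≤ τ n) ∧ y = ∑ n, τ n • Γ.toQ (v n)} = Γ.orbCone ∧
  ∀ l ∈ Γ.normModule a, ∀ n,
    (∀ n', n' ≠ n → Γ.quasi a (l + v n) n' = Γ.quasi a l n') ∧ κ ≤ Γ.quasi a (l + v n) n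

/-- The levels `0 ≤ k ≤ δ - 2`: `0 ≤ k_n ≤ δ_{n,𝒩} - 2` for the nodes with `δ_{n,𝒩} ≥ 2`, and
`k_n = 0` for the other nodes. -/
def levels : Finset (Γ.Node → ℕ) :=
  Fintype.piFinset fun n =>
    if n ∈ Γ.hatNodes then Finset.range (Γ.nodeValency n - 1) else {0}

/-- `gr_k 𝓜⁻_{a,I}`. -/
def gradedHoles (v : Γ.Node → Γ.Node → ℤ) (a : Γ.LiftData) (k : Γ.Node → ℕ)
    (I : Finset Γ.Node) : Set (Γ.Node → ℤ) :=
  {l | l ∈ Γ.affineLattice a ∧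
    (∃ τ : Γ.Node → ℚ, (∀ n, 0 ≤ τ n ∧ τ n < 1) ∧
      Γ.toQ l + Γ.shift (Γ.subLift a k) = ∑ n, τ n • Γ.toQ (v n)) ∧
    (∀ n ∈ I \ Γ.hatNodes, Γ.quasi a l n < 0) ∧
    ∀ n ∈ Γ.hatNodes, Γ.quasi a l n = k n}

end Order

end PlumbingTree

end PlumbingDefinitions

end

/-! Write l' = ∑ m_v E_v^*. A vertex of valency 2 contributes the factor 1, so only the
multiplicities of nodes and ends matter. If l' has node coordinates 𝐜_a + ℓ, then [l'] = h says that
l' - a is integral at every vertex. Along a chain or a leg the coordinates satisfy a linear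
recurrence with integer coefficients, so it suffices to test one vertex next to a node. On a chain
this is the congruence defining ℤ^𝒩(a); on a leg it says m_u ≡ a_u - ω_u ℓ_n mod α_u, so that m_u is
the residue plus α_u q_u with q_u ≥ 0. The map -I^orb inverts the matrix of node coordinates of the
E_n^* (`orb_dualVec_node`) and turns the remaining equations into m_n + ∑_{u ∈ ℰ_n} q_u = N_a(ℓ, n)
(`expand_bijOn`). Hence the coefficient of Z_h at 𝐜_a + ℓ is a product over the nodes: the factor at
n is the coefficient of s^{N_a(ℓ,n)} in (1-s)^{δ_n-2} (1-s)^{-|ℰ_n|} = (1-s)^{δ_{n,𝒩}-2}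
(`reducedSeries_eq_prod`).

At n ∈ 𝒩̂ this local series is a polynomial, at the other nodes the geometric series. So Z_h is the
sum over the levels k, with signed binomials, of the characteristic series of the sets where N_a =
k_n on 𝒩̂ and N_a ≥ 0 elsewhere. Adding 𝔳_m changes N_a at m only and brings it above k_m. Reduction
modulo the 𝔳_m therefore writes a point of such a set uniquely as ℓ₀ + ∑_{m ∉ 𝒩̂} j_m 𝔳_m with ℓ₀ in
the translated box, and the only restriction on the j_m ≥ 0 is j_m ≥ 1 where N_a(ℓ₀, m) < 0. Each ℓ₀
gives a simplicial cone, i.e. a monomial over ∏_{m ∉ 𝒩̂} (1 - t^{𝔳_m})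
(`reducedSeries_eq_sum_coneInd`). Expanding the extra factors t^{𝔳_m} = 1 - (1 - t^{𝔳_m}) cancels
parts of the denominator; the set of cancelled nodes is 𝓘 ∖ 𝒩̂, which produces the alternating sum
(`mon_add_sum`, `sum_powerset_negNodes`).

It remains to see that taking polynomial parts is additive and independent of the fraction. The 𝔳_m
are positive multiples of π_𝒩(E_m^*) (`IsGenerating.posWeights`). For one node the polynomial part
comes from division with respect to the degree x_n. For a chain, every E_m^* projects to the ray of
E_n^* or of E_{n'}^* in the (n, n') plane (`dualVec_separates`), and repeated division with respect
to linear forms on this plane gives existence (`exists_chainDivision`). Uniqueness holds because the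
total remainder has smaller degree than the denominator in both x_n and x_{n'}: two quotients could
differ only by exponents with both coordinates negative, and these are excluded
(`chainDivision_unique`). Enlarging numerator and denominator by a common factor keeps the
polynomial part, so the elementary fractions can be added over a common denominator. -/

noncomputable section
open scoped Classical
universe u
namespace PlumbingTree
variable {V : Type u} [Fintype V] [DecidableEq V] (Γ : PlumbingTree V)

/-! ### Paths in the tree -/

/-- The unique path from `v` to `w`, as a walk. -/
def walk (v w : V) : Γ.graph.Walk v w := (Γ.isTree.existsUnique_path v w).choose

theorem walk_isPath (v w : V) : (Γ.walk v w).IsPath :=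
  (Γ.isTree.existsUnique_path v w).choose_spec.1

theorem eq_walk {v w : V} {p : Γ.graph.Walk v w} (hp : p.IsPath) : p = Γ.walk v w :=
  (Γ.isTree.existsUnique_path v w).choose_spec.2 p hp

/-- The `i`-th vertex of the path from `v` to `w`. -/
def pt (v w : V) (i : ℕ) : V := (Γ.walk v w).getVert i

/-- The number of edges of the path from `v` to `w`. -/
def len (v w : V) : ℕ := (Γ.walk v w).length

@[simp] theorem pt_zero (v w : V) : Γ.pt v w 0 = v := by simp [pt]

@[simp] theorem pt_len (v w : V) : Γ.pt v w (Γ.len v w) = w := by simp [pt, len]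

theorem pt_adj {v w : V} {i : ℕ} (hi : i < Γ.len v w) :
    Γ.graph.Adj (Γ.pt v w i) (Γ.pt v w (i + 1)) :=
  (Γ.walk v w).adj_getVert_succ hi

theorem pt_inj {v w : V} {i j : ℕ} (hi : i ≤ Γ.len v w) (hj : j ≤ Γ.len v w)
    (h : Γ.pt v w i = Γ.pt v w j) : i = j :=
  (Γ.walk_isPath v w).getVert_injOn hi hj h

theorem len_lt_card (v w : V) : Γ.len v w < Fintype.card V := (Γ.walk_isPath v w).length_lt

theorem len_pos {v w : V} (h : v ≠ w) : 0 < Γ.len v w := by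
  rcases Nat.eq_zero_or_pos (Γ.len v w) with h0 | h0
  · have h1 := Γ.pt_len v w
    rw [h0, pt_zero] at h1
    exact absurd h1 h
  · exact h0

@[simp] theorem len_self (v : V) : Γ.len v v = 0 :=
  Γ.pt_inj le_rfl (Nat.zero_le _) (by simp)

theorem pt_ne_start {v w : V} {i : ℕ} (h0 : 0 < i) (hi : i ≤ Γ.len v w) : Γ.pt v w i ≠ v := by
  intro h
  have := Γ.pt_inj hi (Nat.zero_le _) (by rw [h, pt_zero])
  omega

theorem pt_ne_end {v w : V} {i : ℕ} (hi : i < Γ.len v w) : Γ.pt v w i ≠ w := by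
  intro h
  have := Γ.pt_inj hi.le le_rfl (by rw [h, pt_len])
  omega

theorem len_pt_of_isPath {v w : V} {p : Γ.graph.Walk v w} (hp : p.IsPath) :
    Γ.len v w = p.length ∧ ∀ i, Γ.pt v w i = p.getVert i := by
  have := Γ.eq_walk hp
  subst this
  exact ⟨rfl, fun _ => rfl⟩

theorem pt_rev (v w : V) (i : ℕ) : Γ.pt w v i = Γ.pt v w (Γ.len v w - i) := by
  rw [(Γ.len_pt_of_isPath (Γ.walk_isPath v w).reverse).2, SimpleGraph.Walk.getVert_reverse]
  rfl

theorem len_comm (v w : V) : Γ.len w v = Γ.len v w := by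
  rw [(Γ.len_pt_of_isPath (Γ.walk_isPath v w).reverse).1, SimpleGraph.Walk.length_reverse]
  rfl

theorem prefix_spec {v w : V} {i : ℕ} (hi : i ≤ Γ.len v w) :
    Γ.len v (Γ.pt v w i) = i ∧ ∀ j ≤ i, Γ.pt v (Γ.pt v w i) j = Γ.pt v w j := by
  have hp : ((Γ.walk v w).take i).IsPath := (Γ.walk_isPath v w).take i
  obtain ⟨h1, h2⟩ := Γ.len_pt_of_isPath hp
  have hlen : ((Γ.walk v w).take i).length = i := by
    rw [SimpleGraph.Walk.take_length]; exact min_eq_left hi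
  refine ⟨h1.trans hlen, fun j hj => (h2 j).trans ?_⟩
  rw [SimpleGraph.Walk.take_getVert, min_eq_right hj]
  rfl

theorem path_eq (v w : V) : Γ.path v w = (List.range (Γ.len v w + 1)).map (Γ.pt v w) := by
  have hl : (Γ.path v w).length = Γ.len v w + 1 := (Γ.walk v w).length_support
  apply List.ext_getElem
  · simp [hl]
  · intro i h1 h2
    simp only [List.getElem_map, List.getElem_range]
    exact (Γ.walk v w).support_getElem_eq_getVert h1

theorem mem_path {v w x : V} : x ∈ Γ.path v w ↔ ∃ i ≤ Γ.len v w, Γ.pt v w i = x := by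
  rw [path_eq]
  simp

theorem path_tail (v w : V) :
    (Γ.path v w).tail = (List.range (Γ.len v w)).map fun i => Γ.pt v w (i + 1) := by
  rw [path_eq, List.range_succ_eq_map]
  simp [Function.comp_def]

theorem interior_eq (v w : V) :
    Γ.interior v w = (List.range (Γ.len v w - 1)).map fun i => Γ.pt v w (i + 1) := by
  rw [interior, path_tail]
  cases h : Γ.len v w with
  | zero => simp
  | succ n => simp [List.range_succ]

theorem mem_interior {v w x : V} :
    x ∈ Γ.interior v w ↔ ∃ i, 0 < i ∧ i < Γ.len v w ∧ Γ.pt v w i = x := by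
  rw [interior_eq]
  simp only [List.mem_map, List.mem_range]
  constructor
  · rintro ⟨i, hi, rfl⟩
    exact ⟨i + 1, by omega, by omega, rfl⟩
  · rintro ⟨i, h0, hi, rfl⟩
    exact ⟨i - 1, by omega, by rw [Nat.sub_add_cancel h0]⟩

theorem linked_iff {v w : V} :
    Γ.Linked v w ↔ ∀ i, 0 < i → i < Γ.len v w → Γ.valency (Γ.pt v w i) ≤ 2 := by
  simp only [Linked, mem_interior]
  constructor
  · exact fun h i h0 hi => h _ ⟨i, h0, hi, rfl⟩
  · rintro h x ⟨i, h0, hi, rfl⟩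
    exact h i h0 hi

theorem Linked.symm {v w : V} (h : Γ.Linked v w) : Γ.Linked w v := by
  rw [linked_iff] at h ⊢
  intro i h0 hi
  rw [len_comm] at hi
  rw [pt_rev]
  exact h _ (by omega) (by omega)

/-- The first vertex after `v` on the path to `w`. -/
def next (v w : V) : V := Γ.pt v w 1

theorem firstVertex_eq (n n' : Γ.Node) : Γ.firstVertex n n' = Γ.next n n' := by
  rw [firstVertex, path_eq, next]
  rcases eq_or_ne (n : V) n' with h | h
  · rw [← h, len_self, pt, SimpleGraph.Walk.getVert_of_length_le _ (by exact (Γ.len_self n).le.trans zero_le_one)]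
    simp
  · have := Γ.len_pos h
    simp [List.getD, this]

theorem next_adj {v w : V} (h : v ≠ w) : Γ.graph.Adj v (Γ.next v w) := by
  have := Γ.pt_adj (Γ.len_pos h)
  simpa [next] using this

/-- Acyclicity: if `y'` lies on the path from `a` to `y`, then `y` is not on the path from `a` to
`y'`. So one of the two paths is the other one with the edge appended. -/
theorem step {y y' : V} (a : V) (h : Γ.graph.Adj y y') :
    (Γ.len a y' = Γ.len a y + 1 ∧ ∀ i ≤ Γ.len a y, Γ.pt a y' i = Γ.pt a y i) ∨
    (Γ.len a y = Γ.len a y' + 1 ∧ ∀ i ≤ Γ.len a y', Γ.pt a y i = Γ.pt a y' i) := by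
  have key : ∀ {y y' : V} (h : Γ.graph.Adj y y') (hy : y' ∉ (Γ.walk a y).support),
      (Γ.len a y' = Γ.len a y + 1 ∧ ∀ i ≤ Γ.len a y, Γ.pt a y' i = Γ.pt a y i) := by
    intro y y' h hy
    obtain ⟨h1, h2⟩ := Γ.len_pt_of_isPath ((Γ.walk_isPath a y).concat hy h)
    refine ⟨by rw [h1, SimpleGraph.Walk.length_concat]; rfl, fun i hi => ?_⟩
    rw [h2, SimpleGraph.Walk.concat_eq_append, SimpleGraph.Walk.getVert_append]
    have hi : i ≤ (Γ.walk a y).length := hi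
    split_ifs with h'
    · rfl
    · have : i = (Γ.walk a y).length := by omega
      subst this
      simp [pt]
  by_cases hy : y' ∈ (Γ.walk a y).support
  · right
    refine key h.symm ?_
    exact Γ.isTree.isAcyclic.ne_mem_support_of_support_of_adj_of_isPath (Γ.walk_isPath a y)
      (Γ.walk_isPath a y') h hy
  · exact Or.inl (key h hy)

theorem next_eq_of_adj {a y y' : V} (h : Γ.graph.Adj y y') (hy : a ≠ y) (hy' : a ≠ y') :
    Γ.next a y = Γ.next a y' := by
  rcases Γ.step a h with ⟨-, h2⟩ | ⟨-, h2⟩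
  · exact (h2 1 (Γ.len_pos hy)).symm
  · exact h2 1 (Γ.len_pos hy')

theorem next_of_adj {a w : V} (h : Γ.graph.Adj a w) : Γ.next a w = w ∧ Γ.len a w = 1 := by
  have hl : Γ.len a w = 1 := by
    rcases Γ.step a h with ⟨h1, -⟩ | ⟨h1, -⟩
    · simpa using h1
    · simp at h1
  refine ⟨?_, hl⟩
  have := Γ.pt_len a w
  rwa [hl] at this

/-- If the paths from `a` to `z` and to `z'` start differently, then `a` separates `z` from `z'`. -/
theorem mem_path_of_next_ne {a z z' : V} (h : Γ.next a z ≠ Γ.next a z') : a ∈ Γ.path z z' := by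
  by_contra ha
  have hi : ∀ i ≤ Γ.len z z', a ≠ Γ.pt z z' i := fun i hi he => ha (Γ.mem_path.2 ⟨i, hi, he.symm⟩)
  have : ∀ i ≤ Γ.len z z', Γ.next a z = Γ.next a (Γ.pt z z' i) := by
    intro i
    induction i with
    | zero => simp
    | succ i ih =>
      intro h1
      rw [ih (by omega)]
      exact Γ.next_eq_of_adj (Γ.pt_adj (by omega)) (hi _ (by omega)) (hi _ h1)
  have := this _ le_rfl
  rw [pt_len] at this
  exact h this

/-! ### Vertices of valency at most two -/

theorem valency_eq_card (v : V) : Γ.valency v = (Γ.graph.neighborFinset v).card := rfl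

/-- The predecessor and the successor on a path are two distinct neighbours, and valency at most 2
leaves room for no other. -/
theorem neighborFinset_pt {v w : V} {i : ℕ} (hi : i + 1 < Γ.len v w)
    (h : Γ.valency (Γ.pt v w (i + 1)) ≤ 2) :
    Γ.graph.neighborFinset (Γ.pt v w (i + 1)) = {Γ.pt v w i, Γ.pt v w (i + 2)} := by
  have hne : Γ.pt v w i ≠ Γ.pt v w (i + 2) := fun h' => by
    have := Γ.pt_inj (by omega) (by omega) h'
    omega
  symm
  apply Finset.eq_of_subset_of_card_le
  · intro x hx
    simp only [Finset.mem_insert, Finset.mem_singleton] at hx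
    rw [SimpleGraph.mem_neighborFinset]
    rcases hx with rfl | rfl
    · exact (Γ.pt_adj (by omega)).symm
    · exact Γ.pt_adj hi
  · rw [Finset.card_pair hne]
    exact h

theorem valency_interior {v w x : V} (h : Γ.Linked v w) (hx : x ∈ Γ.interior v w) :
    Γ.valency x = 2 := by
  obtain ⟨i, h0, hi, rfl⟩ := Γ.mem_interior.1 hx
  obtain ⟨j, rfl⟩ : ∃ j, i = j + 1 := ⟨i - 1, by omega⟩
  have := Γ.neighborFinset_pt hi (Γ.linked_iff.1 h _ h0 hi)
  rw [valency_eq_card, this, Finset.card_pair]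
  intro h'
  have := Γ.pt_inj (by omega) (by omega) h'
  omega

/-- A chain is determined by its first edge: any path which starts like a chain follows it. -/
theorem pt_eq_of_next_eq {a z z' : V} (hz : Γ.Linked a z)
    (h : Γ.next a z = Γ.next a z') :
    ∀ i, i ≤ Γ.len a z → i ≤ Γ.len a z' → Γ.pt a z i = Γ.pt a z' i := by
  intro i
  induction i using Nat.strong_induction_on with
  | _ i ih =>
    intro h1 h2
    match i with
    | 0 => simp
    | 1 => exact h
    | i + 2 =>
      have e1 := ih (i + 1) (by omega) (by omega) (by omega)
      have e0 := ih i (by omega) (by omega) (by omega)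
      have hn := Γ.neighborFinset_pt (i := i) h1 (Γ.linked_iff.1 hz _ (by omega) (by omega))
      have hm : Γ.pt a z' (i + 2) ∈ Γ.graph.neighborFinset (Γ.pt a z (i + 1)) := by
        rw [SimpleGraph.mem_neighborFinset, e1]
        exact Γ.pt_adj h2
      rw [hn] at hm
      simp only [Finset.mem_insert, Finset.mem_singleton] at hm
      rcases hm with hm | hm
      · rw [e0] at hm
        have := Γ.pt_inj (by omega) (by omega) hm
        omega
      · exact hm.symm

theorem mem_interior_of_next_eq {a z z' : V} (hz : Γ.Linked a z) (hne : a ≠ z')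
    (h : Γ.next a z = Γ.next a z') (hlt : Γ.len a z' < Γ.len a z) : z' ∈ Γ.interior a z := by
  refine Γ.mem_interior.2 ⟨Γ.len a z', Γ.len_pos hne, hlt, ?_⟩
  rw [Γ.pt_eq_of_next_eq hz h _ hlt.le le_rfl, pt_len]

/-- Otherwise the shorter of the two chains would end inside the longer one, at a vertex of valency
2. Thus the chains and legs leaving a node are labelled by its edges. -/
theorem eq_of_next_eq {a e e' : V} (he : Γ.Linked a e) (he' : Γ.Linked a e')
    (hv : Γ.valency e ≠ 2) (hv' : Γ.valency e' ≠ 2) (hne : a ≠ e) (hne' : a ≠ e')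
    (h : Γ.next a e = Γ.next a e') : e = e' := by
  rcases lt_trichotomy (Γ.len a e) (Γ.len a e') with hl | hl | hl
  · exact absurd (Γ.valency_interior he' (Γ.mem_interior_of_next_eq he' hne h.symm hl)) hv
  · have := Γ.pt_eq_of_next_eq he h _ le_rfl hl.le
    rwa [pt_len, hl, pt_len] at this
  · exact absurd (Γ.valency_interior he (Γ.mem_interior_of_next_eq he hne' h hl)) hv'

/-- Every edge at `a` starts a chain which ends at a vertex of valency different from `2`. -/
theorem exists_linked {a w : V} (h : Γ.graph.Adj a w) :
    ∃ e, a ≠ e ∧ Γ.valency e ≠ 2 ∧ Γ.Linked a e ∧ Γ.next a e = w := by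
  -- Prolong the chain as long as its end has valency 2. Path lengths are bounded by the number of
  -- vertices, so `k` decreases.
  have key : ∀ k z, Fintype.card V - Γ.len a z = k → a ≠ z → Γ.Linked a z → Γ.next a z = w →
      ∃ e, a ≠ e ∧ Γ.valency e ≠ 2 ∧ Γ.Linked a e ∧ Γ.next a e = w := by
    intro k
    induction k using Nat.strong_induction_on with
    | _ k ih =>
      intro z hk hne hl hn
      by_cases hv : Γ.valency z = 2
      · have hpos := Γ.len_pos hne
        obtain ⟨z', hz', hz'ne⟩ : ∃ z' ∈ Γ.graph.neighborFinset z, z' ≠ Γ.pt a z (Γ.len a z - 1) := by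
          apply Finset.exists_mem_ne
          rw [← valency_eq_card, hv]; norm_num
        rw [SimpleGraph.mem_neighborFinset] at hz'
        rcases Γ.step a hz' with ⟨h1, h2⟩ | ⟨h1, h2⟩
        · have hne' : a ≠ z' := by
            rintro rfl
            simp at h1
          refine ih _ ?_ z' rfl hne' ?_ ?_
          · have := Γ.len_lt_card a z'
            omega
          · rw [linked_iff] at hl ⊢
            intro i h0 hi
            rw [h2 i (by omega)]
            rcases Nat.lt_or_ge i (Γ.len a z) with h' | h'
            · exact hl i h0 h'
            · have : i = Γ.len a z := by omega
              rw [this, pt_len, hv]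
          · rw [← Γ.next_eq_of_adj hz' hne hne', hn]
        · exfalso
          apply hz'ne
          rw [h1, Nat.add_sub_cancel, h2 _ le_rfl, pt_len]
      · exact ⟨z, hne, hv, hl, hn⟩
  obtain ⟨h1, h2⟩ := Γ.next_of_adj h
  refine key _ w rfl h.ne ?_ h1
  rw [linked_iff]
  intro i h0 hi
  omega

end PlumbingTree
end
-- Chains, legs and the two sides of a chain
noncomputable section
open scoped Classical
universe u
namespace PlumbingTree
variable {V : Type u} [Fintype V] [DecidableEq V] (Γ : PlumbingTree V)

theorem suffix_spec {v w : V} {i : ℕ} (hi : i ≤ Γ.len v w) :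
    Γ.len (Γ.pt v w i) w = Γ.len v w - i ∧
      ∀ j ≤ Γ.len v w - i, Γ.pt (Γ.pt v w i) w j = Γ.pt v w (i + j) := by
  have e : Γ.pt w v (Γ.len v w - i) = Γ.pt v w i := by
    rw [pt_rev]; congr 1; omega
  have hl : Γ.len w v = Γ.len v w := Γ.len_comm v w
  obtain ⟨h1, h2⟩ := Γ.prefix_spec (v := w) (w := v) (i := Γ.len v w - i) (by omega)
  rw [e] at h1 h2
  have h3 : Γ.len (Γ.pt v w i) w = Γ.len v w - i := by rw [len_comm, h1]
  refine ⟨h3, fun j hj => ?_⟩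
  rw [pt_rev, h1, h2 _ (by omega), pt_rev]
  congr 1; omega

theorem linked_prefix {v w x : V} (h : Γ.Linked v w) (hx : x ∈ Γ.interior v w) :
    Γ.Linked v x := by
  obtain ⟨i, h0, hi, rfl⟩ := Γ.mem_interior.1 hx
  obtain ⟨h1, h2⟩ := Γ.prefix_spec hi.le
  rw [linked_iff] at h ⊢
  intro j hj0 hj
  rw [h1] at hj
  rw [h2 j hj.le]
  exact h j hj0 (by omega)

theorem interior_comm {v w x : V} : x ∈ Γ.interior v w ↔ x ∈ Γ.interior w v := by
  have key : ∀ {v w : V}, x ∈ Γ.interior v w → x ∈ Γ.interior w v := by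
    intro v w hx
    obtain ⟨i, h0, hi, rfl⟩ := Γ.mem_interior.1 hx
    have := Γ.len_comm v w
    refine Γ.mem_interior.2 ⟨Γ.len v w - i, by omega, by omega, ?_⟩
    rw [pt_rev]; congr 1; omega
  exact ⟨key, key⟩

theorem path_comm {v w x : V} : x ∈ Γ.path v w ↔ x ∈ Γ.path w v := by
  have key : ∀ {v w : V}, x ∈ Γ.path v w → x ∈ Γ.path w v := by
    intro v w hx
    obtain ⟨i, hi, rfl⟩ := Γ.mem_path.1 hx
    have := Γ.len_comm v w
    refine Γ.mem_path.2 ⟨Γ.len v w - i, by omega, ?_⟩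
    rw [pt_rev]; congr 1; omega
  exact ⟨key, key⟩

theorem ne_of_mem_interior {v w x : V} (hx : x ∈ Γ.interior v w) : v ≠ w ∧ x ≠ v ∧ x ≠ w := by
  obtain ⟨i, h0, hi, rfl⟩ := Γ.mem_interior.1 hx
  refine ⟨?_, Γ.pt_ne_start h0 hi.le, Γ.pt_ne_end hi⟩
  rintro rfl
  simp at hi

/-- The ends of a chain are the only vertices of valency different from `2` which are joined by a
chain to a given interior vertex. -/
theorem eq_or_eq_of_linked_interior {v w x e : V} (h : Γ.Linked v w) (hx : x ∈ Γ.interior v w)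
    (hv : Γ.valency v ≠ 2) (hw : Γ.valency w ≠ 2) (he : Γ.valency e ≠ 2) (hxe : Γ.Linked x e) :
    e = v ∨ e = w := by
  have hx2 := Γ.valency_interior h hx
  have hxv := (Γ.linked_prefix h hx).symm
  have hxw := (Γ.linked_prefix h.symm (Γ.interior_comm.1 hx)).symm
  obtain ⟨-, nv, nw⟩ := Γ.ne_of_mem_interior hx
  have nxe : x ≠ e := by rintro rfl; exact he hx2
  obtain ⟨i, h0, hi, rfl⟩ := Γ.mem_interior.1 hx
  obtain ⟨j, rfl⟩ : ∃ j, i = j + 1 := ⟨i - 1, by omega⟩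
  have hn := Γ.neighborFinset_pt hi hx2.le
  have hm := (SimpleGraph.mem_neighborFinset _ _ _).2 (Γ.next_adj nxe)
  rw [hn] at hm
  simp only [Finset.mem_insert, Finset.mem_singleton] at hm
  rcases hm with hm | hm
  · left
    refine Γ.eq_of_next_eq hxe hxv he hv nxe nv ?_
    rw [hm, next, Γ.pt_rev v (Γ.pt v w (j + 1)), (Γ.prefix_spec hi.le).1,
      (Γ.prefix_spec hi.le).2 _ (by omega)]
    congr 1
  · right
    refine Γ.eq_of_next_eq hxe hxw he hw nxe nw ?_
    rw [hm, next, (Γ.suffix_spec hi.le).2 _ (by omega)]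

theorem one_le_valency_of_ne {v w : V} (h : v ≠ w) : 1 ≤ Γ.valency v := by
  rw [valency_eq_card, Nat.one_le_iff_ne_zero, Finset.card_ne_zero]
  exact ⟨_, (SimpleGraph.mem_neighborFinset _ _ _).2 (Γ.next_adj h)⟩

theorem node_or_leaf {v w : V} (h : v ≠ w) (hv : Γ.valency v ≠ 2) :
    3 ≤ Γ.valency v ∨ Γ.valency v = 1 := by
  have := Γ.one_le_valency_of_ne h
  omega

theorem node_valency_ne (n : Γ.Node) : Γ.valency n ≠ 2 := by
  have := n.2
  omega

theorem leaf_valency_ne (u : Γ.Leaf) : Γ.valency u ≠ 2 := by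
  have := u.2
  omega

theorem node_ne_leaf (n : Γ.Node) (u : Γ.Leaf) : (n : V) ≠ u := by
  intro h
  have h1 := n.2
  rw [h, u.2] at h1
  omega

theorem mem_nbrs {n n' : Γ.Node} : n' ∈ Γ.nbrs n ↔ n' ≠ n ∧ Γ.Linked n n' := by
  simp [nbrs]

theorem mem_leaves {n : Γ.Node} {u : Γ.Leaf} : u ∈ Γ.leaves n ↔ Γ.Linked n u := by
  simp [leaves]

theorem nbrs_comm {n n' : Γ.Node} : n' ∈ Γ.nbrs n ↔ n ∈ Γ.nbrs n' := by
  rw [mem_nbrs, mem_nbrs]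
  exact ⟨fun h => ⟨h.1.symm, h.2.symm⟩, fun h => ⟨h.1.symm, h.2.symm⟩⟩

theorem ne_of_mem_nbrs {n n' : Γ.Node} (h : n' ∈ Γ.nbrs n) : (n : V) ≠ n' := fun e =>
  (Γ.mem_nbrs.1 h).1 (Subtype.ext e.symm)

/-- The neighbours of a node are the first vertices of the chains and of the legs at this node. -/
theorem sum_neighbors {M : Type*} [AddCommMonoid M] (n : Γ.Node) (f : V → M) :
    ∑ w ∈ Γ.graph.neighborFinset n, f w =
      ∑ n' ∈ Γ.nbrs n, f (Γ.next n n') + ∑ u ∈ Γ.leaves n, f (Γ.next n u) := by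
  have h1 : ∑ e ∈ Finset.univ.filter (fun e => (n : V) ≠ e ∧ Γ.valency e ≠ 2 ∧ Γ.Linked n e),
      f (Γ.next n e) = ∑ w ∈ Γ.graph.neighborFinset n, f w := by
    refine Finset.sum_bij (fun e _ => Γ.next n e) ?_ ?_ ?_ ?_
    · intro e he
      exact (SimpleGraph.mem_neighborFinset _ _ _).2 (Γ.next_adj (Finset.mem_filter.1 he).2.1)
    · intro e he e' he' h
      obtain ⟨-, a1, a2, a3⟩ := Finset.mem_filter.1 he
      obtain ⟨-, b1, b2, b3⟩ := Finset.mem_filter.1 he'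
      exact Γ.eq_of_next_eq a3 b3 a2 b2 a1 b1 h
    · intro w hw
      obtain ⟨e, a1, a2, a3, a4⟩ := Γ.exists_linked ((SimpleGraph.mem_neighborFinset _ _ _).1 hw)
      exact ⟨e, Finset.mem_filter.2 ⟨Finset.mem_univ _, a1, a2, a3⟩, a4⟩
    · intros; rfl
  have h2 : Finset.univ.filter (fun e => (n : V) ≠ e ∧ Γ.valency e ≠ 2 ∧ Γ.Linked n e) =
      (Γ.nbrs n).map (Function.Embedding.subtype _) ∪
        (Γ.leaves n).map (Function.Embedding.subtype _) := by
    ext e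
    simp only [Finset.mem_filter, Finset.mem_univ, true_and, Finset.mem_union, Finset.mem_map,
      mem_nbrs, mem_leaves, Function.Embedding.subtype_apply]
    constructor
    · rintro ⟨a1, a2, a3⟩
      rcases Γ.node_or_leaf a1.symm a2 with h | h
      · exact Or.inl ⟨⟨e, h⟩, ⟨fun h' => a1 (congrArg Subtype.val h').symm, a3⟩, rfl⟩
      · exact Or.inr ⟨⟨e, h⟩, a3, rfl⟩
    · rintro (⟨n', ⟨a1, a2⟩, rfl⟩ | ⟨u, a, rfl⟩)
      · exact ⟨fun h => a1 (Subtype.ext h.symm), Γ.node_valency_ne n', a2⟩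
      · exact ⟨Γ.node_ne_leaf n u, Γ.leaf_valency_ne u, a⟩
  rw [← h1, h2, Finset.sum_union, Finset.sum_map, Finset.sum_map]
  · rfl
  · rw [Finset.disjoint_left]
    intro e he he'
    obtain ⟨n', -, rfl⟩ := Finset.mem_map.1 he
    obtain ⟨u, -, h⟩ := Finset.mem_map.1 he'
    exact Γ.node_ne_leaf n' u h.symm

theorem valency_node (n : Γ.Node) : Γ.valency n = Γ.nodeValency n + (Γ.leaves n).card := by
  have := Γ.sum_neighbors n fun _ => 1
  simpa [valency, nodeValency] using this

/-- Every end belongs to exactly one leg. -/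
theorem existsUnique_leaves [Nonempty Γ.Node] (u : Γ.Leaf) : ∃! n : Γ.Node, u ∈ Γ.leaves n := by
  -- Take a nearest node: a node strictly inside the path to it would be nearer.
  obtain ⟨n, -, hn⟩ := Finset.exists_min_image Finset.univ (fun n : Γ.Node => Γ.len u n)
    Finset.univ_nonempty
  have hl : Γ.Linked u n := by
    rw [linked_iff]
    intro i h0 hi
    by_contra hv
    have := hn ⟨Γ.pt u n i, by omega⟩ (Finset.mem_univ _)
    rw [(Γ.prefix_spec hi.le).1] at this
    omega
  refine ⟨n, Γ.mem_leaves.2 hl.symm, fun n' hn' => ?_⟩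
  have hl' := (Γ.mem_leaves.1 hn').symm
  have hc : (Γ.graph.neighborFinset (u : V)).card ≤ 1 := by
    rw [← valency_eq_card, u.2]
  apply Subtype.ext
  refine Γ.eq_of_next_eq hl' hl (Γ.node_valency_ne _) (Γ.node_valency_ne _) (Γ.node_ne_leaf _ _).symm
    (Γ.node_ne_leaf _ _).symm ?_
  exact Finset.card_le_one.1 hc _
    ((SimpleGraph.mem_neighborFinset _ _ _).2 (Γ.next_adj (Γ.node_ne_leaf _ _).symm)) _
    ((SimpleGraph.mem_neighborFinset _ _ _).2 (Γ.next_adj (Γ.node_ne_leaf _ _).symm))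

/-- The node to which an end is attached. -/
def base [Nonempty Γ.Node] (u : Γ.Leaf) : Γ.Node := (Γ.existsUnique_leaves u).choose

theorem mem_leaves_base [Nonempty Γ.Node] (u : Γ.Leaf) : u ∈ Γ.leaves (Γ.base u) :=
  (Γ.existsUnique_leaves u).choose_spec.1

theorem mem_leaves_iff [Nonempty Γ.Node] {n : Γ.Node} {u : Γ.Leaf} :
    u ∈ Γ.leaves n ↔ Γ.base u = n :=
  ⟨fun h => ((Γ.existsUnique_leaves u).choose_spec.2 n h).symm, fun h => h ▸ Γ.mem_leaves_base u⟩

theorem not_linked_leaf_leaf [Nonempty Γ.Node] {u u' : Γ.Leaf} (h : (u : V) ≠ u') :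
    ¬ Γ.Linked u u' := by
  intro hl
  have hb := (Γ.mem_leaves.1 (Γ.mem_leaves_base u)).symm
  have hc : (Γ.graph.neighborFinset (u : V)).card ≤ 1 := by
    rw [← valency_eq_card, u.2]
  apply Γ.node_ne_leaf (Γ.base u) u'
  refine Γ.eq_of_next_eq hb hl (Γ.node_valency_ne _) (Γ.leaf_valency_ne _) (Γ.node_ne_leaf _ _).symm
    h ?_
  exact Finset.card_le_one.1 hc _
    ((SimpleGraph.mem_neighborFinset _ _ _).2 (Γ.next_adj (Γ.node_ne_leaf _ _).symm)) _
    ((SimpleGraph.mem_neighborFinset _ _ _).2 (Γ.next_adj h))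

/-- Leave `v` by one edge up to an end `e` of the chain, then turn back from `e` towards `v`. The
chain from `e` cannot stop before `v`, whose chain to `e` has inner vertices of valency 2 only, nor
at `v` itself. -/
theorem exists_interior_of_valency_two {v : V} (hv : Γ.valency v = 2) :
    ∃ e e', Γ.valency e ≠ 2 ∧ Γ.valency e' ≠ 2 ∧ Γ.Linked e e' ∧ v ∈ Γ.interior e e' := by
  obtain ⟨w, hw⟩ : (Γ.graph.neighborFinset v).Nonempty := by
    rw [← Finset.card_pos, ← valency_eq_card, hv]; norm_num
  obtain ⟨e, h1, h2, h3, -⟩ := Γ.exists_linked ((SimpleGraph.mem_neighborFinset _ _ _).1 hw)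
  obtain ⟨e', k1, k2, k3, k4⟩ := Γ.exists_linked (Γ.next_adj h1.symm)
  refine ⟨e, e', h2, k2, k3, ?_⟩
  refine Γ.mem_interior_of_next_eq k3 h1.symm k4 ?_
  by_contra hlt
  push Not at hlt
  have h := Γ.pt_eq_of_next_eq k3 k4 _ le_rfl hlt
  rw [pt_len] at h
  rcases hlt.lt_or_eq with hlt | heq
  · exact k2 (Γ.valency_interior h3.symm
      (Γ.mem_interior.2 ⟨_, Γ.len_pos k1, hlt, h.symm⟩))
  · rw [heq, pt_len] at h
    rw [h] at k2
    exact k2 hv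

/-- Every vertex is a node, an interior vertex of a chain, or a vertex of a leg. -/
theorem vertex_cases [Nonempty Γ.Node] (v : V) :
    (∃ n : Γ.Node, v = n) ∨ (∃ n n' : Γ.Node, n' ∈ Γ.nbrs n ∧ v ∈ Γ.interior n n') ∨
      ∃ u : Γ.Leaf, v = u ∨ v ∈ Γ.interior (Γ.base u) u := by
  by_cases hv : Γ.valency v = 2
  · obtain ⟨e, e', h1, h2, h3, h4⟩ := Γ.exists_interior_of_valency_two hv
    obtain ⟨hne, -, -⟩ := Γ.ne_of_mem_interior h4
    rcases Γ.node_or_leaf hne h1 with he | he <;> rcases Γ.node_or_leaf hne.symm h2 with he' | he'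
    · refine Or.inr (Or.inl ⟨⟨e, he⟩, ⟨e', he'⟩, Γ.mem_nbrs.2 ⟨?_, h3⟩, h4⟩)
      exact fun h => hne (congrArg Subtype.val h).symm
    · refine Or.inr (Or.inr ⟨⟨e', he'⟩, Or.inr ?_⟩)
      have : Γ.base ⟨e', he'⟩ = ⟨e, he⟩ := Γ.mem_leaves_iff.1 (Γ.mem_leaves.2 h3)
      rw [this]
      exact h4
    · refine Or.inr (Or.inr ⟨⟨e, he⟩, Or.inr ?_⟩)
      have : Γ.base ⟨e, he⟩ = ⟨e', he'⟩ := Γ.mem_leaves_iff.1 (Γ.mem_leaves.2 h3.symm)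
      rw [this]
      exact Γ.interior_comm.1 h4
    · exact absurd h3 (Γ.not_linked_leaf_leaf (u := ⟨e, he⟩) (u' := ⟨e', he'⟩) hne)
  · by_cases h3 : 3 ≤ Γ.valency v
    · exact Or.inl ⟨⟨v, h3⟩, rfl⟩
    · obtain ⟨n⟩ := ‹Nonempty Γ.Node›
      have hne : v ≠ n := by rintro rfl; exact h3 n.2
      rcases Γ.node_or_leaf hne hv with h | h
      · exact absurd h h3
      · exact Or.inr (Or.inr ⟨⟨v, h⟩, Or.inl rfl⟩)

/-- The sides of a chain cover the nodes. -/
theorem mem_side_or {n n' : Γ.Node} (h : n' ∈ Γ.nbrs n) (m : Γ.Node) :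
    m ∈ Γ.side n n' ∨ m ∈ Γ.side n' n := by
  simp only [side, Finset.mem_filter, Finset.mem_univ, true_and]
  have hne := Γ.ne_of_mem_nbrs h
  have hl := (Γ.mem_nbrs.1 h).2
  by_cases hmn : (m : V) = n
  · left
    rw [hmn, mem_path]
    exact ⟨0, Nat.zero_le _, by simp⟩
  by_cases hx : Γ.next n n' = Γ.next n m
  · right
    rw [path_comm]
    rcases Nat.lt_or_ge (Γ.len n m) (Γ.len n n') with hlt | hge
    · exact absurd (Γ.valency_interior hl (Γ.mem_interior_of_next_eq hl (Ne.symm hmn) hx hlt))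
        (Γ.node_valency_ne m)
    · refine Γ.mem_path.2 ⟨_, hge, ?_⟩
      rw [← Γ.pt_eq_of_next_eq hl hx _ le_rfl hge, pt_len]
  · left
    rw [path_comm]
    exact Γ.mem_path_of_next_ne hx

theorem side_disjoint {n n' : Γ.Node} (h : n' ∈ Γ.nbrs n) :
    Disjoint (Γ.side n n') (Γ.side n' n) := by
  rw [Finset.disjoint_left]
  intro m h1 h2
  simp only [side, Finset.mem_filter, Finset.mem_univ, true_and] at h1 h2
  obtain ⟨i, hi, e1⟩ := Γ.mem_path.1 h1
  obtain ⟨j, hj, e2⟩ := Γ.mem_path.1 h2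
  have l1 := (Γ.prefix_spec hi).1
  have l2 := (Γ.prefix_spec hj).1
  rw [e1] at l1
  rw [e2] at l2
  have : i = j := by omega
  rw [l2, this] at hi
  have h3 : i = Γ.len m n' := by omega
  rw [h3, pt_len] at e1
  exact Γ.ne_of_mem_nbrs h e1.symm

end PlumbingTree
end
noncomputable section
open scoped Classical
universe u
namespace PlumbingTree
variable {V : Type u} [Fintype V] [DecidableEq V] (Γ : PlumbingTree V)

/-! ### The inverse of the intersection form -/

/-- The linear map `x ↦ (-(x, E_v))_v`, i.e. the coordinates of `x` in the basis `E_v^*`. -/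
def coef : (V → ℚ) →ₗ[ℚ] (V → ℚ) := -Matrix.mulVecLin Γ.form

theorem form_apply (v w : V) :
    Γ.form v w = if v = w then (Γ.b v : ℚ) else if Γ.graph.Adj v w then 1 else 0 := by
  simp only [form, plumbingMatrix, Matrix.map_apply, Matrix.of_apply]
  split_ifs <;> simp

theorem form_symm (v w : V) : Γ.form v w = Γ.form w v := by
  rw [form_apply, form_apply, Γ.graph.adj_comm]
  by_cases h : v = w
  · subst h; rfl
  · simp [h, Ne.symm h]

theorem coef_apply (x : V → ℚ) (v : V) :
    Γ.coef x v = -(Γ.b v * x v) - ∑ w ∈ Γ.graph.neighborFinset v, x w := by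
  have h : ∀ w, Γ.form v w * x w =
      (if v = w then (Γ.b v : ℚ) * x w else 0) + if Γ.graph.Adj v w then x w else 0 := by
    intro w
    rw [form_apply]
    by_cases h : v = w
    · subst h; simp
    · simp [h]
  simp only [coef, LinearMap.neg_apply, Pi.neg_apply, Matrix.mulVecLin_apply, Matrix.mulVec,
    dotProduct, h, Finset.sum_add_distrib, Finset.sum_ite_eq, Finset.mem_univ, if_true]
  rw [← Finset.sum_filter, SimpleGraph.neighborFinset_eq_filter]
  ring

/-- The product of the denominators of the coordinates scales `x` to an integral vector, to which
`negDef` applies. -/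
theorem coef_posDef {x : V → ℚ} (hx : x ≠ 0) : 0 < x ⬝ᵥ Γ.coef x := by
  set D : ℕ := ∏ v, (x v).den with hD
  have hD0 : (0 : ℚ) < D := by
    rw [hD]; exact_mod_cast Finset.prod_pos fun v _ => (x v).pos
  have hint : ∀ v, ∃ k : ℤ, (k : ℚ) = D * x v := by
    intro v
    obtain ⟨c, hc⟩ : (x v).den ∣ D := Finset.dvd_prod_of_mem _ (Finset.mem_univ v)
    refine ⟨c * (x v).num, ?_⟩
    rw [hc]
    push_cast
    have := Rat.mul_den_eq_num (x v)
    rw [← this]; ring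
  choose y hy using hint
  have hy0 : y ≠ 0 := by
    intro h
    apply hx
    funext v
    have := hy v
    rw [h] at this
    simp only [Pi.zero_apply, Int.cast_zero] at this
    rcases mul_eq_zero.1 this.symm with h' | h'
    · exact absurd h' hD0.ne'
    · exact h'
  have h1 := Γ.negDef y hy0
  have h2 : ((dotProduct y (Matrix.mulVec (plumbingMatrix Γ.graph Γ.b) y) : ℤ) : ℚ) =
      -((D : ℚ) ^ 2 * (x ⬝ᵥ Γ.coef x)) := by
    simp only [coef, LinearMap.neg_apply, Matrix.mulVecLin_apply, dotProduct, Matrix.mulVec,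
      form, Matrix.map_apply, Pi.neg_apply]
    push_cast
    simp only [hy, Finset.mul_sum, ← Finset.sum_neg_distrib]
    refine Finset.sum_congr rfl fun v _ => Finset.sum_congr rfl fun w _ => ?_
    ring
  have h3 : -((D : ℚ) ^ 2 * (x ⬝ᵥ Γ.coef x)) < 0 := by
    rw [← h2]; exact_mod_cast h1
  have h4 : 0 < (D : ℚ) ^ 2 * (x ⬝ᵥ Γ.coef x) := by linarith
  exact (mul_pos_iff_of_pos_left (by positivity)).1 h4

theorem coef_dualVec (v w : V) : Γ.coef (Γ.dualVec v) w = if v = w then 1 else 0 := by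
  have ht : Γ.form.transpose = Γ.form := by
    ext v w
    exact Γ.form_symm w v
  have h := Γ.dualVec_vecMul v w
  rw [← Matrix.mulVec_transpose, ht] at h
  simp only [coef, LinearMap.neg_apply, Matrix.mulVecLin_apply, Pi.neg_apply, h]
  split_ifs <;> simp

theorem coef_sum_dualVec (m : V → ℚ) : Γ.coef (∑ v, m v • Γ.dualVec v) = m := by
  funext w
  simp only [map_sum, map_smul, Finset.sum_apply, Pi.smul_apply, coef_dualVec, smul_eq_mul]
  simp

/-- Let `y` be the negative part of `x`. As `y` and `x + y` have disjoint supports and the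
off-diagonal entries of the form are nonnegative, `y · coef (x + y) ≤ 0`; with `y · coef x ≥ 0` this
gives `y · coef y ≤ 0`, hence `y = 0` by definiteness. -/
theorem nonneg_of_coef_nonneg {x : V → ℚ} (hx : ∀ v, 0 ≤ Γ.coef x v) (v : V) : 0 ≤ x v := by
  set y : V → ℚ := fun v => max (-x v) 0 with hy
  have hy0 : ∀ v, 0 ≤ y v := fun v => le_max_right _ _
  have hxy : ∀ v, 0 ≤ x v + y v := fun v => by
    have := le_max_left (-x v) 0
    simp only [hy]; linarith
  have hprod : ∀ v, y v * (x v + y v) = 0 := fun v => by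
    simp only [hy]
    rcases le_total (-x v) 0 with h | h
    · rw [max_eq_right h]; ring
    · rw [max_eq_left h]; ring
  have h1 : 0 ≤ y ⬝ᵥ Γ.coef x := Finset.sum_nonneg fun v _ => mul_nonneg (hy0 v) (hx v)
  have h2 : y ⬝ᵥ Γ.coef (x + y) ≤ 0 := by
    apply Finset.sum_nonpos
    intro v _
    rw [coef_apply, mul_sub]
    have : y v * -(Γ.b v * (x + y) v) = 0 := by
      rw [Pi.add_apply]
      linear_combination (-(Γ.b v : ℚ)) * hprod v
    rw [this, zero_sub, neg_nonpos]
    exact mul_nonneg (hy0 v) (Finset.sum_nonneg fun w _ => hxy w)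
  rw [map_add, dotProduct_add] at h2
  have h3 : y = 0 := by
    by_contra h
    have := Γ.coef_posDef h
    linarith
  have := congrFun h3 v
  have h4 := hxy v
  rw [this] at h4
  simpa using h4

/-- The coordinates are nonnegative by `nonneg_of_coef_nonneg`. A zero at one vertex forces zeros at
all its neighbours, so by connectedness everywhere, against the coefficient 1 at `v`. -/
theorem dualVec_pos (v w : V) : 0 < Γ.dualVec v w := by
  have hc : ∀ z, 0 ≤ Γ.coef (Γ.dualVec v) z := fun z => by
    rw [coef_dualVec]; split_ifs <;> norm_num
  have hnn := Γ.nonneg_of_coef_nonneg hc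
  have hadj : ∀ z, Γ.dualVec v z = 0 → ∀ z' ∈ Γ.graph.neighborFinset z, Γ.dualVec v z' = 0 := by
    intro z hz
    have := hc z
    rw [coef_apply, hz, mul_zero, neg_zero, zero_sub, neg_nonneg] at this
    exact (Finset.sum_eq_zero_iff_of_nonneg fun z' _ => hnn z').1
      (le_antisymm this (Finset.sum_nonneg fun z' _ => hnn z'))
  refine lt_of_le_of_ne (hnn w) fun h0 => ?_
  have hall : ∀ z, Γ.dualVec v z = 0 := by
    intro z
    have : ∀ i, i ≤ Γ.len w z → Γ.dualVec v (Γ.pt w z i) = 0 := by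
      intro i
      induction i with
      | zero => intro _; rw [pt_zero]; exact h0.symm
      | succ i ih =>
        intro hi
        exact hadj _ (ih (by omega)) _
          ((SimpleGraph.mem_neighborFinset _ _ _).2 (Γ.pt_adj (by omega)))
    have := this _ le_rfl
    rwa [pt_len] at this
  have h1 := Γ.coef_dualVec v v
  rw [coef_apply] at h1
  simp [hall] at h1

/-- If `n` separates `m` from `n'`, then `E_m^*` and `E_n^*` have proportional coordinates at
`n` and `n'`. -/
theorem dualVec_separates {m n n' : V} (h : n ∈ Γ.path m n') :
    Γ.dualVec m n' * Γ.dualVec n n = Γ.dualVec m n * Γ.dualVec n n' := by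
  -- The combination that vanishes at `n`; the claim is that it vanishes at `n'` too.
  set y : V → ℚ := Γ.dualVec m n • Γ.dualVec n - Γ.dualVec n n • Γ.dualVec m with hy
  have hyn : y n = 0 := by simp [hy, mul_comm]
  -- `C` is the component of `n'` in the tree without `n` (empty if `n' = n`). The only vertex
  -- outside `C` adjacent to it is `n`, where `y` vanishes, and neither `m` nor `n` is in `C`. So
  -- the restriction `x` of `y` to `C` has zero coefficients on `C`, and definiteness kills it.
  set C : V → Prop := fun v => n ∉ Γ.path v n' with hC
  set x : V → ℚ := fun v => if C v then y v else 0 with hx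
  have hmem : ∀ v w, C v → Γ.graph.Adj v w → ¬ C w → w = n := by
    intro v w hv hvw hw
    simp only [hC, not_not] at hv hw
    rw [path_comm, mem_path] at hw
    rw [path_comm, mem_path] at hv
    obtain ⟨i, hi, e⟩ := hw
    rcases Γ.step n' hvw with ⟨h1, h2⟩ | ⟨h1, h2⟩
    · rcases Nat.lt_or_ge (Γ.len n' v) i with hlt | hge
      · have : i = Γ.len n' w := by omega
        rw [this, pt_len] at e
        exact e
      · exact absurd ⟨i, hge, by rw [← h2 i hge, e]⟩ hv
    · exact absurd ⟨i, by omega, by rw [h2 i hi, e]⟩ hv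
  have hco : ∀ v, C v → Γ.coef x v = 0 := by
    intro v hv
    have h1 : Γ.coef x v = Γ.coef y v := by
      rw [coef_apply, coef_apply]
      congr 1
      · simp [hx, hv]
      · refine Finset.sum_congr rfl fun w hw => ?_
        by_cases hw' : C w
        · simp [hx, hw']
        · rw [hmem v w hv ((SimpleGraph.mem_neighborFinset _ _ _).1 hw) hw', hyn]
          simp [hx, hyn]
    rw [h1, hy, map_sub, map_smul, map_smul]
    simp only [Pi.sub_apply, Pi.smul_apply, coef_dualVec, smul_eq_mul]
    have hvn : n ≠ v := by
      rintro rfl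
      exact hv (Γ.mem_path.2 ⟨0, Nat.zero_le _, by simp⟩)
    have hvm : m ≠ v := by
      rintro rfl
      exact hv h
    simp [hvn, hvm]
  have hx0 : x = 0 := by
    by_contra hne
    have := Γ.coef_posDef hne
    have h0 : x ⬝ᵥ Γ.coef x = 0 := by
      apply Finset.sum_eq_zero
      intro v _
      by_cases hv : C v
      · rw [hco v hv, mul_zero]
      · simp [hx, hv]
    linarith
  have hn' : y n' = 0 := by
    by_cases hv : C n'
    · have := congrFun hx0 n'
      simpa [hx, hv] using this
    · simp only [hC, not_not] at hv
      rw [mem_path] at hv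
      obtain ⟨i, -, e⟩ := hv
      have : n' = n := by
        rw [← e, pt, SimpleGraph.Walk.getVert_of_length_le]
        exact (Γ.len_self n').le.trans (Nat.zero_le _)
      rw [this, hyn]
  simp only [hy, Pi.sub_apply, Pi.smul_apply, smul_eq_mul] at hn'
  linarith

/-- The combination `y` of `E_n^*` and `E_{n'}^*` which vanishes at `n'` pairs with its own
coefficients to `-(E_{n'}^*)_{n'} y_n`. By definiteness `y_n < 0`, and `-y_n` is the determinant. -/
theorem dualVec_det_pos {n n' : V} (h : n ≠ n') :
    0 < Γ.dualVec n n * Γ.dualVec n' n' - Γ.dualVec n' n * Γ.dualVec n n' := by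
  set y : V → ℚ := Γ.dualVec n n' • Γ.dualVec n' - Γ.dualVec n' n' • Γ.dualVec n with hy
  have hyn : y n' = 0 := by simp [hy, mul_comm]
  have hc : Γ.coef y = fun v => Γ.dualVec n n' * (if n' = v then 1 else 0) -
      Γ.dualVec n' n' * (if n = v then 1 else 0) := by
    funext v
    simp [hy, coef_dualVec]
  have hy0 : y ≠ 0 := by
    intro h0
    rw [h0, map_zero] at hc
    have := congrFun hc n
    simp [h.symm] at this
    exact (Γ.dualVec_pos n' n').ne' this
  have hp := Γ.coef_posDef hy0
  have hs : y ⬝ᵥ Γ.coef y = - (Γ.dualVec n' n' * y n) := by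
    rw [hc]
    simp only [dotProduct, mul_sub, Finset.sum_sub_distrib, mul_ite, mul_one, mul_zero,
      Finset.sum_ite_eq, Finset.mem_univ, if_true, hyn]
    ring
  rw [hs] at hp
  have hq := Γ.dualVec_pos n' n'
  have : y n < 0 := by
    by_contra hge
    push Not at hge
    have := mul_nonneg hq.le hge
    linarith
  simp only [hy, Pi.sub_apply, Pi.smul_apply, smul_eq_mul] at this
  linarith

end PlumbingTree
end
noncomputable section
open scoped Classical
universe u

/-! ### Continued fractions -/

theorem contFrac_bounds : ∀ ks : List ℤ, (∀ k ∈ ks, 2 ≤ k) →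
    0 ≤ (contFrac ks).2 ∧ (contFrac ks).2 < (contFrac ks).1
  | [], _ => by simp [contFrac]
  | k :: ks, h => by
    obtain ⟨h1, h2⟩ := contFrac_bounds ks fun k hk => h k (List.mem_cons_of_mem _ hk)
    have hk := h k List.mem_cons_self
    simp only [contFrac]
    constructor
    · omega
    · nlinarith

/-- The numerator is a continuant, which can be expanded at its last entry as well as at its first.
Comparing the two expansions gives its invariance under reversal by induction on the length; this is
what makes α_{n,n'} symmetric. -/
theorem contFrac_append (ks : List ℤ) (k : ℤ) :
    (contFrac (ks ++ [k])).1 = k * (contFrac ks).1 - (contFrac ks.reverse).2 ∧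
    (contFrac (ks ++ [k]).reverse).2 = (contFrac ks.reverse).1 ∧
    (contFrac ks.reverse).1 = (contFrac ks).1 := by
  -- The pair that precedes `(1, 0)` in the recursion is `(0, -1)`, whence the values for the empty
  -- string.
  have key : ∀ (ks : List ℤ) (k : ℤ), (contFrac (ks ++ [k])).1 =
      k * (contFrac ks).1 - (contFrac ks.dropLast).1 * (if ks = [] then 0 else 1) ∧
      (contFrac (ks ++ [k])).2 =
      k * (contFrac ks).2 - (if ks = [] then -1 else
        (contFrac ks.dropLast).2) := by
    intro ks
    induction ks with
    | nil => intro k; simp [contFrac]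
    | cons a l ih =>
      intro k
      obtain ⟨i1, i2⟩ := ih k
      rcases eq_or_ne l [] with rfl | hl
      · simp [contFrac, mul_comm]
      · simp only [List.cons_append, contFrac, i1, i2, hl, if_false, reduceCtorEq,
          List.dropLast_cons_of_ne_nil hl]
        constructor <;> ring
  have rev : ∀ n, ∀ ks : List ℤ, ks.length = n → (contFrac ks.reverse).1 = (contFrac ks).1 := by
    intro n
    induction n using Nat.strong_induction_on with
    | _ n ih =>
      intro ks hn
      match ks, hn with
      | [], _ => simp
      | a :: l, hn =>
        simp only [List.length_cons] at hn
        rw [List.reverse_cons, (key _ _).1, ih l.length (by omega) l rfl]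
        match l with
        | [] => simp [contFrac]
        | b :: m =>
          have : (b :: m).reverse.dropLast = m.reverse := by simp
          simp only [List.length_cons] at hn
          rw [this, ih m.length (by omega) m rfl]
          simp [contFrac]
  have hr := rev _ ks rfl
  refine ⟨?_, by simp [contFrac], hr⟩
  rw [← rev _ _ rfl, List.reverse_append]
  simp [contFrac, hr]

theorem contFrac_reverse (ks : List ℤ) : (contFrac ks.reverse).1 = (contFrac ks).1 :=
  (contFrac_append ks 0).2.2

/-- A sequence with `f_{i+1} = k_i f_i - f_{i-1}` along a string. -/
theorem contFrac_recurrence : ∀ (s : ℕ) (k : ℕ → ℤ) (f : ℕ → ℚ),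
    (∀ i < s, f (i + 2) = k i * f (i + 1) - f i) →
    (contFrac ((List.range s).map k)).1 * f 1 = (contFrac ((List.range s).map k)).2 * f 0 + f (s + 1)
  | 0, k, f, _ => by simp [contFrac]
  | s + 1, k, f, h => by
    have ih := contFrac_recurrence s (fun i => k (i + 1)) (fun i => f (i + 1))
      fun i hi => h (i + 1) (by omega)
    have h0 := h 0 (by omega)
    have hl : (List.range (s + 1)).map k = k 0 :: (List.range s).map fun i => k (i + 1) := by
      rw [List.range_succ_eq_map]; simp [Function.comp_def]
    rw [hl]
    simp only [contFrac]
    push_cast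
    simp only [zero_add] at h0 ih
    rw [h0] at ih
    linear_combination ih

/-! ### Relations along chains and legs -/

namespace PlumbingTree
variable {V : Type u} [Fintype V] [DecidableEq V] (Γ : PlumbingTree V)

theorem coef_pt (x : V → ℚ) {v w : V} (h : Γ.Linked v w) {i : ℕ} (hi : i + 1 < Γ.len v w) :
    x (Γ.pt v w (i + 2)) =
      ((-Γ.b (Γ.pt v w (i + 1)) : ℤ) : ℚ) * x (Γ.pt v w (i + 1)) - x (Γ.pt v w i) -
        Γ.coef x (Γ.pt v w (i + 1)) := by
  have hne : Γ.pt v w i ≠ Γ.pt v w (i + 2) := fun h' => by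
    have := Γ.pt_inj (by omega) (by omega) h'
    omega
  rw [coef_apply, Γ.neighborFinset_pt hi (Γ.linked_iff.1 h _ (by omega) hi), Finset.sum_pair hne]
  push_cast
  ring

theorem coef_leaf (x : V → ℚ) (u : Γ.Leaf) {v : V} (hv : v ≠ u) :
    Γ.coef x u = -(Γ.b u * x u) - x (Γ.next u v) := by
  have hc : (Γ.graph.neighborFinset (u : V)).card = 1 := by
    rw [← valency_eq_card, u.2]
  obtain ⟨w, hw⟩ := Finset.card_eq_one.1 hc
  have := (SimpleGraph.mem_neighborFinset _ _ _).2 (Γ.next_adj hv.symm)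
  rw [hw, Finset.mem_singleton] at this
  rw [coef_apply, hw, Finset.sum_singleton, this]

theorem interior_map (v w : V) : (Γ.interior v w).map (fun z => -Γ.b z) =
    (List.range (Γ.len v w - 1)).map fun i => -Γ.b (Γ.pt v w (i + 1)) := by
  rw [interior_eq, List.map_map]; rfl

theorem two_le_of_interior {v w : V} (h : Γ.Linked v w) :
    ∀ k ∈ (Γ.interior v w).map (fun z => -Γ.b z), (2 : ℤ) ≤ k := by
  intro k hk
  obtain ⟨z, hz, rfl⟩ := List.mem_map.1 hk
  have := Γ.minimal z (h z hz)
  omega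

theorem chain_bounds {n n' : Γ.Node} (h : n' ∈ Γ.nbrs n) :
    0 ≤ (Γ.chainSeifert n n').2 ∧ (Γ.chainSeifert n n').2 < (Γ.chainSeifert n n').1 :=
  contFrac_bounds _ (Γ.two_le_of_interior (Γ.mem_nbrs.1 h).2)

theorem chain_pos {n n' : Γ.Node} (h : n' ∈ Γ.nbrs n) : (0 : ℚ) < (Γ.chainSeifert n n').1 := by
  have := Γ.chain_bounds h
  exact_mod_cast this.1.trans_lt this.2

theorem leg_pos {n : Γ.Node} {u : Γ.Leaf} (h : u ∈ Γ.leaves n) : 0 < (Γ.legSeifert n u).1 := by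
  have := contFrac_bounds ((Γ.path n u).tail.map fun v => -Γ.b v) fun k hk => by
    obtain ⟨z, hz, rfl⟩ := List.mem_map.1 hk
    rw [path_tail] at hz
    obtain ⟨i, hi, rfl⟩ := List.mem_map.1 hz
    rw [List.mem_range] at hi
    have : Γ.valency (Γ.pt n u (i + 1)) ≤ 2 := by
      rcases Nat.lt_or_ge (i + 1) (Γ.len n u) with hlt | hge
      · exact Γ.linked_iff.1 (Γ.mem_leaves.1 h) _ (by omega) hlt
      · rw [show i + 1 = Γ.len n u by omega, pt_len, u.2]; norm_num
    have := Γ.minimal _ this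
    omega
  exact this.1.trans_lt this.2

theorem interior_reverse (v w : V) : Γ.interior w v = (Γ.interior v w).reverse := by
  rw [interior_eq, interior_eq]
  apply List.ext_getElem
  · simp [Γ.len_comm v w]
  · intro i h1 h2
    simp only [List.length_map, List.length_range, List.length_reverse] at h1 h2
    simp only [List.getElem_map, List.getElem_range, List.getElem_reverse, List.length_map,
      List.length_range]
    rw [pt_rev]
    congr 1
    omega

theorem chainSeifert_comm (n n' : Γ.Node) : (Γ.chainSeifert n' n).1 = (Γ.chainSeifert n n').1 := by
  simp only [chainSeifert]
  rw [Γ.interior_reverse n n', List.map_reverse, contFrac_reverse]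

/-- The relation along a chain on which the coordinates `-(x, E_v)` vanish. -/
theorem chain_relation (x : V → ℚ) {n n' : Γ.Node} (h : n' ∈ Γ.nbrs n)
    (h0 : ∀ v ∈ Γ.interior n n', Γ.coef x v = 0) :
    (Γ.chainSeifert n n').1 * x (Γ.next n n') = (Γ.chainSeifert n n').2 * x n + x n' := by
  have hlen := Γ.len_pos (Γ.ne_of_mem_nbrs h)
  have := contFrac_recurrence (Γ.len n n' - 1) (fun i => -Γ.b (Γ.pt n n' (i + 1)))
    (fun i => x (Γ.pt n n' i)) fun i hi => by
      rw [Γ.coef_pt x (Γ.mem_nbrs.1 h).2 (by omega),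
        h0 _ (Γ.mem_interior.2 ⟨i + 1, by omega, by omega, rfl⟩), sub_zero]
  rw [Nat.sub_add_cancel hlen, pt_len, pt_zero, ← interior_map] at this
  exact this

/-- The relation along a chain on which only the coordinate at the first vertex may not vanish. -/
theorem chain_relation_first (x : V → ℚ) {n n' : Γ.Node} (h : n' ∈ Γ.nbrs n)
    (h0 : ∀ v ∈ Γ.interior n n', v ≠ Γ.next n n' → Γ.coef x v = 0) :
    (Γ.chainSeifert n n').1 * x (Γ.next n n') =
      (Γ.chainSeifert n n').2 * (x n + Γ.coef x (Γ.next n n')) + x n' := by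
  have hlen := Γ.len_pos (Γ.ne_of_mem_nbrs h)
  -- The inhomogeneous term at the first vertex is absorbed by altering the initial value of the
  -- sequence.
  have := contFrac_recurrence (Γ.len n n' - 1) (fun i => -Γ.b (Γ.pt n n' (i + 1)))
    (fun i => if i = 0 then x n + Γ.coef x (Γ.next n n') else x (Γ.pt n n' i)) fun i hi => by
      have hr := Γ.coef_pt x (Γ.mem_nbrs.1 h).2 (i := i) (by omega)
      rcases Nat.eq_zero_or_pos i with rfl | hi0
      · simp only [zero_add, pt_zero] at hr
        simp only [zero_add, if_true]
        rw [if_neg (by norm_num), if_neg (by norm_num), hr, next]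
        ring
      · rw [if_neg (by omega), if_neg (by omega), if_neg (by omega), hr,
          h0 _ (Γ.mem_interior.2 ⟨i + 1, by omega, by omega, rfl⟩), sub_zero]
        intro he
        have := Γ.pt_inj (by omega) (by omega) he
        omega
  rw [Nat.sub_add_cancel hlen, if_neg hlen.ne', if_neg one_ne_zero, if_pos rfl, pt_len,
    ← interior_map] at this
  exact this

/-- The relation along a chain on which only the coordinate at the last vertex may not vanish. -/
theorem chain_relation_last (x : V → ℚ) {n n' : Γ.Node} (h : n' ∈ Γ.nbrs n)
    (h0 : ∀ v ∈ Γ.interior n n', v ≠ Γ.next n' n → Γ.coef x v = 0) (hadj : 1 < Γ.len n n') :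
    (Γ.chainSeifert n n').1 * x (Γ.next n n') =
      (Γ.chainSeifert n n').2 * x n + (x n' + Γ.coef x (Γ.next n' n)) := by
  have hnx : Γ.next n' n = Γ.pt n n' (Γ.len n n' - 1) := by rw [next, pt_rev]
  -- Here the inhomogeneous term is absorbed by the last value of the sequence.
  have := contFrac_recurrence (Γ.len n n' - 1) (fun i => -Γ.b (Γ.pt n n' (i + 1)))
    (fun i => if i = Γ.len n n' then x n' + Γ.coef x (Γ.next n' n) else x (Γ.pt n n' i))
    fun i hi => by
      have hr := Γ.coef_pt x (Γ.mem_nbrs.1 h).2 (i := i) (by omega)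
      rw [if_neg (by omega : ¬ i + 1 = _), if_neg (by omega : ¬ i = _)]
      by_cases hi2 : i + 2 = Γ.len n n'
      · rw [hi2, pt_len] at hr
        rw [if_pos hi2, hr, hnx, show Γ.len n n' - 1 = i + 1 by omega]
        ring
      · rw [if_neg hi2, hr, h0 _ (Γ.mem_interior.2 ⟨i + 1, by omega, by omega, rfl⟩), sub_zero]
        intro he
        rw [hnx] at he
        have := Γ.pt_inj (by omega) (by omega) he
        omega
  rw [Nat.sub_add_cancel (by omega), if_pos rfl, if_neg (by omega), if_neg (by omega),
    pt_zero, ← interior_map] at this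
  exact this

/-- The relation along a leg. -/
theorem leg_relation (x : V → ℚ) {n : Γ.Node} {u : Γ.Leaf} (h : u ∈ Γ.leaves n)
    (h0 : ∀ v ∈ Γ.interior n u, Γ.coef x v = 0) :
    (Γ.legSeifert n u).1 * x (Γ.next n u) = (Γ.legSeifert n u).2 * x n + Γ.coef x u := by
  have hne := Γ.node_ne_leaf n u
  have hlen := Γ.len_pos hne
  have hl : ((Γ.path n u).tail.map fun v => -Γ.b v) =
      (List.range (Γ.len n u)).map fun i => -Γ.b (Γ.pt n u (i + 1)) := by
    rw [path_tail, List.map_map]; rfl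
  -- A fictitious vertex after `u` with the value `coef x u` makes the homogeneous recurrence hold
  -- at `u` as well.
  have := contFrac_recurrence (Γ.len n u) (fun i => -Γ.b (Γ.pt n u (i + 1)))
    (fun i => if i = Γ.len n u + 1 then Γ.coef x u else x (Γ.pt n u i)) fun i hi => by
      rw [if_neg (by omega : ¬ i + 1 = _), if_neg (by omega : ¬ i = _)]
      by_cases hi2 : i + 1 = Γ.len n u
      · have hnx : Γ.next u n = Γ.pt n u i := by
          rw [next, pt_rev, ← hi2, Nat.add_sub_cancel]
        rw [if_pos (by omega), Γ.coef_leaf x u hne, hnx, hi2, pt_len]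
        push_cast
        ring
      · rw [if_neg (by omega), Γ.coef_pt x (Γ.mem_leaves.1 h) (by omega),
          h0 _ (Γ.mem_interior.2 ⟨i + 1, by omega, by omega, rfl⟩), sub_zero]
  rw [if_pos rfl, if_neg (by omega), if_neg (by omega), pt_zero, ← hl] at this
  exact this

end PlumbingTree
end
noncomputable section
open scoped Classical
universe u
namespace PlumbingTree
variable {V : Type u} [Fintype V] [DecidableEq V] (Γ : PlumbingTree V)

/-! ### The orbifold intersection matrix -/

/-- The linear map `y ↦ -I^orb y`. -/
def orb : (Γ.Node → ℚ) →ₗ[ℚ] (Γ.Node → ℚ) := Matrix.mulVecLin (-Γ.orbMatrix)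

/-- The restriction to the node coordinates, as a linear map. -/
def res : (V → ℚ) →ₗ[ℚ] (Γ.Node → ℚ) := LinearMap.funLeft ℚ ℚ Subtype.val

@[simp] theorem res_apply (x : V → ℚ) (n : Γ.Node) : Γ.res x n = x n := rfl

theorem proj_eq (x : Γ.dualLattice) : Γ.proj x = Γ.res (x : V → ℚ) := rfl

theorem orb_apply (y : Γ.Node → ℚ) (n : Γ.Node) :
    Γ.orb y n = -((Γ.b n + ∑ u ∈ Γ.leaves n, ((Γ.legSeifert n u).2 : ℚ) / (Γ.legSeifert n u).1
      + ∑ m ∈ Γ.nbrs n, ((Γ.chainSeifert n m).2 : ℚ) / (Γ.chainSeifert n m).1) * y n)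
      - ∑ n' ∈ Γ.nbrs n, 1 / ((Γ.chainSeifert n n').1 : ℚ) * y n' := by
  have hnn : n ∉ Γ.nbrs n := fun h => (Γ.mem_nbrs.1 h).1 rfl
  have h : ∀ n', Γ.orbMatrix n n' * y n' =
      (if n = n' then (Γ.b n + ∑ u ∈ Γ.leaves n, ((Γ.legSeifert n u).2 : ℚ) / (Γ.legSeifert n u).1
      + ∑ m ∈ Γ.nbrs n, ((Γ.chainSeifert n m).2 : ℚ) / (Γ.chainSeifert n m).1) * y n else 0) +
      if n' ∈ Γ.nbrs n then 1 / ((Γ.chainSeifert n n').1 : ℚ) * y n' else 0 := by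
    intro n'
    simp only [orbMatrix, Matrix.of_apply]
    by_cases h : n = n'
    · subst h; simp [hnn]
    · simp [h]
  have h1 : Γ.orb y n = -∑ n', Γ.orbMatrix n n' * y n' :=
    congrFun (Matrix.neg_mulVec y Γ.orbMatrix) n
  rw [h1]
  simp only [h, Finset.sum_add_distrib, Finset.sum_ite_eq, Finset.mem_univ, if_true]
  rw [← Finset.sum_filter, Finset.filter_mem_eq_inter, Finset.univ_inter]
  ring

theorem mem_orbCone {y : Γ.Node → ℚ} : y ∈ Γ.orbCone ↔ ∀ n, 0 ≤ Γ.orb y n := Iff.rfl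

/-- In `coef x n` the neighbours of `n` occur with their true coordinates, in `-I^orb` with the
values interpolated along chains and legs. The sums collect the differences, which depend only on
the coefficients of `x` on the chains and legs. -/
theorem orb_res (x : V → ℚ) (n : Γ.Node) :
    Γ.orb (Γ.res x) n = Γ.coef x n +
      ∑ n' ∈ Γ.nbrs n, (x (Γ.next n n') -
        ((Γ.chainSeifert n n').2 * x n + x n') / (Γ.chainSeifert n n').1) +
      ∑ u ∈ Γ.leaves n, (x (Γ.next n u) - (Γ.legSeifert n u).2 * x n / (Γ.legSeifert n u).1) := by
  rw [orb_apply, coef_apply, sum_neighbors]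
  simp only [Finset.sum_sub_distrib, add_div, Finset.sum_add_distrib, add_mul, Finset.sum_mul,
    res_apply]
  have e1 : ∀ n' : Γ.Node, ((Γ.chainSeifert n n').2 : ℚ) / (Γ.chainSeifert n n').1 * x n =
      (Γ.chainSeifert n n').2 * x n / (Γ.chainSeifert n n').1 := fun n' => by ring
  have e2 : ∀ n' : Γ.Node, 1 / ((Γ.chainSeifert n n').1 : ℚ) * x n' =
      x n' / (Γ.chainSeifert n n').1 := fun n' => by ring
  have e3 : ∀ u : Γ.Leaf, ((Γ.legSeifert n u).2 : ℚ) / (Γ.legSeifert n u).1 * x n =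
      (Γ.legSeifert n u).2 * x n / (Γ.legSeifert n u).1 := fun u => by ring
  simp only [e1, e2, e3]
  ring

theorem chain_defect (x : V → ℚ) {n n' : Γ.Node} (h : n' ∈ Γ.nbrs n)
    (h0 : ∀ v ∈ Γ.interior n n', Γ.coef x v = 0) :
    x (Γ.next n n') - ((Γ.chainSeifert n n').2 * x n + x n') / (Γ.chainSeifert n n').1 = 0 := by
  have hp := Γ.chain_pos h
  rw [← Γ.chain_relation x h h0]
  field_simp
  ring

theorem leg_defect (x : V → ℚ) {n : Γ.Node} {u : Γ.Leaf} (h : u ∈ Γ.leaves n)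
    (h0 : ∀ v ∈ Γ.interior n u, Γ.coef x v = 0) :
    x (Γ.next n u) - (Γ.legSeifert n u).2 * x n / (Γ.legSeifert n u).1 =
      Γ.coef x u / (Γ.legSeifert n u).1 := by
  have hp : (0 : ℚ) < (Γ.legSeifert n u).1 := by exact_mod_cast Γ.leg_pos h
  have := Γ.leg_relation x h h0
  field_simp
  linarith

/-- The coefficients of `E_m^*` vanish on all chains and legs, so `orb_res` has no correction terms.
Thus the vectors π_𝒩(E_m^*) form the basis dual to the coordinates of `orb`. -/
theorem orb_dualVec_node (m n : Γ.Node) : Γ.orb (Γ.res (Γ.dualVec m)) n = if m = n then 1 else 0 := by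
  have h0 : ∀ v, Γ.valency v = 2 → Γ.coef (Γ.dualVec m) v = 0 := by
    intro v hv
    rw [coef_dualVec, if_neg]
    rintro rfl
    exact Γ.node_valency_ne m hv
  rw [orb_res, Finset.sum_eq_zero, Finset.sum_eq_zero, coef_dualVec, add_zero, add_zero]
  · simp only [Subtype.ext_iff]
  · intro u hu
    rw [Γ.leg_defect _ hu fun v hv => h0 v (Γ.valency_interior (Γ.mem_leaves.1 hu) hv),
      coef_dualVec, if_neg (Γ.node_ne_leaf m u), zero_div]
  · intro n' hn'
    exact Γ.chain_defect _ hn' fun v hv => h0 v (Γ.valency_interior (Γ.mem_nbrs.1 hn').2 hv)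

theorem orb_dualVec_leaf (u : Γ.Leaf) (n : Γ.Node) :
    Γ.orb (Γ.res (Γ.dualVec u)) n = if u ∈ Γ.leaves n then 1 / ((Γ.legSeifert n u).1 : ℚ) else 0 := by
  have h0 : ∀ v, Γ.valency v = 2 → Γ.coef (Γ.dualVec u) v = 0 := by
    intro v hv
    rw [coef_dualVec, if_neg]
    rintro rfl
    exact Γ.leaf_valency_ne u hv
  have h1 : ∀ u' ∈ Γ.leaves n, Γ.dualVec u (Γ.next n u') -
      (Γ.legSeifert n u').2 * Γ.dualVec u n / (Γ.legSeifert n u').1 =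
      if u = u' then 1 / ((Γ.legSeifert n u).1 : ℚ) else 0 := by
    intro u' hu'
    rw [Γ.leg_defect _ hu' fun v hv => h0 v (Γ.valency_interior (Γ.mem_leaves.1 hu') hv),
      coef_dualVec]
    by_cases h : u = u'
    · subst h; simp
    · rw [if_neg h, if_neg fun h' => h (Subtype.ext h'), zero_div]
  rw [orb_res, Finset.sum_eq_zero (s := Γ.nbrs n), Finset.sum_congr rfl h1, coef_dualVec,
    if_neg (Γ.node_ne_leaf n u).symm, Finset.sum_ite_eq, zero_add, zero_add]
  intro n' hn'
  exact Γ.chain_defect _ hn' fun v hv => h0 v (Γ.valency_interior (Γ.mem_nbrs.1 hn').2 hv)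

theorem next_mem_interior {n n' : Γ.Node} (hadj : 1 < Γ.len n n') :
    Γ.next n n' ∈ Γ.interior n n' :=
  Γ.mem_interior.2 ⟨1, one_pos, hadj, rfl⟩

theorem next_eq_of_len {n n' : Γ.Node} (h : n' ∈ Γ.nbrs n) (hadj : ¬ 1 < Γ.len n n') :
    Γ.next n n' = n' ∧ Γ.chainSeifert n n' = (1, 0) := by
  have hlen : Γ.len n n' = 1 := by
    have := Γ.len_pos (Γ.ne_of_mem_nbrs h)
    omega
  constructor
  · rw [next, ← hlen, pt_len]
  · rw [chainSeifert, interior_eq, hlen]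
    rfl

/-- A vertex lies in the interior of at most one chain. -/
theorem interior_unique {n n' m m' : Γ.Node} (h : n' ∈ Γ.nbrs n) (h' : m' ∈ Γ.nbrs m) {v : V}
    (hv : v ∈ Γ.interior n n') (hv' : v ∈ Γ.interior m m') :
    (m = n ∧ m' = n') ∨ (m = n' ∧ m' = n) := by
  have hl := (Γ.mem_nbrs.1 h).2
  have hl' := (Γ.mem_nbrs.1 h').2
  have e1 := Γ.eq_or_eq_of_linked_interior hl hv (Γ.node_valency_ne _) (Γ.node_valency_ne _)
    (Γ.node_valency_ne m) (Γ.linked_prefix hl' hv').symm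
  have e2 := Γ.eq_or_eq_of_linked_interior hl hv (Γ.node_valency_ne _) (Γ.node_valency_ne _)
    (Γ.node_valency_ne m') (Γ.linked_prefix hl'.symm (Γ.interior_comm.1 hv')).symm
  have hne := Γ.ne_of_mem_nbrs h'
  rcases e1 with e1 | e1 <;> rcases e2 with e2 | e2
  · exact absurd (e1.trans e2.symm) hne
  · exact Or.inl ⟨Subtype.ext e1, Subtype.ext e2⟩
  · exact Or.inr ⟨Subtype.ext e1, Subtype.ext e2⟩
  · exact absurd (e1.trans e2.symm) hne

theorem not_mem_interior_leg {n n' m : Γ.Node} {u : Γ.Leaf} (h : n' ∈ Γ.nbrs n)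
    (hu : u ∈ Γ.leaves m) {v : V} (hv : v ∈ Γ.interior n n') : v ∉ Γ.interior m u := by
  intro hv'
  have hl := (Γ.mem_nbrs.1 h).2
  have hl' := Γ.mem_leaves.1 hu
  rcases Γ.eq_or_eq_of_linked_interior hl hv (Γ.node_valency_ne _) (Γ.node_valency_ne _)
    (Γ.leaf_valency_ne u) (Γ.linked_prefix hl'.symm (Γ.interior_comm.1 hv')).symm with e | e
  · exact Γ.node_ne_leaf _ _ e.symm
  · exact Γ.node_ne_leaf _ _ e.symm

/-- Only the chain `(m, m')` has a defect. Seen from `m`, the coefficient 1 sits at the first vertex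
and contributes ω/α; seen from `m'`, it sits at the last one and contributes 1/α. For an empty chain
the vertex is `m'` itself and (α, ω) = (1, 0). -/
theorem orb_dualVec_next {m m' : Γ.Node} (h : m' ∈ Γ.nbrs m) (n : Γ.Node) :
    Γ.orb (Γ.res (Γ.dualVec (Γ.next m m'))) n =
      (if m = n then ((Γ.chainSeifert m m').2 : ℚ) / (Γ.chainSeifert m m').1 else 0) +
      if m' = n then 1 / ((Γ.chainSeifert m' m).1 : ℚ) else 0 := by
  by_cases hadj : 1 < Γ.len m m'
  swap
  · obtain ⟨e1, e2⟩ := Γ.next_eq_of_len h hadj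
    rw [e1, orb_dualVec_node, Γ.chainSeifert_comm m m', e2]
    simp
  have hmem := Γ.next_mem_interior hadj
  set v := Γ.next m m' with hv
  have hv2 := Γ.valency_interior (Γ.mem_nbrs.1 h).2 hmem
  have hcn : Γ.coef (Γ.dualVec v) n = 0 := by
    rw [coef_dualVec, if_neg]
    intro e
    rw [e] at hv2
    exact Γ.node_valency_ne n hv2
  have hp := Γ.chain_pos h
  have hc : ∀ w, v ≠ w → Γ.coef (Γ.dualVec v) w = 0 := fun w hw => by
    rw [coef_dualVec, if_neg hw]
  have hcv : Γ.coef (Γ.dualVec v) v = 1 := by rw [coef_dualVec, if_pos rfl]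
  have hmm' : m ≠ m' := fun e => Γ.ne_of_mem_nbrs h (congrArg _ e)
  have hleg : ∀ u ∈ Γ.leaves n, Γ.dualVec v (Γ.next n u) -
      (Γ.legSeifert n u).2 * Γ.dualVec v n / (Γ.legSeifert n u).1 = 0 := by
    intro u hu
    rw [Γ.leg_defect _ hu, hc, zero_div]
    · intro e
      rw [e] at hv2
      exact Γ.leaf_valency_ne u hv2
    · intro w hw
      apply hc
      rintro rfl
      exact Γ.not_mem_interior_leg h hu hmem hw
  have hchain : ∀ n' ∈ Γ.nbrs n, Γ.dualVec v (Γ.next n n') -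
      ((Γ.chainSeifert n n').2 * Γ.dualVec v n + Γ.dualVec v n') / (Γ.chainSeifert n n').1 =
      (if m = n ∧ m' = n' then ((Γ.chainSeifert m m').2 : ℚ) / (Γ.chainSeifert m m').1 else 0) +
      if m' = n ∧ m = n' then 1 / ((Γ.chainSeifert m' m).1 : ℚ) else 0 := by
    intro n' hn'
    by_cases c1 : m = n ∧ m' = n'
    · obtain ⟨rfl, rfl⟩ := c1
      rw [if_pos ⟨rfl, rfl⟩, if_neg fun e => hmm' e.2]
      have := Γ.chain_relation_first (Γ.dualVec v) h fun w _ hw => hc w hw.symm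
      rw [← hv, hcv] at this
      field_simp
      rw [← hv]
      linarith
    · by_cases c2 : m' = n ∧ m = n'
      · obtain ⟨rfl, rfl⟩ := c2
        rw [if_neg fun e => hmm' e.1, if_pos ⟨rfl, rfl⟩]
        have := Γ.chain_relation_last (Γ.dualVec v) hn' (fun w _ hw => hc w hw.symm)
          (by rw [len_comm]; exact hadj)
        rw [← hv, hcv] at this
        have hp' := Γ.chain_pos hn'
        field_simp
        linarith
      · rw [if_neg c1, if_neg c2, add_zero]
        refine Γ.chain_defect _ hn' fun w hw => hc w ?_
        rintro rfl
        rcases Γ.interior_unique h hn' hmem hw with ⟨rfl, rfl⟩ | ⟨rfl, rfl⟩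
        · exact c1 ⟨rfl, rfl⟩
        · exact c2 ⟨rfl, rfl⟩
  rw [orb_res, hcn, Finset.sum_eq_zero hleg, Finset.sum_congr rfl hchain, Finset.sum_add_distrib,
    zero_add, add_zero]
  congr 1
  · by_cases e : m = n
    · subst e
      simp [h]
    · simp [e]
  · by_cases e : m' = n
    · subst e
      simp [Γ.nbrs_comm.1 h]
    · simp [e]

theorem orb_injective : Function.Injective Γ.orb := by
  have hs : Function.Surjective Γ.orb := by
    intro z
    refine ⟨∑ m, z m • Γ.res (Γ.dualVec m), ?_⟩
    funext n
    simp [map_sum, map_smul, orb_dualVec_node]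
  exact LinearMap.injective_iff_surjective.2 hs

theorem eq_sum_orb (y : Γ.Node → ℚ) : y = ∑ m, Γ.orb y m • Γ.res (Γ.dualVec m) := by
  apply Γ.orb_injective
  funext n
  simp [map_sum, map_smul, orb_dualVec_node]

section Order
variable [PartialOrder Γ.Node]

theorem orb_shift (a : Γ.LiftData) (n : Γ.Node) :
    Γ.orb (Γ.shift a) n = a.node n
    + ∑ n' ∈ (Γ.nbrs n).filter (fun n' => n < n'),
        ((Γ.chainSeifert n n').2 : ℚ) / (Γ.chainSeifert n n').1 * a.chain n n'
    + ∑ n' ∈ (Γ.nbrs n).filter (fun n' => n' < n),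
        1 / ((Γ.chainSeifert n n').1 : ℚ) * a.chain n' n
    + ∑ u ∈ Γ.leaves n, (a.leaf u : ℚ) / (Γ.legSeifert n u).1 := by
  have h1 : Γ.shift a = ∑ m : Γ.Node, (a.node m : ℚ) • Γ.res (Γ.dualVec m)
      + ∑ u : Γ.Leaf, (a.leaf u : ℚ) • Γ.res (Γ.dualVec u)
      + ∑ m, ∑ m' ∈ (Γ.nbrs m).filter (fun m' => m < m'),
        (a.chain m m' : ℚ) • Γ.res (Γ.dualVec (Γ.next m m')) := by
    simp only [← map_smul, ← map_sum, ← map_add]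
    rw [shift, proj_eq]
    congr 1
    simp only [liftElem, AddSubgroup.coe_add, AddSubgroup.val_finsetSum, AddSubgroup.coe_zsmul,
      Estar, firstVertex_eq, Int.cast_smul_eq_zsmul]
  rw [h1, map_add, map_add, Pi.add_apply, Pi.add_apply]
  have e1 : Γ.orb (∑ m : Γ.Node, (a.node m : ℚ) • Γ.res (Γ.dualVec m)) n = a.node n := by
    simp [map_sum, map_smul, orb_dualVec_node]
  have e2 : Γ.orb (∑ u : Γ.Leaf, (a.leaf u : ℚ) • Γ.res (Γ.dualVec u)) n =
      ∑ u ∈ Γ.leaves n, (a.leaf u : ℚ) / (Γ.legSeifert n u).1 := by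
    simp only [map_sum, map_smul, Finset.sum_apply, Pi.smul_apply, orb_dualVec_leaf, smul_eq_mul,
      mul_ite, mul_zero]
    rw [← Finset.sum_filter, Finset.filter_mem_eq_inter, Finset.univ_inter]
    simp [div_eq_mul_inv]
  have e3 : Γ.orb (∑ m, ∑ m' ∈ (Γ.nbrs m).filter (fun m' => m < m'),
        (a.chain m m' : ℚ) • Γ.res (Γ.dualVec (Γ.next m m'))) n =
      ∑ n' ∈ (Γ.nbrs n).filter (fun n' => n < n'),
        ((Γ.chainSeifert n n').2 : ℚ) / (Γ.chainSeifert n n').1 * a.chain n n'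
    + ∑ n' ∈ (Γ.nbrs n).filter (fun n' => n' < n),
        1 / ((Γ.chainSeifert n n').1 : ℚ) * a.chain n' n := by
    have : ∀ m, ∀ m' ∈ (Γ.nbrs m).filter (fun m' => m < m'),
        (a.chain m m' : ℚ) * Γ.orb (Γ.res (Γ.dualVec (Γ.next m m'))) n =
        (if m = n then ((Γ.chainSeifert m m').2 : ℚ) / (Γ.chainSeifert m m').1 * a.chain m m'
          else 0) +
        if m' = n then 1 / ((Γ.chainSeifert m' m).1 : ℚ) * a.chain m m' else 0 := by
      intro m m' hm'
      rw [Γ.orb_dualVec_next (Finset.mem_filter.1 hm').1, mul_add]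
      congr 1 <;> split_ifs <;> ring
    simp only [map_sum, map_smul, Finset.sum_apply, Pi.smul_apply, smul_eq_mul]
    rw [Finset.sum_congr rfl fun m _ => Finset.sum_congr rfl (this m)]
    simp only [Finset.sum_add_distrib]
    congr 1
    · rw [Finset.sum_eq_single n]
      · simp
      · intro m _ hm
        simp [hm]
      · simp
    · rw [Finset.sum_filter, ← Finset.sum_subset (Finset.subset_univ (Γ.nbrs n))]
      · refine Finset.sum_congr rfl fun m hm => ?_
        rw [Finset.sum_ite_eq']
        simp only [Finset.mem_filter, Γ.nbrs_comm.1 hm, true_and]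
      · intro m _ hm
        rw [Finset.sum_ite_eq', if_neg]
        intro h
        exact hm (Γ.nbrs_comm.1 (Finset.mem_filter.1 h).1)
  rw [e1, e2, e3]
  ring

/-- Floor plus fractional part leaves an affine function of ℓ. So the normalization of 𝓜_a consists
of the points of ℤ^𝒩(a) whose translate by 𝐜_a lies in 𝒞^orb. -/
theorem linear_eq_orb (a : Γ.LiftData) (l : Γ.Node → ℤ) (n : Γ.Node) :
    Γ.linear a l n = Γ.orb (Γ.shift a + Γ.toQ l) n := by
  rw [map_add, Pi.add_apply, orb_shift, orb_apply, linear, quasi, add_assoc _ (Finset.sum _ _) (Finset.sum _ _),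
    ← Finset.sum_add_distrib]
  simp only [Int.floor_add_fract, sub_div, Finset.sum_sub_distrib, toQ, add_mul, Finset.sum_mul]
  have e3 : ∀ u : Γ.Leaf, ((Γ.legSeifert n u).2 : ℚ) / (Γ.legSeifert n u).1 * l n =
      (Γ.legSeifert n u).2 * l n / (Γ.legSeifert n u).1 := fun u => by ring
  simp only [e3]
  ring

end Order
end PlumbingTree
end
noncomputable section
open scoped Classical
universe u
namespace PlumbingTree
variable {V : Type u} [Fintype V] [DecidableEq V] (Γ : PlumbingTree V)

/-! ### Integrality -/

/-- Integrality propagates along a chain. -/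
theorem integral_along (x : V → ℚ) {v w : V} (hl : Γ.Linked v w) (hv : ∃ k : ℤ, x v = k)
    (hn : ∃ k : ℤ, x (Γ.next v w) = k)
    (hc : ∀ z ∈ Γ.interior v w, ∃ k : ℤ, Γ.coef x z = k) :
    ∀ i, i ≤ Γ.len v w → ∃ k : ℤ, x (Γ.pt v w i) = k := by
  intro i
  induction i using Nat.strong_induction_on with
  | _ i ih =>
    intro hi
    match i with
    | 0 => simpa using hv
    | 1 => exact hn
    | i + 2 =>
      obtain ⟨k0, e0⟩ := ih i (by omega) (by omega)
      obtain ⟨k1, e1⟩ := ih (i + 1) (by omega) (by omega)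
      obtain ⟨k2, e2⟩ := hc (Γ.pt v w (i + 1)) (Γ.mem_interior.2 ⟨i + 1, by omega, by omega, rfl⟩)
      refine ⟨-Γ.b (Γ.pt v w (i + 1)) * k1 - k0 - k2, ?_⟩
      rw [Γ.coef_pt x hl hi, e0, e1, e2]
      push_cast
      ring

theorem exists_coef_dualLattice (x : Γ.dualLattice) (v : V) : ∃ k : ℤ, Γ.coef (x : V → ℚ) v = k := by
  obtain ⟨k, hk⟩ := x.2 v
  have ht : Γ.form.transpose = Γ.form := by
    ext v w
    exact Γ.form_symm w v
  rw [← Matrix.mulVec_transpose, ht] at hk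
  refine ⟨-k, ?_⟩
  simp only [coef, LinearMap.neg_apply, Matrix.mulVecLin_apply, Pi.neg_apply, hk]
  push_cast
  rfl

theorem cls_eq_iff (x y : Γ.dualLattice) :
    Γ.cls x = Γ.cls y ↔ ∀ v, ∃ k : ℤ, (x : V → ℚ) v - (y : V → ℚ) v = k := by
  have h1 : Γ.cls x = Γ.cls y ↔ -x + y ∈ (integerLattice V).addSubgroupOf Γ.dualLattice :=
    QuotientAddGroup.eq
  rw [h1, AddSubgroup.mem_addSubgroupOf]
  constructor
  · intro h v
    obtain ⟨k, hk⟩ := h v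
    refine ⟨-k, ?_⟩
    push_cast
    rw [← hk]
    simp only [AddSubgroup.coe_add, AddSubgroup.coe_neg, Pi.add_apply, Pi.neg_apply]
    ring
  · intro h v
    obtain ⟨k, hk⟩ := h v
    refine ⟨-k, ?_⟩
    push_cast
    rw [← hk]
    simp only [Pi.add_apply, Pi.neg_apply]
    ring

theorem next_ne_leaf {n n' : Γ.Node} (h : n' ∈ Γ.nbrs n) (u : Γ.Leaf) : Γ.next n n' ≠ u := by
  intro e
  by_cases hadj : 1 < Γ.len n n'
  · have := Γ.valency_interior (Γ.mem_nbrs.1 h).2 (Γ.next_mem_interior hadj)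
    rw [e] at this
    exact Γ.leaf_valency_ne u this
  · rw [(Γ.next_eq_of_len h hadj).1] at e
    exact Γ.node_ne_leaf _ _ e

theorem next_mem_interior_of_valency {n n' : Γ.Node} (h : n' ∈ Γ.nbrs n)
    (hv : Γ.valency (Γ.next n n') = 2) : Γ.next n n' ∈ Γ.interior n n' := by
  apply Γ.next_mem_interior
  by_contra hadj
  rw [(Γ.next_eq_of_len h hadj).1] at hv
  exact Γ.node_valency_ne _ hv

section Order
variable [PartialOrder Γ.Node]

theorem coef_liftElem (a : Γ.LiftData) (v : V) :
    Γ.coef (Γ.liftElem a : V → ℚ) v = ∑ n : Γ.Node, (if (n : V) = v then (a.node n : ℚ) else 0)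
      + ∑ u : Γ.Leaf, (if (u : V) = v then (a.leaf u : ℚ) else 0)
      + ∑ n, ∑ n' ∈ (Γ.nbrs n).filter (fun n' => n < n'),
        (if Γ.next n n' = v then (a.chain n n' : ℚ) else 0) := by
  have h1 : (Γ.liftElem a : V → ℚ) = ∑ m : Γ.Node, (a.node m : ℚ) • Γ.dualVec m
      + ∑ u : Γ.Leaf, (a.leaf u : ℚ) • Γ.dualVec u
      + ∑ m, ∑ m' ∈ (Γ.nbrs m).filter (fun m' => m < m'),
        (a.chain m m' : ℚ) • Γ.dualVec (Γ.next m m') := by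
    simp only [liftElem, AddSubgroup.coe_add, AddSubgroup.val_finsetSum, AddSubgroup.coe_zsmul,
      Estar, firstVertex_eq, Int.cast_smul_eq_zsmul]
  rw [h1]
  simp only [map_add, map_sum, map_smul, Pi.add_apply, Finset.sum_apply, Pi.smul_apply,
    coef_dualVec, smul_eq_mul, mul_ite, mul_one, mul_zero]

theorem coef_liftElem_leaf (a : Γ.LiftData) (u : Γ.Leaf) :
    Γ.coef (Γ.liftElem a : V → ℚ) u = a.leaf u := by
  rw [coef_liftElem, Finset.sum_eq_zero, zero_add, Finset.sum_eq_single u, if_pos rfl,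
    Finset.sum_eq_zero, add_zero]
  · intro n _
    apply Finset.sum_eq_zero
    intro n' hn'
    rw [if_neg (Γ.next_ne_leaf (Finset.mem_filter.1 hn').1 u)]
  · intro u' _ hne
    rw [if_neg fun e => hne (Subtype.ext e)]
  · simp
  · intro n _
    rw [if_neg (Γ.node_ne_leaf n u)]

theorem coef_liftElem_two (a : Γ.LiftData) {v : V} (hv : Γ.valency v = 2) :
    Γ.coef (Γ.liftElem a : V → ℚ) v = ∑ n, ∑ n' ∈ (Γ.nbrs n).filter (fun n' => n < n'),
        (if Γ.next n n' = v then (a.chain n n' : ℚ) else 0) := by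
  rw [coef_liftElem, Finset.sum_eq_zero, Finset.sum_eq_zero, zero_add, zero_add]
  · intro u _
    rw [if_neg]
    rintro rfl
    exact Γ.leaf_valency_ne u hv
  · intro n _
    rw [if_neg]
    rintro rfl
    exact Γ.node_valency_ne n hv

/-- An interior vertex lies on one chain only, and `n < n'` excludes that this chain occurs in the
lift with the opposite orientation. -/
theorem coef_liftElem_chain (a : Γ.LiftData) {n n' : Γ.Node} (h : n' ∈ Γ.nbrs n) (hlt : n < n')
    {v : V} (hv : v ∈ Γ.interior n n') :
    Γ.coef (Γ.liftElem a : V → ℚ) v = if Γ.next n n' = v then (a.chain n n' : ℚ) else 0 := by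
  have hv2 := Γ.valency_interior (Γ.mem_nbrs.1 h).2 hv
  have key : ∀ m, ∀ m' ∈ (Γ.nbrs m).filter (fun m' => m < m'), Γ.next m m' = v →
      m = n ∧ m' = n' := by
    intro m m' hm' e
    obtain ⟨h1, h2⟩ := Finset.mem_filter.1 hm'
    rw [← e] at hv2 hv
    rcases Γ.interior_unique h h1 hv (Γ.next_mem_interior_of_valency h1 hv2) with h3 | ⟨rfl, rfl⟩
    · exact h3
    · exact absurd hlt h2.asymm
  rw [Γ.coef_liftElem_two a hv2, Finset.sum_eq_single n, Finset.sum_eq_single n']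
  · intro m' hm' hne
    rw [if_neg fun e => hne (key n m' hm' e).2]
  · intro hn
    exact absurd (Finset.mem_filter.2 ⟨h, hlt⟩) hn
  · intro m _ hne
    apply Finset.sum_eq_zero
    intro m' hm'
    rw [if_neg fun e => hne (key m m' hm' e).1]
  · simp

theorem coef_liftElem_leg (a : Γ.LiftData) {n : Γ.Node} {u : Γ.Leaf} (h : u ∈ Γ.leaves n)
    {v : V} (hv : v ∈ Γ.interior n u) :
    Γ.coef (Γ.liftElem a : V → ℚ) v = 0 := by
  have hv2 := Γ.valency_interior (Γ.mem_leaves.1 h) hv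
  rw [Γ.coef_liftElem_two a hv2]
  refine Finset.sum_eq_zero fun m _ => Finset.sum_eq_zero fun m' hm' => ?_
  rw [if_neg]
  intro e
  have h1 := (Finset.mem_filter.1 hm').1
  rw [← e] at hv2 hv
  exact Γ.not_mem_interior_leg h1 h (Γ.next_mem_interior_of_valency h1 hv2) hv

/-- The far-end relation along a chain for a vector which has the same coordinates as `-a` on the
chains. -/
theorem lift_chain_relation (a : Γ.LiftData) (x : V → ℚ)
    (hx : ∀ v, Γ.valency v = 2 → Γ.coef x v = -Γ.coef (Γ.liftElem a : V → ℚ) v)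
    {n n' : Γ.Node} (h : n' ∈ Γ.nbrs n) (hlt : n < n') (hadj : 1 < Γ.len n n') :
    (Γ.chainSeifert n n').1 * x (Γ.next n' n) =
      x n + (Γ.chainSeifert n' n).2 * x n' - a.chain n n' := by
  have hco : ∀ v ∈ Γ.interior n n', Γ.coef x v =
      -(if Γ.next n n' = v then (a.chain n n' : ℚ) else 0) := fun v hv => by
    rw [hx v (Γ.valency_interior (Γ.mem_nbrs.1 h).2 hv), Γ.coef_liftElem_chain a h hlt hv]
  have := Γ.chain_relation_last x (Γ.nbrs_comm.1 h) (fun v hv hne => by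
    rw [hco v (Γ.interior_comm.1 hv), if_neg hne.symm, neg_zero]) (by rw [len_comm]; exact hadj)
  rw [Γ.chainSeifert_comm n n', hco _ (Γ.next_mem_interior hadj), if_pos rfl] at this
  linarith

/-- By `lift_chain_relation` the vertex next to `n'` has coordinate (ℓ_n + ω_{n',n} ℓ_{n'} -
a_{n_{n'}}) / α_{n,n'}, so its integrality is the congruence of the chain. An empty chain has
modulus 1. -/
theorem mem_affineLattice_of_integral (a : Γ.LiftData) (x : V → ℚ) (l : Γ.Node → ℤ)
    (hx : ∀ v, Γ.valency v = 2 → Γ.coef x v = -Γ.coef (Γ.liftElem a : V → ℚ) v)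
    (hl : ∀ n : Γ.Node, x n = l n) (hint : ∀ v, ∃ k : ℤ, x v = k) : l ∈ Γ.affineLattice a := by
  intro n n' h hlt
  by_cases hadj : 1 < Γ.len n n'
  · obtain ⟨k, hk⟩ := hint (Γ.next n' n)
    have := Γ.lift_chain_relation a x hx h hlt hadj
    rw [hk, hl, hl] at this
    apply Int.ModEq.symm
    rw [Int.modEq_iff_dvd]
    exact ⟨k, by exact_mod_cast this.symm⟩
  · rw [(Γ.next_eq_of_len h hadj).2]
    exact Int.modEq_one

theorem leg_integral (a : Γ.LiftData) (x : V → ℚ) (l : Γ.Node → ℤ)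
    (hx : ∀ v, Γ.valency v = 2 → Γ.coef x v = -Γ.coef (Γ.liftElem a : V → ℚ) v)
    (hl : ∀ n : Γ.Node, x n = l n) (hint : ∀ v, ∃ k : ℤ, x v = k) {n : Γ.Node} {u : Γ.Leaf}
    (h : u ∈ Γ.leaves n) :
    ∃ j : ℤ, Γ.coef x u + (Γ.legSeifert n u).2 * l n = (Γ.legSeifert n u).1 * j := by
  obtain ⟨k, hk⟩ := hint (Γ.next n u)
  refine ⟨k, ?_⟩
  rw [← hk, Γ.leg_relation x h, hl]
  · ring
  · intro v hv
    rw [hx v (Γ.valency_interior (Γ.mem_leaves.1 h) hv), Γ.coef_liftElem_leg a h hv, neg_zero]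

/-- The congruence of a chain gives an integer next to its larger node, the divisibility on a leg an
integer next to its node; the recurrence then carries integrality along (`integral_along`).
Comparability of linked nodes lets every chain be read in the direction used by the lift. -/
theorem integral_of_mem_affineLattice [Nonempty Γ.Node]
    (hord : ∀ n, ∀ n' ∈ Γ.nbrs n, n < n' ∨ n' < n) (a : Γ.LiftData) (x : V → ℚ) (l : Γ.Node → ℤ)
    (hx : ∀ v, Γ.valency v = 2 → Γ.coef x v = -Γ.coef (Γ.liftElem a : V → ℚ) v)
    (hl : ∀ n : Γ.Node, x n = l n) (hmem : l ∈ Γ.affineLattice a)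
    (hleg : ∀ n, ∀ u ∈ Γ.leaves n, ∃ j : ℤ,
      Γ.coef x u + (Γ.legSeifert n u).2 * l n = (Γ.legSeifert n u).1 * j) (v : V) :
    ∃ k : ℤ, x v = k := by
  have hco : ∀ {w w' : V}, Γ.Linked w w' → ∀ z ∈ Γ.interior w w', ∃ k : ℤ, Γ.coef x z = k := by
    intro w w' h z hz
    obtain ⟨k, hk⟩ := Γ.exists_coef_dualLattice (Γ.liftElem a) z
    exact ⟨-k, by rw [hx z (Γ.valency_interior h hz), hk]; push_cast; rfl⟩
  rcases Γ.vertex_cases v with ⟨n, rfl⟩ | ⟨n, n', h, hv⟩ | ⟨u, hu⟩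
  · exact ⟨l n, hl n⟩
  · have key : ∀ {n n' : Γ.Node}, n' ∈ Γ.nbrs n → n < n' → v ∈ Γ.interior n n' →
        ∃ k : ℤ, x v = k := by
      intro n n' h hlt hv
      have hadj : 1 < Γ.len n n' := by
        obtain ⟨i, h0, h1, -⟩ := Γ.mem_interior.1 hv
        omega
      obtain ⟨k, hk⟩ := Int.modEq_iff_dvd.1 (hmem n n' h hlt).symm
      have hr := Γ.lift_chain_relation a x hx h hlt hadj
      have hp := Γ.chain_pos h
      rw [hl, hl] at hr
      have hk' : (l n : ℚ) + (Γ.chainSeifert n' n).2 * l n' - a.chain n n' =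
        (Γ.chainSeifert n n').1 * k := by exact_mod_cast hk
      rw [hk'] at hr
      have hl' := (Γ.mem_nbrs.1 h).2.symm
      obtain ⟨i, h0, h1, rfl⟩ := Γ.mem_interior.1 (Γ.interior_comm.1 hv)
      exact Γ.integral_along x hl' ⟨_, hl n'⟩ ⟨k, mul_left_cancel₀ hp.ne' hr⟩ (hco hl') i h1.le
    rcases hord n n' h with hlt | hlt
    · exact key h hlt hv
    · exact key (Γ.nbrs_comm.1 h) hlt (Γ.interior_comm.1 hv)
  · have h := Γ.mem_leaves_base u
    have hl' := Γ.mem_leaves.1 h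
    obtain ⟨j, hj⟩ := hleg _ u h
    have hp : (0 : ℚ) < (Γ.legSeifert (Γ.base u) u).1 := by exact_mod_cast Γ.leg_pos h
    have hr := Γ.leg_relation x h fun v hv => by
      rw [hx v (Γ.valency_interior hl' hv), Γ.coef_liftElem_leg a h hv, neg_zero]
    rw [hl, add_comm, hj] at hr
    have hall := Γ.integral_along x hl' ⟨_, hl (Γ.base u)⟩ ⟨j, mul_left_cancel₀ hp.ne' hr⟩ (hco hl')
    rcases hu with rfl | hu
    · simpa using hall _ le_rfl
    · obtain ⟨i, h0, h1, rfl⟩ := Γ.mem_interior.1 hu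
      exact hall i h1.le

end Order
end PlumbingTree
end
noncomputable section
open scoped Classical
universe u

/-! ### Power series in separate variables -/

theorem coeff_toMvPowerSeries {σ : Type*} (i : σ) (f : PowerSeries ℤ) (m : σ →₀ ℕ) :
    MvPowerSeries.coeff m (f.toMvPowerSeries i) =
      if m = Finsupp.single i (m i) then PowerSeries.coeff (m i) f else 0 := by
  have hs : ∀ k : Unit →₀ ℕ, Finsupp.mapDomain (fun _ : Unit => i) k = Finsupp.single i (k ()) := by
    intro k
    rw [Finsupp.unique_single k, Finsupp.mapDomain_single]
    simp
  split_ifs with h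
  · have h2 := MvPowerSeries.coeff_embDomain_rename (R := ℤ) (Function.Embedding.punit i) f
      (Finsupp.single () (m i))
    rw [Finsupp.embDomain_single] at h2
    have h3 : MvPowerSeries.coeff (Finsupp.single i (m i)) (MvPowerSeries.rename (fun _ => i) f) =
      PowerSeries.coeff (m i) f := h2
    rw [h]
    simpa [PowerSeries.toMvPowerSeries_apply] using h3
  · rw [PowerSeries.toMvPowerSeries_apply]
    apply MvPowerSeries.coeff_rename_eq_zero
    rintro ⟨k, rfl⟩
    apply h
    rw [hs]
    simp

/-- The factors involve separate variables, so only the decomposition of `m` into its pure powers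
contributes. -/
theorem coeff_prod_toMvPowerSeries {σ : Type*} [Fintype σ] (f : σ → PowerSeries ℤ) (m : σ →₀ ℕ) :
    MvPowerSeries.coeff m (∏ i, (f i).toMvPowerSeries i) =
      ∏ i, PowerSeries.coeff (m i) (f i) := by
  rw [MvPowerSeries.coeff_prod]
  set l0 : σ →₀ (σ →₀ ℕ) := Finsupp.equivFunOnFinite.symm fun i => Finsupp.single i (m i) with hl0
  rw [Finset.sum_eq_single l0]
  · refine Finset.prod_congr rfl fun i _ => ?_
    simp [coeff_toMvPowerSeries, hl0]
  · intro l hl hne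
    by_contra h0
    apply hne
    have h1 : ∀ i, l i = Finsupp.single i (l i i) := by
      intro i
      by_contra h
      apply h0
      apply Finset.prod_eq_zero (Finset.mem_univ i)
      rw [coeff_toMvPowerSeries, if_neg h]
    have h2 : ∑ i, l i = m := (Finset.mem_finsuppAntidiag.1 hl).1
    ext i : 1
    rw [h1 i]
    have h3 : m i = l i i := by
      rw [← h2, Finsupp.finsetSum_apply, Finset.sum_eq_single i]
      · intro j _ hj
        rw [h1 j, Finsupp.single_apply, if_neg hj]
      · simp
    simp [hl0, h3]
  · intro h
    exfalso
    apply h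
    rw [Finset.mem_finsuppAntidiag]
    refine ⟨?_, Finset.subset_univ _⟩
    simp [hl0]

/-- The product of the coefficients of power series which are grouped by a map `κ`. -/
theorem finsum_prod_coeff {W N : Type*} [Fintype W] [Fintype N] [DecidableEq N] (κ : W → N)
    (f : W → PowerSeries ℤ) (M : N → ℕ) :
    ∑ᶠ q ∈ {q : W → ℕ | ∀ n, ∑ w ∈ Finset.univ.filter (fun w => κ w = n), q w = M n},
      ∏ w, PowerSeries.coeff (q w) (f w) =
    ∏ n, PowerSeries.coeff (M n) (∏ w ∈ Finset.univ.filter (fun w => κ w = n), f w) := by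
  simp only [PowerSeries.coeff_prod]
  rw [Finset.prod_univ_sum, ← finsum_mem_coe_finset]
  symm
  -- A family with `p n` supported on the fibre of `n` is the same as a single function on `W`.
  refine finsum_mem_eq_of_bijOn (fun p w => p (κ w) w) ⟨?_, ?_, ?_⟩ ?_
  · intro p hp n
    have := (Finset.mem_finsuppAntidiag.1 (Fintype.mem_piFinset.1 hp n)).1
    rw [← this]
    refine Finset.sum_congr rfl fun w hw => ?_
    simp only [(Finset.mem_filter.1 hw).2]
  · intro p hp p' hp' h
    funext n
    ext w
    have h1 := (Finset.mem_finsuppAntidiag.1 (Fintype.mem_piFinset.1 hp n)).2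
    have h2 := (Finset.mem_finsuppAntidiag.1 (Fintype.mem_piFinset.1 hp' n)).2
    by_cases hw : κ w = n
    · have := congrFun h w
      simp only [hw] at this
      exact this
    · have e1 : p n w = 0 := by
        by_contra h0
        exact hw (Finset.mem_filter.1 (h1 (Finsupp.mem_support_iff.2 h0))).2
      have e2 : p' n w = 0 := by
        by_contra h0
        exact hw (Finset.mem_filter.1 (h2 (Finsupp.mem_support_iff.2 h0))).2
      rw [e1, e2]
  · intro q hq
    refine ⟨fun n => Finsupp.equivFunOnFinite.symm fun w => if κ w = n then q w else 0, ?_, ?_⟩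
    · refine Fintype.mem_piFinset.2 fun n => Finset.mem_finsuppAntidiag.2 ⟨?_, ?_⟩
      · rw [← hq n]
        refine Finset.sum_congr rfl fun w hw => ?_
        simp [(Finset.mem_filter.1 hw).2]
      · intro w hw
        rw [Finsupp.mem_support_iff] at hw
        refine Finset.mem_filter.2 ⟨Finset.mem_univ _, ?_⟩
        by_contra h
        simp [h] at hw
    · funext w
      simp
  · intro p hp
    rw [← Finset.prod_fiberwise (Finset.univ : Finset W) κ]
    refine Finset.prod_congr rfl fun n _ => Finset.prod_congr rfl fun w hw => ?_
    simp only [(Finset.mem_filter.1 hw).2]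

theorem one_sub_X_mul_geom : (1 - PowerSeries.X) * PowerSeries.mk (1 : ℕ → ℤ) = 1 := by
  rw [mul_comm]
  exact PowerSeries.mk_one_mul_one_sub_eq_one ℤ

/-- The one-variable series `(1 - X)^{d-2}`. -/
def localSeries (d : ℕ) : PowerSeries ℤ :=
  (1 - PowerSeries.X) ^ d * PowerSeries.mk (1 : ℕ → ℤ) ^ 2

theorem localSeries_one : localSeries 1 = PowerSeries.mk 1 := by
  rw [localSeries, pow_one, pow_two, ← mul_assoc, one_sub_X_mul_geom, one_mul]

theorem localSeries_add_two (d : ℕ) : localSeries (d + 2) = (1 - PowerSeries.X) ^ d := by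
  rw [localSeries, pow_add, mul_assoc, ← mul_pow, one_sub_X_mul_geom, one_pow, mul_one]

theorem localSeries_mul_geom (d e : ℕ) :
    localSeries (d + e) * PowerSeries.mk 1 ^ e = localSeries d := by
  have : (1 - PowerSeries.X) ^ e * PowerSeries.mk (1 : ℕ → ℤ) ^ e = 1 := by
    rw [← mul_pow, one_sub_X_mul_geom, one_pow]
  rw [localSeries, localSeries, pow_add]
  linear_combination (1 - PowerSeries.X) ^ d * PowerSeries.mk (1 : ℕ → ℤ) ^ 2 * this

theorem coeff_one_sub_X_pow (d k : ℕ) :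
    PowerSeries.coeff k ((1 - PowerSeries.X : PowerSeries ℤ) ^ d) = (-1) ^ k * (d.choose k : ℤ) := by
  have h : (1 - PowerSeries.X : PowerSeries ℤ) ^ d =
      ∑ j ∈ Finset.range (d + 1), PowerSeries.C ((-1) ^ j * (d.choose j : ℤ)) * PowerSeries.X ^ j := by
    rw [sub_eq_neg_add, add_pow]
    refine Finset.sum_congr rfl fun j _ => ?_
    rw [one_pow, mul_one, neg_pow]
    simp only [map_mul, map_pow, map_neg, map_one, map_natCast]
    ring
  rw [h, map_sum]
  simp only [PowerSeries.coeff_C_mul, PowerSeries.coeff_X_pow, mul_ite, mul_one, mul_zero]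
  rw [Finset.sum_ite_eq]
  split_ifs with hk
  · rfl
  · rw [Finset.mem_range, not_lt] at hk
    rw [Nat.choose_eq_zero_of_lt (by omega)]
    simp

namespace PlumbingTree
variable {V : Type u} [Fintype V] [DecidableEq V] (Γ : PlumbingTree V)

theorem zeta_eq : Γ.zeta = ∏ v, (localSeries (Γ.valency v)).toMvPowerSeries v := by
  refine Finset.prod_congr rfl fun v _ => ?_
  have h1 : (1 - MvPowerSeries.X v : MvPowerSeries V ℤ) =
      (1 - PowerSeries.X : PowerSeries ℤ).toMvPowerSeries v := by
    rw [map_sub, map_one, PowerSeries.toMvPowerSeries_X]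
  have h2 : (1 - MvPowerSeries.X v) * MvPowerSeries.invOfUnit (1 - MvPowerSeries.X v) (1 : ℤˣ) = 1 :=
    MvPowerSeries.mul_invOfUnit _ _ (by simp)
  have h3 : (1 - MvPowerSeries.X v : MvPowerSeries V ℤ) *
      (PowerSeries.mk (1 : ℕ → ℤ)).toMvPowerSeries v = 1 := by
    rw [h1, ← map_mul, one_sub_X_mul_geom, map_one]
  have h4 : MvPowerSeries.invOfUnit (1 - MvPowerSeries.X v) (1 : ℤˣ) =
      (PowerSeries.mk (1 : ℕ → ℤ)).toMvPowerSeries v := by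
    rw [mul_comm] at h3
    exact (left_inv_eq_right_inv h3 h2).symm
  rw [h4, h1, localSeries, map_mul, map_pow, map_pow]

theorem coeff_zeta (m : V →₀ ℕ) :
    MvPowerSeries.coeff m Γ.zeta = ∏ v, PowerSeries.coeff (m v) (localSeries (Γ.valency v)) := by
  rw [zeta_eq, coeff_prod_toMvPowerSeries]

end PlumbingTree
end
noncomputable section
open scoped Classical
universe u
theorem floor_div_intCast (e : ℤ) {α : ℤ} (hα : 0 < α) : ⌊(e : ℚ) / α⌋ = e / α := by
  have hq : (0 : ℚ) < α := by exact_mod_cast hα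
  have h1 := Int.emod_nonneg e hα.ne'
  have h2 := Int.emod_lt_of_pos e hα
  have h3 := Int.mul_ediv_add_emod e α
  rw [Int.floor_eq_iff, le_div_iff₀ hq, div_lt_iff₀ hq]
  constructor
  · have : e / α * α ≤ e := by linarith [mul_comm (e / α) α]
    exact_mod_cast this
  · have : e < (e / α + 1) * α := by linarith [mul_comm (e / α) α]
    exact_mod_cast this

theorem fract_div_intCast (e : ℤ) {α : ℤ} (hα : 0 < α) :
    Int.fract ((e : ℚ) / α) = ((e % α : ℤ) : ℚ) / α := by
  have hq : (0 : ℚ) < α := by exact_mod_cast hα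
  rw [Int.fract, floor_div_intCast e hα]
  have h3 : (α : ℚ) * ((e / α : ℤ) : ℚ) + ((e % α : ℤ) : ℚ) = e := by
    exact_mod_cast Int.mul_ediv_add_emod e α
  field_simp
  linarith

namespace PlumbingTree
variable {V : Type u} [Fintype V] [DecidableEq V] (Γ : PlumbingTree V)

/-! ### The coefficients of the reduced series -/

/-- Every `E_v^*` has a positive coordinate at a node, so prescribing that coordinate of the sum
bounds each multiplicity. -/
theorem fiber_finite [Nonempty Γ.Node] (h : Γ.H) (x : Γ.Node → ℚ) : (Γ.fiber h x).Finite := by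
  obtain ⟨n⟩ := ‹Nonempty Γ.Node›
  set B : V → ℕ := fun v => ⌊x n / Γ.dualVec v n⌋₊ with hB
  apply (Set.finite_Iic (Finsupp.equivFunOnFinite.symm B)).subset
  rintro m ⟨-, hm⟩
  rw [Set.mem_Iic]
  intro v
  have h1 := congrFun hm n
  rw [proj_eq, res_apply] at h1
  simp only [AddSubgroup.val_finsetSum, AddSubgroup.coe_nsmul, Estar, Finset.sum_apply,
    nsmul_eq_mul] at h1
  have h2 : (m v : ℚ) * Γ.dualVec v n ≤ x n := by
    rw [← h1]
    exact Finset.single_le_sum (f := fun v => (m v : ℚ) * Γ.dualVec v n)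
      (fun w _ => mul_nonneg (Nat.cast_nonneg _) (Γ.dualVec_pos w n).le) (Finset.mem_univ v)
  exact Nat.le_floor ((le_div_iff₀ (Γ.dualVec_pos v n)).2 h2)

theorem toQ_injective : Function.Injective Γ.toQ := by
  intro l l' h
  funext n
  have := congrFun h n
  simpa [toQ] using this

/-- `∑_v m_v E_v^*` for rational `m`. -/
def elem (m : V → ℚ) : V → ℚ := ∑ v, m v • Γ.dualVec v

theorem coef_elem (m : V → ℚ) : Γ.coef (Γ.elem m) = m := Γ.coef_sum_dualVec m

theorem coe_sum_Estar (m : V →₀ ℕ) :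
    ((∑ v, m v • Γ.Estar v : Γ.dualLattice) : V → ℚ) = Γ.elem fun v => (m v : ℚ) := by
  simp only [elem, AddSubgroup.val_finsetSum, AddSubgroup.coe_nsmul, Estar]
  refine Finset.sum_congr rfl fun v _ => ?_
  rw [Nat.cast_smul_eq_nsmul]

theorem orb_elem (m : V → ℚ) (hm : ∀ v, Γ.valency v = 2 → m v = 0) (n : Γ.Node) :
    Γ.orb (Γ.res (Γ.elem m)) n = m n + ∑ u ∈ Γ.leaves n, m u / (Γ.legSeifert n u).1 := by
  rw [orb_res, coef_elem, Finset.sum_eq_zero (s := Γ.nbrs n), add_zero]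
  · congr 1
    refine Finset.sum_congr rfl fun u hu => ?_
    rw [Γ.leg_defect _ hu, coef_elem]
    intro v hv
    rw [coef_elem, hm v (Γ.valency_interior (Γ.mem_leaves.1 hu) hv)]
  · intro n' hn'
    apply Γ.chain_defect _ hn'
    intro v hv
    rw [coef_elem, hm v (Γ.valency_interior (Γ.mem_nbrs.1 hn').2 hv)]

/-- The integer `a_u - ω_u ℓ_n`. -/
def legDefect [Nonempty Γ.Node] (a : Γ.LiftData) (l : Γ.Node → ℤ) (u : Γ.Leaf) : ℤ :=
  a.leaf u - (Γ.legSeifert (Γ.base u) u).2 * l (Γ.base u)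

/-- The exponent vector on the vertices which belongs to the multiplicities `q` of the nodes and
the ends. -/
def expand [Nonempty Γ.Node] (a : Γ.LiftData) (l : Γ.Node → ℤ) (q : Γ.Node ⊕ Γ.Leaf → ℕ) : V →₀ ℕ :=
  Finsupp.equivFunOnFinite.symm fun v => if h : 3 ≤ Γ.valency v then q (Sum.inl ⟨v, h⟩) else
    if h : Γ.valency v = 1 then
      (Γ.legDefect a l ⟨v, h⟩ % (Γ.legSeifert (Γ.base ⟨v, h⟩) ⟨v, h⟩).1).toNat +
        (Γ.legSeifert (Γ.base ⟨v, h⟩) ⟨v, h⟩).1.toNat * q (Sum.inr ⟨v, h⟩) else 0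

theorem expand_node [Nonempty Γ.Node] (a : Γ.LiftData) (l : Γ.Node → ℤ)
    (q : Γ.Node ⊕ Γ.Leaf → ℕ) (n : Γ.Node) : Γ.expand a l q n = q (Sum.inl n) := by
  simp only [expand, Finsupp.equivFunOnFinite_symm_apply_apply]
  rw [dif_pos n.2]

theorem expand_leaf [Nonempty Γ.Node] (a : Γ.LiftData) (l : Γ.Node → ℤ)
    (q : Γ.Node ⊕ Γ.Leaf → ℕ) (u : Γ.Leaf) : (Γ.expand a l q u : ℤ) =
      Γ.legDefect a l u % (Γ.legSeifert (Γ.base u) u).1 +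
        (Γ.legSeifert (Γ.base u) u).1 * q (Sum.inr u) := by
  have h := u.2
  have hp := Γ.leg_pos (Γ.mem_leaves_base u)
  simp only [expand, Finsupp.equivFunOnFinite_symm_apply_apply]
  rw [dif_neg (by omega), dif_pos h]
  push_cast
  rw [Int.toNat_of_nonneg (Int.emod_nonneg _ hp.ne'), Int.toNat_of_nonneg hp.le]

theorem expand_two [Nonempty Γ.Node] (a : Γ.LiftData) (l : Γ.Node → ℤ)
    (q : Γ.Node ⊕ Γ.Leaf → ℕ) {v : V} (hv : Γ.valency v = 2) : Γ.expand a l q v = 0 := by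
  simp only [expand, Finsupp.equivFunOnFinite_symm_apply_apply]
  rw [dif_neg (by omega), dif_neg (by omega)]

/-- The node of a node or an end. -/
def nodeOf [Nonempty Γ.Node] : Γ.Node ⊕ Γ.Leaf → Γ.Node := Sum.elim id Γ.base

theorem sum_nodeOf [Nonempty Γ.Node] {M : Type*} [AddCommMonoid M] (f : Γ.Node ⊕ Γ.Leaf → M)
    (n : Γ.Node) : ∑ w ∈ Finset.univ.filter (fun w => Γ.nodeOf w = n), f w =
      f (Sum.inl n) + ∑ u ∈ Γ.leaves n, f (Sum.inr u) := by
  rw [Finset.sum_filter, Fintype.sum_sum_type]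
  congr 1
  · rw [Finset.sum_eq_single n]
    · exact if_pos rfl
    · intro m _ hm
      exact if_neg hm
    · simp
  · rw [← Finset.sum_filter]
    refine Finset.sum_congr ?_ fun _ _ => rfl
    ext u
    rw [Finset.mem_filter, mem_leaves_iff]
    exact ⟨fun h => h.2, fun h => ⟨Finset.mem_univ _, h⟩⟩

theorem vertex_trichotomy [Nonempty Γ.Node] (v : V) :
    (∃ n : Γ.Node, v = n) ∨ (∃ u : Γ.Leaf, v = u) ∨ Γ.valency v = 2 := by
  by_cases h3 : 3 ≤ Γ.valency v
  · exact Or.inl ⟨⟨v, h3⟩, rfl⟩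
  · obtain ⟨n⟩ := ‹Nonempty Γ.Node›
    have hne : v ≠ n := by rintro rfl; exact h3 n.2
    have := Γ.one_le_valency_of_ne hne
    by_cases h1 : Γ.valency v = 1
    · exact Or.inr (Or.inl ⟨⟨v, h1⟩, rfl⟩)
    · exact Or.inr (Or.inr (by omega))

/-- The coefficient of `s^k` in `(1 - s)^{δ_{n,𝒩} - 2}`, for `δ_{n,𝒩} ≥ 1`. -/
def nodeCoeff (n : Γ.Node) (k : ℕ) : ℤ :=
  if n ∈ Γ.hatNodes then (-1) ^ k * ((Γ.nodeValency n - 2).choose k : ℤ) else 1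

theorem coeff_localSeries_node (hval : ∀ n, 1 ≤ Γ.nodeValency n) (n : Γ.Node) (k : ℕ) :
    PowerSeries.coeff k (localSeries (Γ.nodeValency n)) = Γ.nodeCoeff n k := by
  rw [nodeCoeff]
  have h1 := hval n
  split_ifs with h
  · have h2 : 2 ≤ Γ.nodeValency n := (Finset.mem_filter.1 h).2
    obtain ⟨d, hd⟩ : ∃ d, Γ.nodeValency n = d + 2 := ⟨Γ.nodeValency n - 2, by omega⟩
    rw [hd, localSeries_add_two, coeff_one_sub_X_pow, Nat.add_sub_cancel]
  · have h2 : ¬ 2 ≤ Γ.nodeValency n := fun h' => h (Finset.mem_filter.2 ⟨Finset.mem_univ _, h'⟩)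
    rw [show Γ.nodeValency n = 1 by omega, localSeries_one]
    simp

/-- The series attached to a node or an end. -/
def vertexSeries : Γ.Node ⊕ Γ.Leaf → PowerSeries ℤ :=
  Sum.elim (fun n => localSeries (Γ.valency n)) fun _ => PowerSeries.mk 1

theorem coeff_zeta_expand [Nonempty Γ.Node] (a : Γ.LiftData) (l : Γ.Node → ℤ)
    (q : Γ.Node ⊕ Γ.Leaf → ℕ) :
    MvPowerSeries.coeff (Γ.expand a l q) Γ.zeta =
      ∏ w, PowerSeries.coeff (q w) (Γ.vertexSeries w) := by
  rw [coeff_zeta, Fintype.prod_sum_type,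
    ← Fintype.prod_subtype_mul_prod_subtype (fun v => 3 ≤ Γ.valency v)]
  congr 1
  · refine Finset.prod_congr rfl fun n _ => ?_
    rw [Γ.expand_node a l q n]
    rfl
  · rw [Finset.prod_eq_one, Finset.prod_eq_one]
    · intro u _
      simp [vertexSeries]
    · rintro ⟨v, hv⟩ -
      rcases Γ.vertex_trichotomy v with ⟨n, rfl⟩ | ⟨u, rfl⟩ | h2
      · exact absurd n.2 hv
      · simp only [u.2, localSeries_one]
        simp
      · simp only [h2, Γ.expand_two a l q h2]
        rw [show 2 = 0 + 2 from rfl, localSeries_add_two]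
        simp

/-! ### Exponents of given class and node coordinates -/

section Order
variable [PartialOrder Γ.Node]

theorem linear_eq_quasi [Nonempty Γ.Node] (a : Γ.LiftData) (l : Γ.Node → ℤ) (n : Γ.Node) :
    Γ.linear a l n = Γ.quasi a l n + ∑ u ∈ Γ.leaves n,
      ((Γ.legDefect a l u % (Γ.legSeifert (Γ.base u) u).1 : ℤ) : ℚ) /
        (Γ.legSeifert (Γ.base u) u).1 := by
  rw [linear]
  congr 1
  refine Finset.sum_congr rfl fun u hu => ?_
  rw [← fract_div_intCast _ (Γ.leg_pos (Γ.mem_leaves_base u)), legDefect, Γ.mem_leaves_iff.1 hu]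
  push_cast
  rfl

/-- The multiplicities `m` are rational on purpose: `quasi_integral` applies this before the node
multiplicities are known to be integers. -/
theorem elem_lift_integral [Nonempty Γ.Node] (hord : ∀ n, ∀ n' ∈ Γ.nbrs n, n < n' ∨ n' < n)
    (a : Γ.LiftData) (m : V → ℚ) (hm : ∀ v, Γ.valency v = 2 → m v = 0) (l : Γ.Node → ℤ)
    (hl : l ∈ Γ.affineLattice a)
    (hres : Γ.res (Γ.elem m) = Γ.shift a + Γ.toQ l)
    (hleg : ∀ u : Γ.Leaf, ∃ j : ℤ, m u - Γ.legDefect a l u = (Γ.legSeifert (Γ.base u) u).1 * j)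
    (v : V) : ∃ k : ℤ, Γ.elem m v - (Γ.liftElem a : V → ℚ) v = k := by
  refine Γ.integral_of_mem_affineLattice hord a (Γ.elem m - Γ.liftElem a) l ?_ ?_ hl ?_ v
  · intro v hv
    rw [map_sub, Pi.sub_apply, coef_elem, hm v hv, zero_sub]
  · intro n
    have := congrFun hres n
    rw [shift, proj_eq] at this
    simp only [res_apply, Pi.add_apply, toQ] at this
    rw [Pi.sub_apply, this]
    ring
  · intro n u hu
    obtain ⟨j, hj⟩ := hleg u
    refine ⟨j, ?_⟩
    rw [map_sub, Pi.sub_apply, coef_elem, coef_liftElem_leaf]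
    rw [legDefect, Γ.mem_leaves_iff.1 hu] at hj
    rw [← hj]
    push_cast
    ring

/-- Equality of classes is integrality of the difference with `a`, which splits into the condition
on ℤ^𝒩(a) and one divisibility per leg. As `orb` is injective, the node coordinates may be compared
after applying it. -/
theorem mem_fiber_iff [Nonempty Γ.Node] (hord : ∀ n, ∀ n' ∈ Γ.nbrs n, n < n' ∨ n' < n)
    {h : Γ.H} {a : Γ.LiftData} (ha : Γ.IsReducedLift a h) (m : V →₀ ℕ)
    (hm : ∀ v, Γ.valency v = 2 → m v = 0) (x : Γ.Node → ℚ) :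
    m ∈ Γ.fiber h x ↔ ∃ l ∈ Γ.affineLattice a, x = Γ.shift a + Γ.toQ l ∧
      (∀ u : Γ.Leaf, ∃ j : ℤ, (m u : ℤ) - Γ.legDefect a l u = (Γ.legSeifert (Γ.base u) u).1 * j) ∧
      ∀ n : Γ.Node, (m n : ℚ) + ∑ u ∈ Γ.leaves n, (m u : ℚ) / (Γ.legSeifert n u).1 =
        Γ.linear a l n := by
  have hmq : ∀ v, Γ.valency v = 2 → (m v : ℚ) = 0 := fun v hv => by rw [hm v hv]; rfl
  have hcls : Γ.cls (∑ v, m v • Γ.Estar v) = h ↔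
      ∀ v, ∃ k : ℤ, Γ.elem (fun v => (m v : ℚ)) v - (Γ.liftElem a : V → ℚ) v = k := by
    rw [← ha, cls_eq_iff, coe_sum_Estar]
  have hproj : Γ.proj (∑ v, m v • Γ.Estar v) = Γ.res (Γ.elem fun v => (m v : ℚ)) := by
    rw [proj_eq, coe_sum_Estar]
  have horb := Γ.orb_elem _ hmq
  constructor
  · rintro ⟨h1, h2⟩
    rw [hcls] at h1
    rw [hproj] at h2
    choose k hk using h1
    have hl : ∀ n : Γ.Node, (Γ.elem (fun v => (m v : ℚ)) - Γ.liftElem a) n = (k n : ℚ) :=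
      fun n => hk n
    have hc : ∀ v, Γ.valency v = 2 → Γ.coef (Γ.elem (fun v => (m v : ℚ)) - Γ.liftElem a) v =
        -Γ.coef (Γ.liftElem a : V → ℚ) v := by
      intro v hv
      rw [map_sub, Pi.sub_apply, coef_elem, hm v hv]
      simp
    have hint : ∀ v, ∃ k : ℤ, (Γ.elem (fun v => (m v : ℚ)) - Γ.liftElem a) v = (k : ℚ) :=
      fun v => ⟨k v, hk v⟩
    have hx : Γ.res (Γ.elem fun v => (m v : ℚ)) = Γ.shift a + Γ.toQ fun n => k n := by
      funext n
      have := hk n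
      rw [shift, proj_eq]
      simp only [res_apply, Pi.add_apply, toQ]
      linarith
    refine ⟨fun n => k n, Γ.mem_affineLattice_of_integral a _ _ hc hl hint, ?_, ?_, ?_⟩
    · rw [← h2, hx]
    · intro u
      obtain ⟨j, hj⟩ := Γ.leg_integral a _ _ hc hl hint (Γ.mem_leaves_base u)
      refine ⟨j, ?_⟩
      rw [map_sub, Pi.sub_apply, coef_elem, coef_liftElem_leaf] at hj
      rw [legDefect]
      have : ((m u : ℤ) : ℚ) - a.leaf u + (Γ.legSeifert (Γ.base u) u).2 * (k (Γ.base u) : ℤ) =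
        (Γ.legSeifert (Γ.base u) u).1 * j := by exact_mod_cast hj
      have h5 : (m u : ℤ) - a.leaf u + (Γ.legSeifert (Γ.base u) u).2 * k (Γ.base u) =
        (Γ.legSeifert (Γ.base u) u).1 * j := by exact_mod_cast this
      linarith
    · intro n
      rw [linear_eq_orb, ← hx, horb]
  · rintro ⟨l, hl, hx, hj, hlin⟩
    have hres : Γ.res (Γ.elem fun v => (m v : ℚ)) = Γ.shift a + Γ.toQ l := by
      apply Γ.orb_injective
      funext n
      rw [horb, hlin, linear_eq_orb]
    refine ⟨hcls.2 (Γ.elem_lift_integral hord a _ hmq l hl hres ?_), by rw [hproj, hres, hx]⟩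
    intro u
    obtain ⟨j, hj⟩ := hj u
    exact ⟨j, by exact_mod_cast hj⟩

/-- Take the vector with multiplicity N_a(ℓ, n) at each node and the residue of a_u - ω_u ℓ_n at
each end. Its node coordinates are 𝐜_a + ℓ and it differs from `a` by an integral vector. Integral
vectors have integral coefficients, and so does `a`, hence also N_a(ℓ, n). -/
theorem quasi_integral [Nonempty Γ.Node] (hord : ∀ n, ∀ n' ∈ Γ.nbrs n, n < n' ∨ n' < n)
    (a : Γ.LiftData) {l : Γ.Node → ℤ} (hl : l ∈ Γ.affineLattice a) (n : Γ.Node) :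
    ∃ k : ℤ, Γ.quasi a l n = k := by
  set m : V → ℚ := fun v => if h : 3 ≤ Γ.valency v then Γ.quasi a l ⟨v, h⟩ else
    if h : Γ.valency v = 1 then
      ((Γ.legDefect a l ⟨v, h⟩ % (Γ.legSeifert (Γ.base ⟨v, h⟩) ⟨v, h⟩).1 : ℤ) : ℚ) else 0 with hm
  have hmn : ∀ n : Γ.Node, m n = Γ.quasi a l n := fun n => by simp only [hm]; rw [dif_pos n.2]
  have hmu : ∀ u : Γ.Leaf, m u =
      ((Γ.legDefect a l u % (Γ.legSeifert (Γ.base u) u).1 : ℤ) : ℚ) := fun u => by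
    have := u.2
    simp only [hm]; rw [dif_neg (by omega), dif_pos u.2]
  have hm2 : ∀ v, Γ.valency v = 2 → m v = 0 := fun v hv => by
    simp only [hm]; rw [dif_neg (by omega), dif_neg (by omega)]
  have hres : Γ.res (Γ.elem m) = Γ.shift a + Γ.toQ l := by
    apply Γ.orb_injective
    funext n
    rw [Γ.orb_elem m hm2, ← linear_eq_orb, linear_eq_quasi, hmn]
    congr 1
    refine Finset.sum_congr rfl fun u hu => ?_
    rw [hmu, Γ.mem_leaves_iff.1 hu]
  have hint := Γ.elem_lift_integral hord a m hm2 l hl hres (by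
    intro u
    refine ⟨-(Γ.legDefect a l u / (Γ.legSeifert (Γ.base u) u).1), ?_⟩
    have := Int.mul_ediv_add_emod (Γ.legDefect a l u) (Γ.legSeifert (Γ.base u) u).1
    rw [hmu]
    have h2 : Γ.legDefect a l u % (Γ.legSeifert (Γ.base u) u).1 - Γ.legDefect a l u =
      (Γ.legSeifert (Γ.base u) u).1 * -(Γ.legDefect a l u / (Γ.legSeifert (Γ.base u) u).1) := by
      linarith
    exact_mod_cast h2)
  choose k hk using hint
  obtain ⟨c, hc⟩ := Γ.exists_coef_dualLattice (Γ.liftElem a) n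
  have h1 : Γ.coef (Γ.elem m - Γ.liftElem a) n = Γ.quasi a l n - c := by
    rw [map_sub, Pi.sub_apply, coef_elem, hmn, hc]
  rw [coef_apply] at h1
  simp only [Pi.sub_apply, hk] at h1
  refine ⟨-(Γ.b n * k n) - ∑ w ∈ Γ.graph.neighborFinset n, k w + c, ?_⟩
  push_cast
  linarith

/-- At an end, m_u is a fixed residue modulo α_u, so it amounts to its quotient q_u. The residues
divided by α_u add up to the difference of `linear` and `quasi`, so the equation for `linear`
becomes: the multiplicity of a node plus the quotients of its legs is N_a(ℓ, n). -/
theorem expand_bijOn [Nonempty Γ.Node] (hord : ∀ n, ∀ n' ∈ Γ.nbrs n, n < n' ∨ n' < n)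
    {h : Γ.H} {a : Γ.LiftData} (ha : Γ.IsReducedLift a h) {l : Γ.Node → ℤ}
    (hl : l ∈ Γ.affineLattice a) :
    Set.BijOn (Γ.expand a l)
      {q | ∀ n, ((∑ w ∈ Finset.univ.filter (fun w => Γ.nodeOf w = n), q w : ℕ) : ℚ) =
        Γ.quasi a l n}
      {m | m ∈ Γ.fiber h (Γ.shift a + Γ.toQ l) ∧ ∀ v, Γ.valency v = 2 → m v = 0} := by
  have hpos : ∀ u : Γ.Leaf, 0 < (Γ.legSeifert (Γ.base u) u).1 := fun u =>
    Γ.leg_pos (Γ.mem_leaves_base u)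
  have hposq : ∀ u : Γ.Leaf, (0 : ℚ) < (Γ.legSeifert (Γ.base u) u).1 := fun u => by
    exact_mod_cast hpos u
  have hlin : ∀ (q : Γ.Node ⊕ Γ.Leaf → ℕ) (n : Γ.Node),
      (Γ.expand a l q n : ℚ) + ∑ u ∈ Γ.leaves n, (Γ.expand a l q u : ℚ) / (Γ.legSeifert n u).1 =
        ((∑ w ∈ Finset.univ.filter (fun w => Γ.nodeOf w = n), q w : ℕ) : ℚ) +
          (Γ.linear a l n - Γ.quasi a l n) := by
    intro q n
    rw [linear_eq_quasi, sum_nodeOf, expand_node]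
    have : ∀ u ∈ Γ.leaves n, (Γ.expand a l q u : ℚ) / (Γ.legSeifert n u).1 =
        q (Sum.inr u) + ((Γ.legDefect a l u % (Γ.legSeifert (Γ.base u) u).1 : ℤ) : ℚ) /
        (Γ.legSeifert (Γ.base u) u).1 := by
      intro u hu
      have e : (Γ.expand a l q u : ℚ) = ((Γ.expand a l q u : ℤ) : ℚ) := by norm_cast
      rw [← Γ.mem_leaves_iff.1 hu, e, expand_leaf]
      have := hposq u
      push_cast
      field_simp
      ring
    rw [Finset.sum_congr rfl this, Finset.sum_add_distrib]
    push_cast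
    ring
  refine ⟨?_, ?_, ?_⟩
  · intro q hq
    refine ⟨(Γ.mem_fiber_iff hord ha _ (fun v hv => Γ.expand_two a l q hv) _).2
      ⟨l, hl, rfl, ?_, ?_⟩, fun v hv => Γ.expand_two a l q hv⟩
    · intro u
      refine ⟨q (Sum.inr u) - Γ.legDefect a l u / (Γ.legSeifert (Γ.base u) u).1, ?_⟩
      rw [expand_leaf]
      have := Int.mul_ediv_add_emod (Γ.legDefect a l u) (Γ.legSeifert (Γ.base u) u).1
      linarith
    · intro n
      rw [hlin, hq n]
      ring
  · intro q _ q' _ he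
    funext w
    rcases w with n | u
    · rw [← Γ.expand_node a l q n, ← Γ.expand_node a l q' n, he]
    · have h1 := Γ.expand_leaf a l q u
      rw [he, expand_leaf, add_right_inj] at h1
      have := mul_left_cancel₀ (hpos u).ne' h1
      exact_mod_cast this.symm
  · rintro m ⟨hm, hm2⟩
    obtain ⟨l', hl', hx, hj, hlin'⟩ := (Γ.mem_fiber_iff hord ha m hm2 _).1 hm
    have : l = l' := Γ.toQ_injective (add_left_cancel hx)
    subst this
    choose j hj using hj
    -- The quotient cannot be negative, since m_u ≥ 0 and the residue is less than α_u.
    have hnn : ∀ u : Γ.Leaf, 0 ≤ j u + Γ.legDefect a l u / (Γ.legSeifert (Γ.base u) u).1 := by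
      intro u
      have h1 := Int.mul_ediv_add_emod (Γ.legDefect a l u) (Γ.legSeifert (Γ.base u) u).1
      have h2 := Int.emod_lt_of_pos (Γ.legDefect a l u) (hpos u)
      have h3 := hj u
      have h4 : (0 : ℤ) ≤ m u := Int.natCast_nonneg _
      by_contra hneg
      push Not at hneg
      have h5 : j u + Γ.legDefect a l u / (Γ.legSeifert (Γ.base u) u).1 ≤ -1 := by omega
      have h6 := mul_le_mul_of_nonneg_left h5 (hpos u).le
      rw [mul_add] at h6
      linarith
    set q : Γ.Node ⊕ Γ.Leaf → ℕ := Sum.elim (fun n => m n) fun u =>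
      (j u + Γ.legDefect a l u / (Γ.legSeifert (Γ.base u) u).1).toNat with hq
    have he : Γ.expand a l q = m := by
      ext v
      rcases Γ.vertex_trichotomy v with ⟨n, rfl⟩ | ⟨u, rfl⟩ | hv
      · rw [expand_node]; rfl
      · have h1 := Γ.expand_leaf a l q u
        simp only [hq, Sum.elim_inr] at h1
        rw [Int.toNat_of_nonneg (hnn u)] at h1
        have h2 := Int.mul_ediv_add_emod (Γ.legDefect a l u) (Γ.legSeifert (Γ.base u) u).1
        have h3 := hj u
        rw [mul_add] at h1
        have : (Γ.expand a l q u : ℤ) = m u := by rw [h1]; linarith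
        exact_mod_cast this
      · rw [Γ.expand_two a l q hv, hm2 v hv]
    refine ⟨q, ?_, he⟩
    intro n
    have h1 := hlin q n
    rw [he, hlin' n] at h1
    linarith

theorem reducedSeries_eq_finsum [Nonempty Γ.Node]
    (hord : ∀ n, ∀ n' ∈ Γ.nbrs n, n < n' ∨ n' < n)
    {h : Γ.H} {a : Γ.LiftData} (ha : Γ.IsReducedLift a h) {l : Γ.Node → ℤ}
    (hl : l ∈ Γ.affineLattice a) :
    Γ.reducedSeries h (Γ.shift a + Γ.toQ l) =
      ∑ᶠ q ∈ {q : Γ.Node ⊕ Γ.Leaf → ℕ |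
        ∀ n, ((∑ w ∈ Finset.univ.filter (fun w => Γ.nodeOf w = n), q w : ℕ) : ℚ) =
        Γ.quasi a l n}, ∏ w, PowerSeries.coeff (q w) (Γ.vertexSeries w) := by
  rw [reducedSeries]
  symm
  rw [finsum_mem_eq_of_bijOn _ (Γ.expand_bijOn hord ha hl) fun q _ =>
    (Γ.coeff_zeta_expand a l q).symm]
  -- Exponents that involve a vertex of valency 2 have coefficient 0, its factor being the constant
  -- series 1.
  apply finsum_mem_inter_support_eq'
  intro m hm
  refine ⟨fun h => h.1, fun h => ⟨h, fun v hv => ?_⟩⟩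
  by_contra h0
  apply hm
  change MvPowerSeries.coeff m Γ.zeta = 0
  rw [coeff_zeta]
  apply Finset.prod_eq_zero (Finset.mem_univ v)
  rw [hv, show 2 = 0 + 2 from rfl, localSeries_add_two, pow_zero, PowerSeries.coeff_one, if_neg h0]

/-- Group each node with its ends: their series multiply to (1-s)^{δ_n-2} (1-s)^{-|ℰ_n|}, and δ_n -
|ℰ_n| = δ_{n,𝒩}. The constraint prescribes exactly the total exponent in each group. -/
theorem reducedSeries_eq_prod [Nonempty Γ.Node]
    (hord : ∀ n, ∀ n' ∈ Γ.nbrs n, n < n' ∨ n' < n) (hval : ∀ n, 1 ≤ Γ.nodeValency n)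
    {h : Γ.H} {a : Γ.LiftData} (ha : Γ.IsReducedLift a h) {l : Γ.Node → ℤ}
    (hl : l ∈ Γ.affineLattice a) (M : Γ.Node → ℕ) (hM : ∀ n, Γ.quasi a l n = M n) :
    Γ.reducedSeries h (Γ.shift a + Γ.toQ l) = ∏ n, Γ.nodeCoeff n (M n) := by
  rw [Γ.reducedSeries_eq_finsum hord ha hl]
  simp only [hM, Nat.cast_inj]
  rw [finsum_prod_coeff]
  refine Finset.prod_congr rfl fun n _ => ?_
  have : ∏ w ∈ Finset.univ.filter (fun w => Γ.nodeOf w = n), Γ.vertexSeries w =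
      localSeries (Γ.nodeValency n) := by
    have h1 := Γ.sum_nodeOf (M := Additive (PowerSeries ℤ)) (fun w => Additive.ofMul (Γ.vertexSeries w)) n
    have h2 : ∏ w ∈ Finset.univ.filter (fun w => Γ.nodeOf w = n), Γ.vertexSeries w =
      Γ.vertexSeries (Sum.inl n) * ∏ u ∈ Γ.leaves n, Γ.vertexSeries (Sum.inr u) := h1
    rw [h2]
    simp only [vertexSeries, Sum.elim_inl, Sum.elim_inr, Finset.prod_const]
    rw [valency_node, localSeries_mul_geom]
  rw [this, Γ.coeff_localSeries_node hval]

theorem reducedSeries_eq_zero_of_neg [Nonempty Γ.Node]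
    (hord : ∀ n, ∀ n' ∈ Γ.nbrs n, n < n' ∨ n' < n)
    {h : Γ.H} {a : Γ.LiftData} (ha : Γ.IsReducedLift a h) {l : Γ.Node → ℤ}
    (hl : l ∈ Γ.affineLattice a) {n : Γ.Node} (hn : Γ.quasi a l n < 0) :
    Γ.reducedSeries h (Γ.shift a + Γ.toQ l) = 0 := by
  rw [Γ.reducedSeries_eq_finsum hord ha hl]
  apply finsum_mem_eq_zero_of_forall_eq_zero
  intro q hq
  have := hq n
  rw [← this] at hn
  exact absurd hn (not_lt.2 (Nat.cast_nonneg _))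

theorem reducedSeries_eq_zero_of_notMem [Nonempty Γ.Node]
    (hord : ∀ n, ∀ n' ∈ Γ.nbrs n, n < n' ∨ n' < n)
    {h : Γ.H} {a : Γ.LiftData} (ha : Γ.IsReducedLift a h) {x : Γ.Node → ℚ}
    (hx : ∀ l ∈ Γ.affineLattice a, x ≠ Γ.shift a + Γ.toQ l) :
    Γ.reducedSeries h x = 0 := by
  apply finsum_mem_eq_zero_of_forall_eq_zero
  intro m hm
  rw [coeff_zeta]
  by_cases hm2 : ∀ v, Γ.valency v = 2 → m v = 0
  · obtain ⟨l, hl, he, -⟩ := (Γ.mem_fiber_iff hord ha m hm2 x).1 hm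
    exact absurd he (hx l hl)
  · push Not at hm2
    obtain ⟨v, hv, h0⟩ := hm2
    apply Finset.prod_eq_zero (Finset.mem_univ v)
    rw [hv, show 2 = 0 + 2 from rfl, localSeries_add_two, pow_zero, PowerSeries.coeff_one, if_neg h0]

end Order
end PlumbingTree
end
noncomputable section
open scoped Classical
universe u

/-! ### Supports of Laurent polynomials -/

namespace LaurentDivision

variable {G ι : Type*}

/-- All exponents of `Q` belong to `C`. -/
def SuppIn (Q : AddMonoidAlgebra ℤ G) (C : Set G) : Prop := ∀ x ∈ Q.coeff.support, x ∈ C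

/-- The monomial `t^x`. -/
def mon (x : G) : AddMonoidAlgebra ℤ G := AddMonoidAlgebra.single x 1

theorem SuppIn.mono {Q : AddMonoidAlgebra ℤ G} {C C' : Set G} (h : SuppIn Q C) (hC : C ⊆ C') :
    SuppIn Q C' := fun x hx => hC (h x hx)

theorem suppIn_zero (C : Set G) : SuppIn (0 : AddMonoidAlgebra ℤ G) C := by
  intro x hx
  simp at hx

theorem eq_zero_of_suppIn_empty {Q : AddMonoidAlgebra ℤ G} (h : SuppIn Q ∅) : Q = 0 := by
  rw [← AddMonoidAlgebra.coeff_eq_zero, ← Finsupp.support_eq_empty]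
  exact Finset.eq_empty_of_forall_notMem fun x hx => h x hx

theorem SuppIn.add {P Q : AddMonoidAlgebra ℤ G} {C : Set G} (hP : SuppIn P C) (hQ : SuppIn Q C) :
    SuppIn (P + Q) C := by
  intro x hx
  rw [AddMonoidAlgebra.coeff_add] at hx
  rcases Finset.mem_union.1 (Finsupp.support_add hx) with h | h
  · exact hP x h
  · exact hQ x h

theorem SuppIn.neg {P : AddMonoidAlgebra ℤ G} {C : Set G} (hP : SuppIn P C) : SuppIn (-P) C := by
  intro x hx
  rw [AddMonoidAlgebra.coeff_neg, Finsupp.support_neg] at hx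
  exact hP x hx

theorem SuppIn.sub {P Q : AddMonoidAlgebra ℤ G} {C : Set G} (hP : SuppIn P C) (hQ : SuppIn Q C) :
    SuppIn (P - Q) C := by
  rw [sub_eq_add_neg]
  exact hP.add hQ.neg

theorem SuppIn.smul {P : AddMonoidAlgebra ℤ G} {C : Set G} (hP : SuppIn P C) (c : ℤ) :
    SuppIn (c • P) C := by
  intro x hx
  rw [AddMonoidAlgebra.coeff_smul] at hx
  exact hP x (Finsupp.support_smul hx)

theorem suppIn_sum {κ : Type*} (s : Finset κ) (P : κ → AddMonoidAlgebra ℤ G) {C : Set G}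
    (hP : ∀ i ∈ s, SuppIn (P i) C) : SuppIn (∑ i ∈ s, P i) C := by
  induction s using Finset.induction_on with
  | empty => simpa using suppIn_zero C
  | insert i s hi ih =>
    rw [Finset.sum_insert hi]
    exact (hP i (Finset.mem_insert_self _ _)).add
      (ih fun j hj => hP j (Finset.mem_insert_of_mem hj))

theorem suppIn_mon {x : G} {C : Set G} (hx : x ∈ C) : SuppIn (mon x) C := by
  intro y hy
  rw [mon, AddMonoidAlgebra.coeff_single] at hy
  have := Finsupp.support_single_subset hy
  rw [Finset.mem_singleton] at this
  rwa [this]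

variable [AddCommGroup G]

/-- `∏_{m ∈ S} (1 - t^{w_m})`. -/
def den (w : ι → G) (S : Finset ι) : AddMonoidAlgebra ℤ G := ∏ m ∈ S, (1 - mon (w m))

theorem SuppIn.mul {P Q : AddMonoidAlgebra ℤ G} {A B C : Set G} (hP : SuppIn P A)
    (hQ : SuppIn Q B) (h : ∀ a ∈ A, ∀ b ∈ B, a + b ∈ C) : SuppIn (P * Q) C := by
  intro x hx
  obtain ⟨a, ha, b, hb, rfl⟩ := Finset.mem_add.1 (AddMonoidAlgebra.support_coeff_mul_subset P Q hx)
  exact h a (hP a ha) b (hQ b hb)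

theorem eq_sum_mon (F : AddMonoidAlgebra ℤ G) :
    F = ∑ x ∈ F.coeff.support, F.coeff x • mon x := by
  conv_lhs => rw [← AddMonoidAlgebra.sum_coeff_single F]
  rw [Finsupp.sum]
  refine Finset.sum_congr rfl fun x _ => ?_
  simp [mon]

theorem mon_mul (x y : G) : mon x * mon y = mon (x + y) := by
  simp [mon, AddMonoidAlgebra.single_mul_single]

theorem mon_zero : mon (0 : G) = 1 := rfl

theorem suppIn_one {C : Set G} (h : (0 : G) ∈ C) : SuppIn (1 : AddMonoidAlgebra ℤ G) C := by
  rw [← mon_zero]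
  exact suppIn_mon h

theorem den_insert (w : ι → G) {S : Finset ι} {m : ι} (hm : m ∉ S) :
    den w (insert m S) = (1 - mon (w m)) * den w S := Finset.prod_insert hm

theorem suppIn_den (w : ι → G) (S : Finset ι) (lam : G →+ ℚ) (K : AddSubgroup G)
    (hw : ∀ m ∈ S, 0 ≤ lam (w m)) (hK : ∀ m ∈ S, w m ∈ K) :
    SuppIn (den w S) {x | x ∈ K ∧ 0 ≤ lam x ∧ lam x ≤ ∑ m ∈ S, lam (w m)} := by
  induction S using Finset.induction_on with
  | empty => exact suppIn_one ⟨K.zero_mem, by simp⟩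
  | insert m S hm ih =>
    rw [den_insert w hm]
    have h1 : SuppIn (1 - mon (w m)) {x | x ∈ K ∧ 0 ≤ lam x ∧ lam x ≤ lam (w m)} := by
      have := hw m (Finset.mem_insert_self _ _)
      refine SuppIn.sub (suppIn_one ⟨K.zero_mem, by simp, by simpa using this⟩)
        (suppIn_mon ⟨hK m (Finset.mem_insert_self _ _), this, le_rfl⟩)
    refine h1.mul (ih (fun j hj => hw j (Finset.mem_insert_of_mem hj))
      fun j hj => hK j (Finset.mem_insert_of_mem hj)) ?_
    rintro a ⟨ha0, ha1, ha2⟩ b ⟨hb0, hb1, hb2⟩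
    refine ⟨K.add_mem ha0 hb0, ?_, ?_⟩
    · rw [map_add]; exact add_nonneg ha1 hb1
    · rw [map_add, Finset.sum_insert hm]; exact add_le_add ha2 hb2

/-! ### Existence of divisions -/

/-- Replace t^x by t^{x-w} - t^{x-w}(1 - t^w) until the degree drops below `lam w`; `j` bounds the
number of steps. -/
theorem exists_division_mon (w : G) (lam : G →+ ℚ) (K : Set G)
    (hsub : ∀ x ∈ K, x - w ∈ K) : ∀ (j : ℕ) (x : G), x ∈ K → 0 ≤ lam x →
      lam x < (j + 1) * lam w → ∃ Q R : AddMonoidAlgebra ℤ G, mon x = Q * (1 - mon w) + R ∧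
        SuppIn Q {x | x ∈ K ∧ 0 ≤ lam x} ∧ SuppIn R {x | x ∈ K ∧ 0 ≤ lam x ∧ lam x < lam w} := by
  intro j
  induction j with
  | zero =>
    intro x hx h0 h1
    exact ⟨0, mon x, by simp, suppIn_zero _, suppIn_mon ⟨hx, h0, by simpa using h1⟩⟩
  | succ j ih =>
    intro x hx h0 h1
    rcases lt_or_ge (lam x) (lam w) with h | h
    · exact ⟨0, mon x, by simp, suppIn_zero _, suppIn_mon ⟨hx, h0, h⟩⟩
    · have e : lam (x - w) = lam x - lam w := map_sub _ _ _
      push_cast at h1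
      obtain ⟨Q, R, h2, h3, h4⟩ := ih (x - w) (hsub x hx) (by rw [e]; linarith)
        (by rw [e]; linarith)
      refine ⟨Q - mon (x - w), R, ?_, h3.sub (suppIn_mon ⟨hsub x hx, by rw [e]; linarith⟩), h4⟩
      have h5 : mon (x - w) * mon w = mon x := by rw [mon_mul, sub_add_cancel]
      linear_combination h2 - h5

theorem exists_division_one (w : G) (lam : G →+ ℚ) (hw : 0 < lam w) (K : Set G)
    (hsub : ∀ x ∈ K, x - w ∈ K) (F : AddMonoidAlgebra ℤ G) (hF : SuppIn F {x | x ∈ K ∧ 0 ≤ lam x}) :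
    ∃ Q R : AddMonoidAlgebra ℤ G, F = Q * (1 - mon w) + R ∧
        SuppIn Q {x | x ∈ K ∧ 0 ≤ lam x} ∧ SuppIn R {x | x ∈ K ∧ 0 ≤ lam x ∧ lam x < lam w} := by
  have h : ∀ x : F.coeff.support, ∃ Q R : AddMonoidAlgebra ℤ G, mon (x : G) = Q * (1 - mon w) + R ∧
        SuppIn Q {x | x ∈ K ∧ 0 ≤ lam x} ∧ SuppIn R {x | x ∈ K ∧ 0 ≤ lam x ∧ lam x < lam w} := by
    rintro ⟨x, hx⟩
    obtain ⟨h1, h2⟩ := hF x hx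
    obtain ⟨j, hj⟩ := exists_nat_gt (lam x / lam w)
    rw [div_lt_iff₀ hw] at hj
    exact exists_division_mon w lam K hsub j x h1 h2 (by nlinarith)
  choose Q R h1 h2 h3 using h
  refine ⟨∑ x ∈ F.coeff.support.attach, F.coeff x • Q x,
    ∑ x ∈ F.coeff.support.attach, F.coeff x • R x, ?_,
    suppIn_sum _ _ fun x _ => (h2 x).smul _, suppIn_sum _ _ fun x _ => (h3 x).smul _⟩
  conv_lhs => rw [eq_sum_mon F]
  rw [← Finset.sum_attach, Finset.sum_mul, ← Finset.sum_add_distrib]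
  refine Finset.sum_congr rfl fun x _ => ?_
  rw [h1 x, smul_add, smul_mul_assoc]

/-- Division by `∏_{m ∈ T} (1 - t^{w_m})` with respect to the degree `lam`; the exponents stay in a
set `K` which is invariant under the translations by the `w_m`. -/
theorem exists_division (w : ι → G) (T : Finset ι) (lam : G →+ ℚ) (hw : ∀ m ∈ T, 0 < lam (w m))
    (K : Set G) (hadd : ∀ m ∈ T, ∀ x ∈ K, x + w m ∈ K) (hsub : ∀ m ∈ T, ∀ x ∈ K, x - w m ∈ K)
    (F : AddMonoidAlgebra ℤ G) (hF : SuppIn F {x | x ∈ K ∧ 0 ≤ lam x}) :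
    ∃ Q R : AddMonoidAlgebra ℤ G, F = Q * den w T + R ∧ SuppIn Q {x | x ∈ K ∧ 0 ≤ lam x} ∧
      SuppIn R {x | x ∈ K ∧ 0 ≤ lam x ∧ lam x < ∑ m ∈ T, lam (w m)} := by
  induction T using Finset.induction_on generalizing F with
  | empty => exact ⟨F, 0, by simp [den], hF, suppIn_zero _⟩
  | insert m T hm ih =>
    have hm' := Finset.mem_insert_self m T
    obtain ⟨Q₁, R₁, e1, q1, r1⟩ := exists_division_one (w m) lam (hw m hm') K (hsub m hm') F hF
    obtain ⟨Q₂, R₂, e2, q2, r2⟩ := ih (fun j hj => hw j (Finset.mem_insert_of_mem hj))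
      (fun j hj => hadd j (Finset.mem_insert_of_mem hj))
      (fun j hj => hsub j (Finset.mem_insert_of_mem hj)) Q₁ q1
    have hpos : 0 ≤ ∑ j ∈ T, lam (w j) :=
      Finset.sum_nonneg fun j hj => (hw j (Finset.mem_insert_of_mem hj)).le
    have hwm := hw m hm'
    refine ⟨Q₂, R₂ * (1 - mon (w m)) + R₁, ?_, q2, ?_⟩
    · rw [e1, e2, den_insert w hm]; ring
    · rw [Finset.sum_insert hm]
      refine SuppIn.add ?_ (r1.mono fun x hx => ⟨hx.1, hx.2.1, by linarith [hx.2.2]⟩)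
      rw [mul_sub, mul_one]
      refine SuppIn.sub (r2.mono fun x hx => ⟨hx.1, hx.2.1, by linarith [hx.2.2]⟩)
        (r2.mul (suppIn_mon (Set.mem_singleton (w m))) ?_)
      rintro a ⟨a0, a1, a2⟩ b rfl
      refine ⟨hadd m hm' a a0, ?_, ?_⟩
      · rw [map_add]; linarith
      · rw [map_add]; linarith

/-! ### Uniqueness -/

/-- A term of maximal degree in `Q`, shifted by `w`, has nothing to cancel against. -/
theorem exists_top_one (w : G) (lam : G →+ ℚ) (hw : 0 < lam w) (Q : AddMonoidAlgebra ℤ G) (c : ℚ)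
    (h : ∃ x ∈ Q.coeff.support, c ≤ lam x) :
    ∃ x ∈ (Q * (1 - mon w)).coeff.support, c + lam w ≤ lam x := by
  obtain ⟨x₀, hx₀, hc⟩ := h
  obtain ⟨x, hx, hmax⟩ := Finset.exists_max_image Q.coeff.support lam ⟨x₀, hx₀⟩
  refine ⟨x + w, ?_, ?_⟩
  · rw [Finsupp.mem_support_iff, mul_sub, mul_one, AddMonoidAlgebra.coeff_sub, Finsupp.sub_apply]
    have h1 : Q.coeff (x + w) = 0 := by
      by_contra h0
      have := hmax _ (Finsupp.mem_support_iff.2 h0)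
      rw [map_add] at this
      linarith
    have h2 : (Q * mon w).coeff (x + w) = Q.coeff x := by
      rw [mon, AddMonoidAlgebra.coeff_mul_single_add, mul_one]
    rw [h1, h2, zero_sub, neg_ne_zero]
    exact Finsupp.mem_support_iff.1 hx
  · rw [map_add]
    linarith [hmax _ hx₀]

theorem exists_top (w : ι → G) (S : Finset ι) (lam : G →+ ℚ) (hw : ∀ m ∈ S, 0 < lam (w m))
    (Q : AddMonoidAlgebra ℤ G) (c : ℚ) (h : ∃ x ∈ Q.coeff.support, c ≤ lam x) :
    ∃ x ∈ (Q * den w S).coeff.support, c + ∑ m ∈ S, lam (w m) ≤ lam x := by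
  induction S using Finset.induction_on with
  | empty => simpa [den] using h
  | insert m S hm ih =>
    obtain ⟨x, hx, hc⟩ := exists_top_one (w m) lam (hw m (Finset.mem_insert_self _ _)) _ _
      (ih fun j hj => hw j (Finset.mem_insert_of_mem hj))
    refine ⟨x, ?_, ?_⟩
    · rw [den_insert w hm, mul_comm (1 - _), ← mul_assoc]
      exact hx
    · rw [Finset.sum_insert hm]; linarith

/-- Two divisions of the same fraction have quotients with the same part of nonnegative degree. -/
theorem division_unique {κ : Type*} (w : ι → G) (S : Finset ι) (w' : κ → G) (S' : Finset κ)
    (lam : G →+ ℚ) (hw : ∀ m ∈ S, 0 < lam (w m)) (hw' : ∀ m ∈ S', 0 < lam (w' m))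
    {F F' P P' R R' : AddMonoidAlgebra ℤ G} (hFF : F * den w' S' = F' * den w S)
    (e : F = P * den w S + R) (hR : SuppIn R {x | lam x < ∑ m ∈ S, lam (w m)})
    (e' : F' = P' * den w' S' + R') (hR' : SuppIn R' {x | lam x < ∑ m ∈ S', lam (w' m)}) :
    SuppIn (P - P') {x | lam x < 0} := by
  intro x hx
  by_contra hneg
  rw [Set.mem_ofPred_eq, not_lt] at hneg
  -- A term of nonnegative degree in P - P' yields, after multiplication by both denominators, a
  -- term of degree at least the sum of all weights. By `h1` the same product consists of remainders
  -- times denominators, of strictly smaller degree.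
  obtain ⟨y, hy, hc⟩ := exists_top w' S' lam hw' _ _ (exists_top w S lam hw _ _ ⟨x, hx, hneg⟩)
  have h1 : (P - P') * den w S * den w' S' = R' * den w S - R * den w' S' := by
    rw [e, e'] at hFF
    linear_combination hFF
  have h2 : SuppIn (R' * den w S - R * den w' S')
      {x | lam x < ∑ m ∈ S, lam (w m) + ∑ m ∈ S', lam (w' m)} := by
    refine (hR'.mul (suppIn_den w S lam ⊤ (fun m hm => (hw m hm).le) fun _ _ => trivial) ?_).sub
      (hR.mul (suppIn_den w' S' lam ⊤ (fun m hm => (hw' m hm).le) fun _ _ => trivial) ?_)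
    · rintro a ha b ⟨-, -, hb⟩
      rw [Set.mem_ofPred_eq] at ha ⊢
      rw [map_add]; linarith
    · rintro a ha b ⟨-, -, hb⟩
      rw [Set.mem_ofPred_eq] at ha ⊢
      rw [map_add]; linarith
  rw [h1] at hy
  have := h2 y hy
  rw [Set.mem_ofPred_eq] at this
  linarith

/-! ### The action on formal series -/

/-- The product of a Laurent polynomial and a formal series. -/
def act (D : AddMonoidAlgebra ℤ G) (z : G → ℤ) (x : G) : ℤ := D.coeff.sum fun y c => c * z (x - y)

theorem act_single (y : G) (c : ℤ) (z : G → ℤ) (x : G) :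
    act (AddMonoidAlgebra.single y c) z x = c * z (x - y) := by
  rw [act, AddMonoidAlgebra.coeff_single, Finsupp.sum_single_index]
  exact zero_mul _

theorem act_add (D E : AddMonoidAlgebra ℤ G) (z : G → ℤ) : act (D + E) z = act D z + act E z := by
  funext x
  rw [act, AddMonoidAlgebra.coeff_add, Finsupp.sum_add_index']
  · rfl
  · intro y; exact zero_mul _
  · intro y c d; exact add_mul _ _ _

theorem act_zero_left (z : G → ℤ) : act (0 : AddMonoidAlgebra ℤ G) z = 0 := by
  funext x
  rw [act, AddMonoidAlgebra.coeff_zero, Finsupp.sum_zero_index]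
  rfl

theorem act_add_right (D : AddMonoidAlgebra ℤ G) (z z' : G → ℤ) :
    act D (z + z') = act D z + act D z' := by
  funext x
  simp only [act, Pi.add_apply, mul_add, Finsupp.sum_add]

theorem act_smul_right (D : AddMonoidAlgebra ℤ G) (c : ℤ) (z : G → ℤ) :
    act D (c • z) = c • act D z := by
  funext x
  simp only [act, Pi.smul_apply, smul_eq_mul, Finsupp.mul_sum]
  refine Finsupp.sum_congr fun y _ => by ring

theorem act_zero_right (D : AddMonoidAlgebra ℤ G) : act D (0 : G → ℤ) = 0 := by
  have := act_smul_right D 0 0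
  simpa using this

theorem act_sum_right {κ : Type*} (D : AddMonoidAlgebra ℤ G) (s : Finset κ) (z : κ → G → ℤ) :
    act D (∑ i ∈ s, z i) = ∑ i ∈ s, act D (z i) := by
  induction s using Finset.induction_on with
  | empty => simpa using act_zero_right D
  | insert i s hi ih => rw [Finset.sum_insert hi, Finset.sum_insert hi, act_add_right, ih]

/-- This makes the formal series a module over the Laurent polynomials, so that two fractions for
one series can be cross-multiplied. -/
theorem act_mul (D E : AddMonoidAlgebra ℤ G) (z : G → ℤ) : act (D * E) z = act D (act E z) := by
  induction D using AddMonoidAlgebra.induction_linear with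
  | zero => rw [zero_mul, act_zero_left, act_zero_left]
  | add D D' h h' => rw [add_mul, act_add, act_add, h, h']
  | single y c =>
    induction E using AddMonoidAlgebra.induction_linear with
    | zero => rw [mul_zero, act_zero_left, act_zero_right]
    | add E E' h h' => rw [mul_add, act_add, act_add, act_add_right, h, h']
    | single y' c' =>
      funext x
      rw [AddMonoidAlgebra.single_mul_single, act_single, act_single, act_single, mul_assoc,
        sub_add_eq_sub_sub]

theorem act_one (z : G → ℤ) : act 1 z = z := by
  funext x
  rw [AddMonoidAlgebra.one_def, act_single, one_mul, sub_zero]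

theorem act_coeff (D F : AddMonoidAlgebra ℤ G) : act D F.coeff = (D * F).coeff := by
  induction D using AddMonoidAlgebra.induction_linear with
  | zero => rw [zero_mul, act_zero_left]; rfl
  | add D D' h h' => rw [add_mul, act_add, h, h', AddMonoidAlgebra.coeff_add]; rfl
  | single y c =>
    funext x
    rw [act_single, AddMonoidAlgebra.coeff_single_mul_apply, sub_eq_neg_add]

end LaurentDivision
end
noncomputable section
open scoped Classical
universe u
namespace PlumbingTree
open LaurentDivision
variable {V : Type u} [Fintype V] [DecidableEq V] (Γ : PlumbingTree V)

/-! ### Polynomial parts of fractions -/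

/-- The group `π_𝒩(L')`. -/
def projRange : AddSubgroup (Γ.Node → ℚ) := Γ.dualLattice.map Γ.res.toAddMonoidHom

theorem mem_projRange {x : Γ.Node → ℚ} : x ∈ Γ.projRange ↔ x ∈ Set.range Γ.proj := by
  constructor
  · rintro ⟨y, hy, rfl⟩
    exact ⟨⟨y, hy⟩, rfl⟩
  · rintro ⟨y, rfl⟩
    exact ⟨y, y.2, rfl⟩

theorem shift_mem_projRange [PartialOrder Γ.Node] (a : Γ.LiftData) : Γ.shift a ∈ Γ.projRange :=
  Γ.mem_projRange.2 ⟨_, rfl⟩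

theorem toQ_mem_projRange (l : Γ.Node → ℤ) : Γ.toQ l ∈ Γ.projRange := by
  refine ⟨fun v => if h : 3 ≤ Γ.valency v then (l ⟨v, h⟩ : ℚ) else 0, fun w => ?_, ?_⟩
  · refine ⟨∑ v, (if h : 3 ≤ Γ.valency v then l ⟨v, h⟩ else 0) * plumbingMatrix Γ.graph Γ.b v w, ?_⟩
    simp only [Matrix.vecMul, dotProduct, form, Matrix.map_apply]
    push_cast
    refine Finset.sum_congr rfl fun v _ => ?_
    split_ifs <;> rfl
  · funext n
    change (if h : 3 ≤ Γ.valency n then (l ⟨n, h⟩ : ℚ) else 0) = _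
    rw [dif_pos n.2]
    rfl

theorem supportedOn_iff (Q : Γ.Laurent) (C : Set (Γ.Node → ℚ)) :
    Γ.SupportedOn Q C ↔ SuppIn Q {x | x ∈ Γ.projRange ∧ x ∈ C} := by
  simp only [SupportedOn, SuppIn, Set.mem_ofPred_eq, mem_projRange]

theorem denom_eq (w : Γ.Node → Γ.Node → ℤ) (S : Finset Γ.Node) :
    Γ.denom w S = den (fun m => Γ.toQ (w m)) S := rfl

/-- The vectors `w_m`, `m ∈ S`, are positive multiples of `π_𝒩(E_m^*)`. -/
def PosWeights (w : Γ.Node → Γ.Node → ℤ) (S : Finset Γ.Node) : Prop :=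
  ∀ m ∈ S, ∃ c : ℚ, 0 < c ∧ Γ.toQ (w m) = c • Γ.proj (Γ.Estar m)

variable {Γ}

theorem PosWeights.subset {w : Γ.Node → Γ.Node → ℤ} {S T : Finset Γ.Node}
    (h : Γ.PosWeights w S) (hT : T ⊆ S) : Γ.PosWeights w T := fun m hm => h m (hT hm)

theorem PosWeights.pos {w : Γ.Node → Γ.Node → ℤ} {S : Finset Γ.Node}
    (h : Γ.PosWeights w S) {m : Γ.Node} (hm : m ∈ S) (n : Γ.Node) : 0 < Γ.toQ (w m) n := by
  obtain ⟨c, hc, e⟩ := h m hm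
  rw [e]
  exact mul_pos hc (Γ.dualVec_pos m n)

variable (Γ)

/-- The coordinate at the node `n`. -/
def coord (n : Γ.Node) : (Γ.Node → ℚ) →+ ℚ := Pi.evalAddMonoidHom _ n

@[simp] theorem coord_apply (n : Γ.Node) (x : Γ.Node → ℚ) : Γ.coord n x = x n := rfl

/-- The determinant of the `(n, n')`-coordinates of `x` and of `E_{n'}^*`. -/
def planeDet (n n' : Γ.Node) : (Γ.Node → ℚ) →+ ℚ :=
  (AddMonoidHom.mulRight (Γ.dualVec n' n')).comp (Γ.coord n) -
    (AddMonoidHom.mulRight (Γ.dualVec n' n)).comp (Γ.coord n')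

theorem planeDet_apply (n n' : Γ.Node) (x : Γ.Node → ℚ) :
    Γ.planeDet n n' x = x n * Γ.dualVec n' n' - x n' * Γ.dualVec n' n := rfl

theorem mem_semiBox_bounds {w : Γ.Node → Γ.Node → ℤ} {T : Finset Γ.Node}
    (hw : Γ.PosWeights w T) {y : Γ.Node → ℚ} (hy : y ∈ Γ.semiBox w T) (n : Γ.Node) :
    0 ≤ y n ∧ y n < ∑ m ∈ T, Γ.toQ (w m) n := by
  obtain ⟨hT, τ, hτ, rfl⟩ := hy
  simp only [Finset.sum_apply, Pi.smul_apply, smul_eq_mul]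
  constructor
  · exact Finset.sum_nonneg fun m hm => mul_nonneg (hτ m hm).1 (hw.pos hm n).le
  · refine Finset.sum_lt_sum_of_nonempty hT fun m hm => ?_
    exact mul_lt_of_lt_one_left (hw.pos hm n) (hτ m hm).2

/-- All coefficients of the box point are taken equal to θ = c / ∑ lam (w_m). The strict inequality
gives θ < 1 and also forces `T` to be nonempty. -/
theorem exists_mem_semiBox (w : Γ.Node → Γ.Node → ℤ) (T : Finset Γ.Node)
    (lam : (Γ.Node → ℚ) →+ ℚ) {c : ℚ} (h0 : 0 ≤ c) (h1 : c < ∑ m ∈ T, lam (Γ.toQ (w m))) :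
    ∃ θ : ℚ, 0 ≤ θ ∧ θ • ∑ m ∈ T, Γ.toQ (w m) ∈ Γ.semiBox w T ∧
      θ * ∑ m ∈ T, lam (Γ.toQ (w m)) = c := by
  have hpos := h0.trans_lt h1
  refine ⟨c / ∑ m ∈ T, lam (Γ.toQ (w m)), div_nonneg h0 hpos.le, ⟨?_, fun _ => _, fun m _ =>
    ⟨div_nonneg h0 hpos.le, (div_lt_one hpos).2 h1⟩, by rw [Finset.smul_sum]⟩,
    div_mul_cancel₀ _ hpos.ne'⟩
  by_contra hT
  rw [Finset.not_nonempty_iff_eq_empty] at hT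
  rw [hT, Finset.sum_empty] at hpos
  exact lt_irrefl _ hpos

/-- The box projects onto the whole interval from 0 to the sum of the weights, and this interval is
empty for `S = ∅`, in accordance with the empty box. -/
theorem isNodeDivision_iff {n : Γ.Node} {w : Γ.Node → Γ.Node → ℤ} {S : Finset Γ.Node}
    (hw : Γ.PosWeights w S) (F P : Γ.Laurent) :
    Γ.IsNodeDivision n w S F P ↔ ∃ R : Γ.Laurent, F = P * Γ.denom w S + R ∧
      SuppIn P {x | x ∈ Γ.projRange ∧ 0 ≤ x n} ∧
      SuppIn R {x | x ∈ Γ.projRange ∧ 0 ≤ x n ∧ x n < ∑ m ∈ S, Γ.toQ (w m) n} := by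
  have h : ∀ x : Γ.Node → ℚ, (∃ y ∈ Γ.semiBox w S, x n = y n) ↔
      0 ≤ x n ∧ x n < ∑ m ∈ S, Γ.toQ (w m) n := by
    intro x
    constructor
    · rintro ⟨y, hy, e⟩
      rw [e]
      exact Γ.mem_semiBox_bounds hw hy n
    · rintro ⟨h0, h1⟩
      obtain ⟨θ, -, hy, e⟩ := Γ.exists_mem_semiBox w S (Γ.coord n) h0 h1
      refine ⟨_, hy, ?_⟩
      rw [← e, Pi.smul_apply, Finset.sum_apply]
      rfl
  simp only [IsNodeDivision, supportedOn_iff, Set.mem_ofPred_eq, h]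

/-- For m on the side of n, `dualVec_separates` puts E_m^* on the ray of E_n^* in the (n, n') plane.
-/
theorem planeDet_Estar_eq_zero {n n' m : Γ.Node} (hm : m ∈ Γ.side n n') :
    Γ.planeDet n' n (Γ.proj (Γ.Estar m)) = 0 := by
  have := Γ.dualVec_separates (Finset.mem_filter.1 hm).2
  rw [planeDet_apply]
  exact sub_eq_zero.2 this

/-- Cramer's rule: up to a common positive factor, `planeDet n n'` and `planeDet n' n` are the
coordinates in the basis E_n^*, E_{n'}^* of the plane. -/
theorem planeDet_coord (n n' : Γ.Node) (x : Γ.Node → ℚ) :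
    x n * (Γ.dualVec n n * Γ.dualVec n' n' - Γ.dualVec n' n * Γ.dualVec n n') =
      Γ.planeDet n n' x * Γ.dualVec n n + Γ.planeDet n' n x * Γ.dualVec n' n := by
  rw [planeDet_apply, planeDet_apply]
  ring

section Chain
variable {n n' : Γ.Node} (h : n' ∈ Γ.nbrs n)
include h

theorem planeDet_pos_const :
    0 < Γ.dualVec n n * Γ.dualVec n' n' - Γ.dualVec n' n * Γ.dualVec n n' :=
  Γ.dualVec_det_pos (Γ.ne_of_mem_nbrs h)

theorem planeDet_Estar_pos {m : Γ.Node} (hm : m ∈ Γ.side n n') :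
    0 < Γ.planeDet n n' (Γ.proj (Γ.Estar m)) := by
  have h1 := Γ.dualVec_separates (Finset.mem_filter.1 hm).2
  have h2 := Γ.planeDet_pos_const h
  have h3 := Γ.dualVec_pos m n
  have h4 := Γ.dualVec_pos n n
  rw [planeDet_apply]
  change 0 < Γ.dualVec m n * Γ.dualVec n' n' - Γ.dualVec m n' * Γ.dualVec n' n
  have h5 : Γ.dualVec n n * (Γ.dualVec m n * Γ.dualVec n' n' - Γ.dualVec m n' * Γ.dualVec n' n) =
      Γ.dualVec m n * (Γ.dualVec n n * Γ.dualVec n' n' - Γ.dualVec n' n * Γ.dualVec n n') := by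
    linear_combination (-Γ.dualVec n' n) * h1
  have h6 := mul_pos h3 h2
  rw [← h5] at h6
  exact (mul_pos_iff_of_pos_left h4).1 h6

theorem planeDet_weight {w : Γ.Node → Γ.Node → ℤ} {S : Finset Γ.Node} (hw : Γ.PosWeights w S)
    {m : Γ.Node} (hm : m ∈ S ∩ Γ.side n n') :
    Γ.planeDet n' n (Γ.toQ (w m)) = 0 ∧ 0 < Γ.planeDet n n' (Γ.toQ (w m)) := by
  obtain ⟨hS, hs⟩ := Finset.mem_inter.1 hm
  obtain ⟨c, hc, e⟩ := hw m hS
  have h1 := Γ.planeDet_Estar_eq_zero hs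
  have h2 := Γ.planeDet_Estar_pos h hs
  rw [planeDet_apply] at h1 h2
  rw [e, planeDet_apply, planeDet_apply]
  simp only [Pi.smul_apply, smul_eq_mul]
  constructor
  · linear_combination c * h1
  · have := mul_pos hc h2
    linarith

theorem inter_side_union (S : Finset Γ.Node) : S ∩ Γ.side n n' ∪ S ∩ Γ.side n' n = S := by
  rw [← Finset.inter_union_distrib_left]
  refine Finset.inter_eq_left.2 fun m _ => Finset.mem_union.2 (Γ.mem_side_or h m)

theorem inter_side_disjoint (S : Finset Γ.Node) :
    Disjoint (S ∩ Γ.side n n') (S ∩ Γ.side n' n) :=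
  (Γ.side_disjoint h).mono Finset.inter_subset_right Finset.inter_subset_right

theorem denom_split (w : Γ.Node → Γ.Node → ℤ) (S : Finset Γ.Node) :
    Γ.denom w S = Γ.denom w (S ∩ Γ.side n n') * Γ.denom w (S ∩ Γ.side n' n) := by
  conv_lhs => rw [← Γ.inter_side_union h S]
  exact Finset.prod_union (Γ.inter_side_disjoint h S)

/-- The semi-open box of one side of a chain projects to a ray in the plane of the chain. -/
theorem semiBox_ray {w : Γ.Node → Γ.Node → ℤ} {S : Finset Γ.Node} (hw : Γ.PosWeights w S)
    (x : Γ.Node → ℚ) :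
    (∃ y ∈ Γ.semiBox w (S ∩ Γ.side n n'), x n ≤ y n ∧ x n' = y n') ↔
      0 ≤ x n' ∧ x n' < ∑ m ∈ S ∩ Γ.side n n', Γ.toQ (w m) n' ∧ 0 ≤ Γ.planeDet n' n x := by
  have hw' := hw.subset (Finset.inter_subset_left (s₁ := S) (s₂ := Γ.side n n'))
  have hq := Γ.dualVec_pos n n'
  have hp := Γ.dualVec_pos n n
  constructor
  · rintro ⟨y, hy, e1, e2⟩
    obtain ⟨b0, b1⟩ := Γ.mem_semiBox_bounds hw' hy n'
    refine ⟨e2 ▸ b0, e2 ▸ b1, ?_⟩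
    have hd : Γ.planeDet n' n y = 0 := by
      obtain ⟨-, τ, -, rfl⟩ := hy
      rw [map_sum]
      refine Finset.sum_eq_zero fun m hm => ?_
      have := (Γ.planeDet_weight h hw hm).1
      rw [planeDet_apply] at this ⊢
      simp only [Pi.smul_apply, smul_eq_mul]
      linear_combination τ m * this
    rw [planeDet_apply] at hd ⊢
    rw [e2]
    nlinarith [mul_le_mul_of_nonneg_right e1 hq.le]
  · rintro ⟨h0, h1, h2⟩
    obtain ⟨θ, -, hy, e⟩ := Γ.exists_mem_semiBox w _ (Γ.coord n') h0 h1
    have hd : Γ.planeDet n' n (θ • ∑ m ∈ S ∩ Γ.side n n', Γ.toQ (w m)) = 0 := by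
      have : Γ.planeDet n' n (∑ m ∈ S ∩ Γ.side n n', Γ.toQ (w m)) = 0 := by
        rw [map_sum]
        exact Finset.sum_eq_zero fun m hm => (Γ.planeDet_weight h hw hm).1
      rw [planeDet_apply] at this ⊢
      simp only [Pi.smul_apply, smul_eq_mul]
      linear_combination θ * this
    have e' : (θ • ∑ m ∈ S ∩ Γ.side n n', Γ.toQ (w m)) n' = x n' := by
      rw [← e, Pi.smul_apply, Finset.sum_apply]
      rfl
    refine ⟨_, hy, ?_, e'.symm⟩
    rw [planeDet_apply, e'] at hd
    rw [planeDet_apply] at h2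
    refine le_of_mul_le_mul_right ?_ hq
    linarith

end Chain

section ChainDivision
variable {n n' : Γ.Node} (h : n' ∈ Γ.nbrs n)
include h

/-- The two boxes project to half-open segments on the rays of E_n^* and E_{n'}^*, and the two
determinants are coordinates along these rays; so the sum of the segments is a product of intervals.
-/
theorem semiBox_parallelogram {w : Γ.Node → Γ.Node → ℤ} {S : Finset Γ.Node}
    (hw : Γ.PosWeights w S) (x : Γ.Node → ℚ) :
    (∃ y ∈ Γ.semiBox w (S ∩ Γ.side n n'), ∃ y' ∈ Γ.semiBox w (S ∩ Γ.side n' n),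
      x n = y n + y' n ∧ x n' = y n' + y' n') ↔
      (0 ≤ Γ.planeDet n n' x ∧
        Γ.planeDet n n' x < ∑ m ∈ S ∩ Γ.side n n', Γ.planeDet n n' (Γ.toQ (w m))) ∧
      0 ≤ Γ.planeDet n' n x ∧
        Γ.planeDet n' n x < ∑ m ∈ S ∩ Γ.side n' n, Γ.planeDet n' n (Γ.toQ (w m)) := by
  have key : ∀ {n n' : Γ.Node}, n' ∈ Γ.nbrs n → ∀ y ∈ Γ.semiBox w (S ∩ Γ.side n n'),
      Γ.planeDet n' n y = 0 ∧ 0 ≤ Γ.planeDet n n' y ∧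
      Γ.planeDet n n' y < ∑ m ∈ S ∩ Γ.side n n', Γ.planeDet n n' (Γ.toQ (w m)) := by
    rintro n n' h y ⟨hT, τ, hτ, rfl⟩
    have hs : ∀ (p : (Γ.Node → ℚ) →+ ℚ) m, p (τ m • Γ.toQ (w m)) = τ m * p (Γ.toQ (w m)) :=
      fun p m => map_rat_smul p _ _
    simp only [map_sum, hs]
    refine ⟨Finset.sum_eq_zero fun m hm => by rw [(Γ.planeDet_weight h hw hm).1, mul_zero],
      Finset.sum_nonneg fun m hm => mul_nonneg (hτ m hm).1 (Γ.planeDet_weight h hw hm).2.le,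
      Finset.sum_lt_sum_of_nonempty hT fun m hm => ?_⟩
    exact mul_lt_of_lt_one_left (Γ.planeDet_weight h hw hm).2 (hτ m hm).2
  have hwit : ∀ {n n' : Γ.Node}, n' ∈ Γ.nbrs n → 0 ≤ Γ.planeDet n n' x →
      Γ.planeDet n n' x < ∑ m ∈ S ∩ Γ.side n n', Γ.planeDet n n' (Γ.toQ (w m)) →
      ∃ y ∈ Γ.semiBox w (S ∩ Γ.side n n'), Γ.planeDet n n' y = Γ.planeDet n n' x := by
    intro n n' h h0 h1
    obtain ⟨θ, -, hy, e⟩ := Γ.exists_mem_semiBox w _ (Γ.planeDet n n') h0 h1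
    refine ⟨_, hy, ?_⟩
    rw [map_rat_smul, map_sum, ← e]
    rfl
  have h' := Γ.nbrs_comm.1 h
  constructor
  · rintro ⟨y, hy, y', hy', e1, e2⟩
    obtain ⟨a1, a2, a3⟩ := key h y hy
    obtain ⟨b1, b2, b3⟩ := key h' y' hy'
    have d1 : Γ.planeDet n n' x = Γ.planeDet n n' y + Γ.planeDet n n' y' := by
      simp only [planeDet_apply, e1, e2]; ring
    have d2 : Γ.planeDet n' n x = Γ.planeDet n' n y + Γ.planeDet n' n y' := by
      simp only [planeDet_apply, e1, e2]; ring
    rw [d1, d2, a1, b1, add_zero, zero_add]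
    exact ⟨⟨a2, a3⟩, b2, b3⟩
  · rintro ⟨⟨h1, h2⟩, h3, h4⟩
    obtain ⟨y, hy, e⟩ := hwit h h1 h2
    obtain ⟨y', hy', e'⟩ := hwit h' h3 h4
    have a1 := (key h y hy).1
    have b1 := (key h' y' hy').1
    refine ⟨y, hy, y', hy', ?_, ?_⟩
    · refine mul_right_cancel₀ (Γ.planeDet_pos_const h).ne' ?_
      rw [add_mul, Γ.planeDet_coord n n', Γ.planeDet_coord n n', Γ.planeDet_coord n n', e, e', a1, b1]
      ring
    · refine mul_right_cancel₀ (Γ.planeDet_pos_const h').ne' ?_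
      rw [add_mul, Γ.planeDet_coord n' n, Γ.planeDet_coord n' n, Γ.planeDet_coord n' n, e, e', a1, b1]
      ring

/-- All support conditions become inequalities between linear forms on the plane, the form in which
`exists_division` produces them. -/
theorem isChainDivision_iff {w : Γ.Node → Γ.Node → ℤ} {S : Finset Γ.Node}
    (hw : Γ.PosWeights w S) (F P : Γ.Laurent) :
    Γ.IsChainDivision n n' w S F P ↔ ∃ R₁ R₂ R : Γ.Laurent,
    F = P * Γ.denom w S + R₁ * Γ.denom w (S ∩ Γ.side n' n)
      + R₂ * Γ.denom w (S ∩ Γ.side n n') + R ∧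
    SuppIn P {x | x ∈ Γ.projRange ∧ ¬ (x n < 0 ∧ x n' < 0)} ∧
    SuppIn R₁ {x | x ∈ Γ.projRange ∧ 0 ≤ x n' ∧
      x n' < ∑ m ∈ S ∩ Γ.side n n', Γ.toQ (w m) n' ∧ 0 ≤ Γ.planeDet n' n x} ∧
    SuppIn R₂ {x | x ∈ Γ.projRange ∧ 0 ≤ x n ∧
      x n < ∑ m ∈ S ∩ Γ.side n' n, Γ.toQ (w m) n ∧ 0 ≤ Γ.planeDet n n' x} ∧
    SuppIn R {x | x ∈ Γ.projRange ∧ (0 ≤ Γ.planeDet n n' x ∧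
        Γ.planeDet n n' x < ∑ m ∈ S ∩ Γ.side n n', Γ.planeDet n n' (Γ.toQ (w m))) ∧
      0 ≤ Γ.planeDet n' n x ∧
        Γ.planeDet n' n x < ∑ m ∈ S ∩ Γ.side n' n, Γ.planeDet n' n (Γ.toQ (w m))} := by
  have h1 := fun x => Γ.semiBox_ray h hw x
  have h2 := fun x => Γ.semiBox_ray (Γ.nbrs_comm.1 h) hw x
  have h3 := fun x => Γ.semiBox_parallelogram h hw x
  have h2' : ∀ x : Γ.Node → ℚ, (∃ y ∈ Γ.semiBox w (S ∩ Γ.side n' n), x n = y n ∧ x n' ≤ y n') ↔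
      0 ≤ x n ∧ x n < ∑ m ∈ S ∩ Γ.side n' n, Γ.toQ (w m) n ∧ 0 ≤ Γ.planeDet n n' x := by
    intro x
    rw [← h2 x]
    simp only [and_comm]
  simp only [IsChainDivision, supportedOn_iff, Set.mem_ofPred_eq, h1, h2', h3]

end ChainDivision

end PlumbingTree
end
noncomputable section
open scoped Classical
universe u
namespace PlumbingTree
open LaurentDivision
variable {V : Type u} [Fintype V] [DecidableEq V] (Γ : PlumbingTree V)

/-! ### Existence of polynomial parts -/

theorem exists_nodeDivision (n : Γ.Node) {w : Γ.Node → Γ.Node → ℤ} {S : Finset Γ.Node}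
    (hw : Γ.PosWeights w S) (F : Γ.Laurent) (hF : SuppIn F {x | x ∈ Γ.projRange ∧ 0 ≤ x n}) :
    ∃ P, Γ.IsNodeDivision n w S F P := by
  obtain ⟨Q, R, e, hQ, hR⟩ := exists_division (fun m => Γ.toQ (w m)) S (Γ.coord n)
    (fun m hm => hw.pos hm n) (Γ.projRange : Set (Γ.Node → ℚ))
    (fun m _ x hx => Γ.projRange.add_mem hx (Γ.toQ_mem_projRange _))
    (fun m _ x hx => Γ.projRange.sub_mem hx (Γ.toQ_mem_projRange _)) F hF
  exact ⟨Q, (Γ.isNodeDivision_iff hw F Q).2 ⟨R, e, hQ, hR⟩⟩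

theorem coord_nonneg_of_planeDet {n n' : Γ.Node} (h : n' ∈ Γ.nbrs n) {x : Γ.Node → ℚ}
    (h1 : 0 ≤ Γ.planeDet n n' x) (h2 : 0 ≤ Γ.planeDet n' n x) : 0 ≤ x n := by
  have h3 : 0 ≤ x n * (Γ.dualVec n n * Γ.dualVec n' n' - Γ.dualVec n' n * Γ.dualVec n n') := by
    rw [Γ.planeDet_coord n n']
    exact add_nonneg (mul_nonneg h1 (Γ.dualVec_pos n n).le) (mul_nonneg h2 (Γ.dualVec_pos n' n).le)
  exact nonneg_of_mul_nonneg_left h3 (Γ.planeDet_pos_const h)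

/-- The weights of each side have positive degree for one of the two determinants and degree 0 for
the other. So dividing by the factors of one side in its own determinant preserves the bounds on the
other: F is divided by the factors of the side of n, then both quotient and remainder by those of
the side of n'. -/
theorem exists_chainDivision {n n' : Γ.Node} (h : n' ∈ Γ.nbrs n) {w : Γ.Node → Γ.Node → ℤ}
    {S : Finset Γ.Node} (hw : Γ.PosWeights w S) (F : Γ.Laurent)
    (hF : SuppIn F {x | x ∈ Γ.projRange ∧ 0 ≤ Γ.planeDet n n' x ∧ 0 ≤ Γ.planeDet n' n x}) :
    ∃ P, Γ.IsChainDivision n n' w S F P := by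
  have h' := Γ.nbrs_comm.1 h
  have hr := fun m => Γ.toQ_mem_projRange (w m)
  have d1 := fun m hm => Γ.planeDet_weight h hw (m := m) hm
  have d2 := fun m hm => Γ.planeDet_weight h' hw (m := m) hm
  obtain ⟨Q, RA, e1, hQ, hRA⟩ := exists_division (fun m => Γ.toQ (w m)) (S ∩ Γ.side n n')
    (Γ.planeDet n n') (fun m hm => (d1 m hm).2)
    {x | x ∈ Γ.projRange ∧ 0 ≤ Γ.planeDet n' n x}
    (fun m hm x hx => ⟨add_mem hx.1 (hr m), by rw [map_add, (d1 m hm).1, add_zero]; exact hx.2⟩)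
    (fun m hm x hx => ⟨sub_mem hx.1 (hr m), by rw [map_sub, (d1 m hm).1, sub_zero]; exact hx.2⟩)
    F (hF.mono fun x hx => ⟨⟨hx.1, hx.2.2⟩, hx.2.1⟩)
  obtain ⟨P0, R2, e2, hP0, hR2⟩ := exists_division (fun m => Γ.toQ (w m)) (S ∩ Γ.side n' n)
    (Γ.planeDet n' n) (fun m hm => (d2 m hm).2)
    {x | x ∈ Γ.projRange ∧ 0 ≤ Γ.planeDet n n' x}
    (fun m hm x hx => ⟨add_mem hx.1 (hr m), by rw [map_add, (d2 m hm).1, add_zero]; exact hx.2⟩)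
    (fun m hm x hx => ⟨sub_mem hx.1 (hr m), by rw [map_sub, (d2 m hm).1, sub_zero]; exact hx.2⟩)
    Q (hQ.mono fun x hx => ⟨⟨hx.1.1, hx.2⟩, hx.1.2⟩)
  obtain ⟨R1, R, e3, hR1, hR⟩ := exists_division (fun m => Γ.toQ (w m)) (S ∩ Γ.side n' n)
    (Γ.planeDet n' n) (fun m hm => (d2 m hm).2)
    {x | x ∈ Γ.projRange ∧ 0 ≤ Γ.planeDet n n' x ∧
      Γ.planeDet n n' x < ∑ m ∈ S ∩ Γ.side n n', Γ.planeDet n n' (Γ.toQ (w m))}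
    (fun m hm x hx => ⟨add_mem hx.1 (hr m), by rw [map_add, (d2 m hm).1, add_zero]; exact hx.2⟩)
    (fun m hm x hx => ⟨sub_mem hx.1 (hr m), by rw [map_sub, (d2 m hm).1, sub_zero]; exact hx.2⟩)
    RA (hRA.mono fun x hx => ⟨⟨hx.1.1, hx.2⟩, hx.1.2⟩)
  -- `R1` is bounded in `planeDet n n'`, but the definition bounds its coordinate at n'. A second
  -- division, in that coordinate, achieves this; its quotient has x_{n'} ≥ 0 and joins the
  -- polynomial part. The same is done for `R2` with x_n.
  obtain ⟨P1, R1', e4, hP1, hR1'⟩ := exists_division (fun m => Γ.toQ (w m)) (S ∩ Γ.side n n')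
    (Γ.coord n') (fun m hm => hw.pos (Finset.mem_inter.1 hm).1 n')
    {x | x ∈ Γ.projRange ∧ 0 ≤ Γ.planeDet n' n x}
    (fun m hm x hx => ⟨add_mem hx.1 (hr m), by rw [map_add, (d1 m hm).1, add_zero]; exact hx.2⟩)
    (fun m hm x hx => ⟨sub_mem hx.1 (hr m), by rw [map_sub, (d1 m hm).1, sub_zero]; exact hx.2⟩)
    R1 (hR1.mono fun x hx => ⟨⟨hx.1.1, hx.2⟩, Γ.coord_nonneg_of_planeDet h' hx.2 hx.1.2.1⟩)
  obtain ⟨P2, R2', e5, hP2, hR2'⟩ := exists_division (fun m => Γ.toQ (w m)) (S ∩ Γ.side n' n)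
    (Γ.coord n) (fun m hm => hw.pos (Finset.mem_inter.1 hm).1 n)
    {x | x ∈ Γ.projRange ∧ 0 ≤ Γ.planeDet n n' x}
    (fun m hm x hx => ⟨add_mem hx.1 (hr m), by rw [map_add, (d2 m hm).1, add_zero]; exact hx.2⟩)
    (fun m hm x hx => ⟨sub_mem hx.1 (hr m), by rw [map_sub, (d2 m hm).1, sub_zero]; exact hx.2⟩)
    R2 (hR2.mono fun x hx => ⟨hx.1, Γ.coord_nonneg_of_planeDet h hx.1.2 hx.2.1⟩)
  refine ⟨P0 + P1 + P2, (Γ.isChainDivision_iff h hw F _).2 ⟨R1', R2', R, ?_, ?_, ?_, ?_, ?_⟩⟩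
  · rw [Γ.denom_split h, e1, e2, e3, e4, e5]
    simp only [denom_eq]
    ring
  · refine SuppIn.add (SuppIn.add ?_ ?_) ?_
    · exact hP0.mono fun x hx => ⟨hx.1.1, fun hn =>
        not_le.2 hn.1 (Γ.coord_nonneg_of_planeDet h hx.1.2 hx.2)⟩
    · exact hP1.mono fun x hx => ⟨hx.1.1, fun hn => not_le.2 hn.2 hx.2⟩
    · exact hP2.mono fun x hx => ⟨hx.1.1, fun hn => not_le.2 hn.1 hx.2⟩
  · exact hR1'.mono fun x hx => ⟨hx.1.1, hx.2.1, hx.2.2, hx.1.2⟩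
  · exact hR2'.mono fun x hx => ⟨hx.1.1, hx.2.1, hx.2.2, hx.1.2⟩
  · exact hR.mono fun x hx => ⟨hx.1.1, hx.1.2, hx.2⟩

/-! ### Uniqueness of polynomial parts -/

/-- The difference of the quotients has only exponents with x_n < 0 by comparison of degrees, and
only exponents with x_n ≥ 0 by definition. -/
theorem nodeDivision_unique {n : Γ.Node} {w w' : Γ.Node → Γ.Node → ℤ} {S S' : Finset Γ.Node}
    (hw : Γ.PosWeights w S) (hw' : Γ.PosWeights w' S') {F F' P P' : Γ.Laurent}
    (hFF : F * Γ.denom w' S' = F' * Γ.denom w S)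
    (hP : Γ.IsNodeDivision n w S F P) (hP' : Γ.IsNodeDivision n w' S' F' P') : P = P' := by
  obtain ⟨R, e, h1, h2⟩ := (Γ.isNodeDivision_iff hw F P).1 hP
  obtain ⟨R', e', h1', h2'⟩ := (Γ.isNodeDivision_iff hw' F' P').1 hP'
  have h3 := division_unique (fun m => Γ.toQ (w m)) S (fun m => Γ.toQ (w' m)) S' (Γ.coord n)
    (fun m hm => hw.pos hm n) (fun m hm => hw'.pos hm n) hFF e (h2.mono fun x hx => hx.2.2)
    e' (h2'.mono fun x hx => hx.2.2)
  refine sub_eq_zero.1 (eq_zero_of_suppIn_empty fun x hx => ?_)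
  exact not_lt.2 (h1.sub h1' x hx).2 (h3 x hx)

theorem IsChainDivision.symm {n n' : Γ.Node} {w : Γ.Node → Γ.Node → ℤ} {S : Finset Γ.Node}
    {F P : Γ.Laurent} (hP : Γ.IsChainDivision n n' w S F P) : Γ.IsChainDivision n' n w S F P := by
  obtain ⟨R₁, R₂, R, e, h1, h2, h3, h4⟩ := hP
  refine ⟨R₂, R₁, R, by rw [e]; ring, fun x hx => ⟨(h1 x hx).1, fun hn => (h1 x hx).2 hn.symm⟩,
    fun x hx => ⟨(h3 x hx).1, ?_⟩, fun x hx => ⟨(h2 x hx).1, ?_⟩, fun x hx => ⟨(h4 x hx).1, ?_⟩⟩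
  · obtain ⟨y, hy, e1, e2⟩ := (h3 x hx).2
    exact ⟨y, hy, e2, e1⟩
  · obtain ⟨y, hy, e1, e2⟩ := (h2 x hx).2
    exact ⟨y, hy, e2, e1⟩
  · obtain ⟨y, hy, y', hy', e1, e2⟩ := (h4 x hx).2
    exact ⟨y', hy', y, hy, by rw [e2, add_comm], by rw [e1, add_comm]⟩

/-- The total remainder of a division along a chain has small degree in each of the variables. -/
theorem exists_chainRemainder {n n' : Γ.Node} (h : n' ∈ Γ.nbrs n) {w : Γ.Node → Γ.Node → ℤ}
    {S : Finset Γ.Node} (hw : Γ.PosWeights w S) {F P : Γ.Laurent}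
    (hP : Γ.IsChainDivision n n' w S F P) :
    ∃ R, F = P * Γ.denom w S + R ∧
      SuppIn R {x | Γ.coord n x < ∑ m ∈ S, Γ.coord n (Γ.toQ (w m))} := by
  obtain ⟨R₁, R₂, R, e, -, h2, h3, h4⟩ := (Γ.isChainDivision_iff h hw F P).1 hP
  have hsplit : ∀ f : Γ.Node → ℚ, ∑ m ∈ S, f m =
      ∑ m ∈ S ∩ Γ.side n n', f m + ∑ m ∈ S ∩ Γ.side n' n, f m := fun f => by
    rw [← Finset.sum_union (Γ.inter_side_disjoint h S), Γ.inter_side_union h S]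
  have hden : ∀ T ⊆ S, SuppIn (Γ.denom w T) {x | x ∈ (⊤ : AddSubgroup (Γ.Node → ℚ)) ∧
      0 ≤ Γ.coord n x ∧ Γ.coord n x ≤ ∑ m ∈ T, Γ.coord n (Γ.toQ (w m))} := fun T hT =>
    suppIn_den _ T (Γ.coord n) ⊤ (fun m hm => (hw.pos (hT hm) n).le) fun _ _ => trivial
  have d1 := fun m hm => Γ.planeDet_weight h hw (m := m) hm
  have d2 := fun m hm => Γ.planeDet_weight (Γ.nbrs_comm.1 h) hw (m := m) hm
  have hΔ := Γ.planeDet_pos_const h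
  refine ⟨R₁ * Γ.denom w (S ∩ Γ.side n' n) + R₂ * Γ.denom w (S ∩ Γ.side n n') + R,
    by rw [e]; ring, ((h2.mul (hden _ Finset.inter_subset_left) ?_).add
    (h3.mul (hden _ Finset.inter_subset_left) ?_)).add (h4.mono ?_)⟩
  · rintro x ⟨-, -, x2, x3⟩ y ⟨-, -, y2⟩
    rw [Set.mem_ofPred_eq, map_add, hsplit]
    refine add_lt_add_of_lt_of_le (lt_of_mul_lt_mul_right ?_ (Γ.dualVec_pos n n').le) y2
    -- On the side of n the weights lie on the ray of E_n^*, so a bound at n' is equivalent to one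
    -- at n.
    have h5 : (∑ m ∈ S ∩ Γ.side n n', Γ.coord n (Γ.toQ (w m))) * Γ.dualVec n n' =
        (∑ m ∈ S ∩ Γ.side n n', Γ.toQ (w m) n') * Γ.dualVec n n := by
      rw [Finset.sum_mul, Finset.sum_mul]
      refine Finset.sum_congr rfl fun m hm => ?_
      have := (d1 m hm).1
      rw [planeDet_apply] at this
      rw [coord_apply]
      linarith
    rw [h5]
    rw [planeDet_apply] at x3
    rw [coord_apply]
    have := mul_lt_mul_of_pos_right x2 (Γ.dualVec_pos n n)
    linarith
  · rintro x ⟨-, -, x2, -⟩ y ⟨-, -, y2⟩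
    rw [Set.mem_ofPred_eq, map_add, hsplit, add_comm]
    exact add_lt_add_of_le_of_lt y2 x2
  · rintro x ⟨-, ⟨-, x2⟩, -, x4⟩
    rw [Set.mem_ofPred_eq]
    refine lt_of_mul_lt_mul_right ?_ hΔ.le
    have h5 : (∑ m ∈ S, Γ.coord n (Γ.toQ (w m))) *
        (Γ.dualVec n n * Γ.dualVec n' n' - Γ.dualVec n' n * Γ.dualVec n n') =
        (∑ m ∈ S ∩ Γ.side n n', Γ.planeDet n n' (Γ.toQ (w m))) * Γ.dualVec n n +
        (∑ m ∈ S ∩ Γ.side n' n, Γ.planeDet n' n (Γ.toQ (w m))) * Γ.dualVec n' n := by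
      rw [hsplit, add_mul, Finset.sum_mul, Finset.sum_mul, Finset.sum_mul, Finset.sum_mul]
      congr 1 <;> refine Finset.sum_congr rfl fun m hm => ?_
      · rw [coord_apply, Γ.planeDet_coord n n', (d1 m hm).1]; ring
      · rw [coord_apply, Γ.planeDet_coord n n', (d2 m hm).1]; ring
    rw [h5, coord_apply, Γ.planeDet_coord n n']
    exact add_lt_add (mul_lt_mul_of_pos_right x2 (Γ.dualVec_pos n n))
      (mul_lt_mul_of_pos_right x4 (Γ.dualVec_pos n' n))

/-- Comparing degrees in x_n and, by symmetry, in x_{n'} confines the exponents of P - P' to the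
open negative quadrant, which the support condition on polynomial parts forbids. -/
theorem chainDivision_unique {n n' : Γ.Node} (h : n' ∈ Γ.nbrs n) {w w' : Γ.Node → Γ.Node → ℤ}
    {S S' : Finset Γ.Node} (hw : Γ.PosWeights w S) (hw' : Γ.PosWeights w' S')
    {F F' P P' : Γ.Laurent} (hFF : F * Γ.denom w' S' = F' * Γ.denom w S)
    (hP : Γ.IsChainDivision n n' w S F P) (hP' : Γ.IsChainDivision n n' w' S' F' P') : P = P' := by
  have key : ∀ {n n' : Γ.Node}, n' ∈ Γ.nbrs n → Γ.IsChainDivision n n' w S F P →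
      Γ.IsChainDivision n n' w' S' F' P' → SuppIn (P - P') {x | Γ.coord n x < 0} := by
    intro n n' h hP hP'
    obtain ⟨R, e, hR⟩ := Γ.exists_chainRemainder h hw hP
    obtain ⟨R', e', hR'⟩ := Γ.exists_chainRemainder h hw' hP'
    exact division_unique (fun m => Γ.toQ (w m)) S (fun m => Γ.toQ (w' m)) S' (Γ.coord n)
      (fun m hm => hw.pos hm n) (fun m hm => hw'.pos hm n) hFF e hR e' hR'
  have h1 := key h hP hP'
  have h2 := key (Γ.nbrs_comm.1 h) (IsChainDivision.symm Γ hP) (IsChainDivision.symm Γ hP')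
  obtain ⟨_, _, _, _, h3, _⟩ := (Γ.isChainDivision_iff h hw F P).1 hP
  obtain ⟨_, _, _, _, h4, _⟩ := (Γ.isChainDivision_iff h hw' F' P').1 hP'
  exact sub_eq_zero.1 (eq_zero_of_suppIn_empty fun x hx => (h3.sub h4 x hx).2 ⟨h1 x hx, h2 x hx⟩)

theorem IsFraction.act_eq {z : (Γ.Node → ℚ) → ℤ} {w : Γ.Node → Γ.Node → ℤ} {S : Finset Γ.Node}
    {F : Γ.Laurent} (hF : Γ.IsFraction z w S F) : act (Γ.denom w S) z = F.coeff :=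
  funext hF.2

/-- Both sides are the product of the same series with both denominators. -/
theorem IsFraction.compat {z : (Γ.Node → ℚ) → ℤ} {w w' : Γ.Node → Γ.Node → ℤ}
    {S S' : Finset Γ.Node} {F F' : Γ.Laurent} (hF : Γ.IsFraction z w S F)
    (hF' : Γ.IsFraction z w' S' F') : F * Γ.denom w' S' = F' * Γ.denom w S := by
  have h : (F * Γ.denom w' S').coeff = (F' * Γ.denom w S).coeff := by
    apply DFunLike.coe_injective
    rw [mul_comm F, mul_comm F', ← act_coeff, ← act_coeff, ← hF.act_eq, ← hF'.act_eq, ← act_mul,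
      ← act_mul, mul_comm]
  exact AddMonoidAlgebra.coeff_injective h

theorem nodePart_unique {z : (Γ.Node → ℚ) → ℤ} {n : Γ.Node} {P P' : Γ.Laurent}
    (hP : Γ.IsNodePart z n P) (hP' : Γ.IsNodePart z n P') : P = P' := by
  obtain ⟨w, S, F, hF, h⟩ := hP
  obtain ⟨w', S', F', hF', h'⟩ := hP'
  exact Γ.nodeDivision_unique hF.1 hF'.1 (IsFraction.compat Γ hF hF') h h'

theorem chainPart_unique {z : (Γ.Node → ℚ) → ℤ} {n n' : Γ.Node} (hn : n' ∈ Γ.nbrs n)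
    {P P' : Γ.Laurent} (hP : Γ.IsChainPart z n n' P) (hP' : Γ.IsChainPart z n n' P') : P = P' := by
  obtain ⟨w, S, F, hF, h⟩ := hP
  obtain ⟨w', S', F', hF', h'⟩ := hP'
  exact Γ.chainDivision_unique hn hF.1 hF'.1 (IsFraction.compat Γ hF hF') h h'

theorem pick_eq {p : Γ.Laurent → Prop} {P : Γ.Laurent} (hP : p P) (hu : ∀ Q, p Q → Q = P) :
    Γ.pick p = P := by
  have hp : ∃ P, p P := ⟨P, hP⟩
  rw [pick, dif_pos hp]
  exact hu _ hp.choose_spec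

/-! ### Linear combinations and enlarging the denominator -/

theorem IsNodeDivision.sum {κ : Type*} (s : Finset κ) (c : κ → ℤ) (F P : κ → Γ.Laurent)
    {n : Γ.Node} {w : Γ.Node → Γ.Node → ℤ} {S : Finset Γ.Node}
    (hP : ∀ i ∈ s, Γ.IsNodeDivision n w S (F i) (P i)) :
    Γ.IsNodeDivision n w S (∑ i ∈ s, c i • F i) (∑ i ∈ s, c i • P i) := by
  choose! R h1 h2 h3 using hP
  refine ⟨∑ i ∈ s, c i • R i, ?_, suppIn_sum _ _ fun i hi => SuppIn.smul (h2 i hi) _,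
    suppIn_sum _ _ fun i hi => SuppIn.smul (h3 i hi) _⟩
  rw [Finset.sum_mul, ← Finset.sum_add_distrib]
  refine Finset.sum_congr rfl fun i hi => ?_
  rw [h1 i hi, smul_add, smul_mul_assoc]

theorem IsChainDivision.sum {κ : Type*} (s : Finset κ) (c : κ → ℤ) (F P : κ → Γ.Laurent)
    {n n' : Γ.Node} {w : Γ.Node → Γ.Node → ℤ} {S : Finset Γ.Node}
    (hP : ∀ i ∈ s, Γ.IsChainDivision n n' w S (F i) (P i)) :
    Γ.IsChainDivision n n' w S (∑ i ∈ s, c i • F i) (∑ i ∈ s, c i • P i) := by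
  choose! R₁ R₂ R h1 h2 h3 h4 h5 using hP
  refine ⟨∑ i ∈ s, c i • R₁ i, ∑ i ∈ s, c i • R₂ i, ∑ i ∈ s, c i • R i, ?_,
    suppIn_sum _ _ fun i hi => SuppIn.smul (h2 i hi) _,
    suppIn_sum _ _ fun i hi => SuppIn.smul (h3 i hi) _,
    suppIn_sum _ _ fun i hi => SuppIn.smul (h4 i hi) _,
    suppIn_sum _ _ fun i hi => SuppIn.smul (h5 i hi) _⟩
  rw [Finset.sum_mul, Finset.sum_mul, Finset.sum_mul, ← Finset.sum_add_distrib,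
    ← Finset.sum_add_distrib, ← Finset.sum_add_distrib]
  refine Finset.sum_congr rfl fun i hi => ?_
  simp only [h1 i hi, smul_add, smul_mul_assoc]

/-- The remainder is multiplied by the new factors, which raise its degree by at most the amount by
which the bound grows. -/
theorem IsNodeDivision.enlarge {n : Γ.Node} {w : Γ.Node → Γ.Node → ℤ} {S T : Finset Γ.Node}
    (hST : Disjoint S T) (hw : Γ.PosWeights w (S ∪ T)) {F P : Γ.Laurent}
    (hP : Γ.IsNodeDivision n w S F P) : Γ.IsNodeDivision n w (S ∪ T) (F * Γ.denom w T) P := by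
  obtain ⟨R, e, h1, h2⟩ := (Γ.isNodeDivision_iff (hw.subset Finset.subset_union_left) F P).1 hP
  refine (Γ.isNodeDivision_iff hw _ P).2 ⟨R * Γ.denom w T, ?_, h1, ?_⟩
  · have : Γ.denom w (S ∪ T) = Γ.denom w S * Γ.denom w T := Finset.prod_union hST
    rw [e, this]
    ring
  · refine h2.mul (suppIn_den _ T (Γ.coord n) Γ.projRange
      (fun m hm => (hw.pos (Finset.mem_union_right _ hm) n).le)
      fun m _ => Γ.toQ_mem_projRange _) ?_
    rintro x ⟨x0, x1, x2⟩ y ⟨y0, y1, y2⟩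
    refine ⟨add_mem x0 y0, add_nonneg x1 y1, ?_⟩
    rw [Finset.sum_union hST]
    exact add_lt_add_of_lt_of_le x2 y2

/-- `R₁` already multiplies the denominator of the side of n', which grows by itself, so it only
absorbs the new factors of the side of n. On the exponents of these `planeDet n' n` vanishes, so
that bound persists. `R₂` is symmetric, and `R` absorbs both kinds. -/
theorem IsChainDivision.enlarge {n n' : Γ.Node} (h : n' ∈ Γ.nbrs n) {w : Γ.Node → Γ.Node → ℤ}
    {S T : Finset Γ.Node} (hST : Disjoint S T) (hw : Γ.PosWeights w (S ∪ T)) {F P : Γ.Laurent}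
    (hP : Γ.IsChainDivision n n' w S F P) :
    Γ.IsChainDivision n n' w (S ∪ T) (F * Γ.denom w T) P := by
  have h' := Γ.nbrs_comm.1 h
  have hwT := hw.subset (Finset.subset_union_right (s₁ := S) (s₂ := T))
  obtain ⟨R₁, R₂, R, e, h1, h2, h3, h4⟩ :=
    (Γ.isChainDivision_iff h (hw.subset Finset.subset_union_left) F P).1 hP
  have hdis : ∀ A : Finset Γ.Node, Disjoint (S ∩ A) (T ∩ A) := fun A =>
    hST.mono Finset.inter_subset_left Finset.inter_subset_left
  have hden : ∀ A : Finset Γ.Node,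
      Γ.denom w ((S ∪ T) ∩ A) = Γ.denom w (S ∩ A) * Γ.denom w (T ∩ A) := fun A => by
    rw [Finset.union_inter_distrib_right]
    exact Finset.prod_union (hdis A)
  have hsum : ∀ (A : Finset Γ.Node) (f : Γ.Node → ℚ), ∑ m ∈ (S ∪ T) ∩ A, f m =
      ∑ m ∈ S ∩ A, f m + ∑ m ∈ T ∩ A, f m := fun A f => by
    rw [Finset.union_inter_distrib_right, Finset.sum_union (hdis A)]
  have hT : ∀ {n n' : Γ.Node}, n' ∈ Γ.nbrs n → ∀ lam : (Γ.Node → ℚ) →+ ℚ,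
      (∀ m ∈ T ∩ Γ.side n n', 0 ≤ lam (Γ.toQ (w m))) → SuppIn (Γ.denom w (T ∩ Γ.side n n'))
      {x | x ∈ Γ.projRange ⊓ (Γ.planeDet n' n).ker ∧ 0 ≤ lam x ∧
        lam x ≤ ∑ m ∈ T ∩ Γ.side n n', lam (Γ.toQ (w m))} := fun h lam hlam =>
    suppIn_den _ _ lam _ hlam
      fun m hm => ⟨Γ.toQ_mem_projRange _, (Γ.planeDet_weight h hwT hm).1⟩
  refine (Γ.isChainDivision_iff h hw _ P).2 ⟨R₁ * Γ.denom w (T ∩ Γ.side n n'),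
    R₂ * Γ.denom w (T ∩ Γ.side n' n),
    R * Γ.denom w (T ∩ Γ.side n n') * Γ.denom w (T ∩ Γ.side n' n), ?_, h1, ?_, ?_, ?_⟩
  · rw [Γ.denom_split h w (S ∪ T), Γ.denom_split h w T, e, Γ.denom_split h w S, hden, hden]
    ring
  · refine h2.mul (hT h (Γ.coord n') fun m hm => (hwT.pos (Finset.mem_inter.1 hm).1 n').le) ?_
    rintro x ⟨x0, x1, x2, x3⟩ y ⟨⟨y0, y1⟩, y2, y3⟩
    refine ⟨add_mem x0 y0, add_nonneg x1 y2, ?_, ?_⟩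
    · rw [hsum]
      exact add_lt_add_of_lt_of_le x2 y3
    · rw [map_add, y1, add_zero]
      exact x3
  · refine h3.mul (hT h' (Γ.coord n) fun m hm => (hwT.pos (Finset.mem_inter.1 hm).1 n).le) ?_
    rintro x ⟨x0, x1, x2, x3⟩ y ⟨⟨y0, y1⟩, y2, y3⟩
    refine ⟨add_mem x0 y0, add_nonneg x1 y2, ?_, ?_⟩
    · rw [hsum]
      exact add_lt_add_of_lt_of_le x2 y3
    · rw [map_add, y1, add_zero]
      exact x3
  · refine (h4.mul (hT h (Γ.planeDet n n')
      fun m hm => (Γ.planeDet_weight h hwT hm).2.le) (C := {x | x ∈ Γ.projRange ∧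
        (0 ≤ Γ.planeDet n n' x ∧
        Γ.planeDet n n' x < ∑ m ∈ (S ∪ T) ∩ Γ.side n n', Γ.planeDet n n' (Γ.toQ (w m))) ∧
      0 ≤ Γ.planeDet n' n x ∧
        Γ.planeDet n' n x < ∑ m ∈ S ∩ Γ.side n' n, Γ.planeDet n' n (Γ.toQ (w m))}) ?_).mul
      (hT h' (Γ.planeDet n' n) fun m hm => (Γ.planeDet_weight h' hwT hm).2.le) ?_
    · rintro x ⟨x0, ⟨x1, x2⟩, x3, x4⟩ y ⟨⟨y0, y1⟩, y2, y3⟩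
      rw [Set.mem_ofPred_eq, map_add, map_add, y1, add_zero, hsum]
      exact ⟨add_mem x0 y0, ⟨add_nonneg x1 y2, add_lt_add_of_lt_of_le x2 y3⟩, x3, x4⟩
    · rintro x ⟨x0, ⟨x1, x2⟩, x3, x4⟩ y ⟨⟨y0, y1⟩, y2, y3⟩
      rw [Set.mem_ofPred_eq, map_add, map_add, y1, add_zero, hsum _ fun m => Γ.planeDet n' n _]
      exact ⟨add_mem x0 y0, ⟨x1, x2⟩, add_nonneg x3 y2, add_lt_add_of_lt_of_le x4 y3⟩

end PlumbingTree
end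
noncomputable section
open scoped Classical
universe u
namespace PlumbingTree
open LaurentDivision
variable {V : Type u} [Fintype V] [DecidableEq V] (Γ : PlumbingTree V)

/-! ### Generating vectors -/

theorem subLift_zero (a : Γ.LiftData) : Γ.subLift a 0 = a := by
  simp [subLift]

theorem zero_mem_levels : (0 : Γ.Node → ℕ) ∈ Γ.levels := by
  rw [levels, Fintype.mem_piFinset]
  intro n
  split_ifs with h
  · have := (Finset.mem_filter.1 h).2
    rw [Finset.mem_range, Pi.zero_apply]
    omega
  · simp

theorem toQ_add (l l' : Γ.Node → ℤ) : Γ.toQ (l + l') = Γ.toQ l + Γ.toQ l' := by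
  funext n
  simp [toQ]

theorem toQ_sub (l l' : Γ.Node → ℤ) : Γ.toQ (l - l') = Γ.toQ l - Γ.toQ l' := by
  funext n
  simp [toQ]

theorem toQ_sum (T : Finset Γ.Node) (j : Γ.Node → ℕ) (v : Γ.Node → Γ.Node → ℤ) :
    Γ.toQ (∑ n ∈ T, j n • v n) = ∑ n ∈ T, j n • Γ.toQ (v n) := by
  funext m
  simp [toQ, Finset.sum_apply]

section Order
variable [PartialOrder Γ.Node]

theorem quasi_subLift (a : Γ.LiftData) (k : Γ.Node → ℕ) (l : Γ.Node → ℤ) (n : Γ.Node) :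
    Γ.quasi (Γ.subLift a k) l n = Γ.quasi a l n - k n := by
  simp only [quasi, subLift]
  push_cast
  ring

theorem linear_subLift (a : Γ.LiftData) (k : Γ.Node → ℕ) (l : Γ.Node → ℤ) (n : Γ.Node) :
    Γ.linear (Γ.subLift a k) l n = Γ.linear a l n - k n := by
  rw [linear, quasi_subLift, linear]
  simp only [subLift]
  ring

theorem normModule_subLift_subset (a : Γ.LiftData) (k : Γ.Node → ℕ) :
    Γ.normModule (Γ.subLift a k) ⊆ Γ.normModule a := by
  rintro l ⟨h1, h2⟩
  refine ⟨h1, fun n => ?_⟩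
  have h3 := h2 n
  rw [linear_subLift] at h3
  have : (0 : ℚ) ≤ k n := Nat.cast_nonneg _
  linarith

theorem quasi_le_linear (a : Γ.LiftData) (l : Γ.Node → ℤ) (n : Γ.Node) :
    Γ.quasi a l n ≤ Γ.linear a l n :=
  le_add_of_nonneg_right (Finset.sum_nonneg fun _ _ => Int.fract_nonneg _)

theorem linear_le_quasi (a : Γ.LiftData) (l : Γ.Node → ℤ) (n : Γ.Node) :
    Γ.linear a l n ≤ Γ.quasi a l n + (Γ.leaves n).card := by
  rw [linear, add_le_add_iff_left, Finset.card_eq_sum_ones, Nat.cast_sum]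
  exact Finset.sum_le_sum fun u _ => by simpa using (Int.fract_lt_one _).le

theorem mem_normModule_iff {a : Γ.LiftData} {l : Γ.Node → ℤ} :
    l ∈ Γ.normModule a ↔ l ∈ Γ.affineLattice a ∧ Γ.shift a + Γ.toQ l ∈ Γ.orbCone := by
  simp only [normModule, Set.mem_ofPred_eq, mem_orbCone, linear_eq_orb]

theorem add_mem_affineLattice {a : Γ.LiftData} {l x : Γ.Node → ℤ} (hl : l ∈ Γ.affineLattice a)
    (hx : x ∈ Γ.affineLattice Γ.zeroLift) : l + x ∈ Γ.affineLattice a := by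
  intro n n' hn hlt
  have h1 := (hl n n' hn hlt).add (hx n n' hn hlt)
  have e : (zeroLift Γ).chain n n' = 0 := rfl
  rw [e, add_zero] at h1
  simpa [mul_add, add_add_add_comm] using h1

theorem neg_mem_affineLattice {x : Γ.Node → ℤ}
    (hx : x ∈ Γ.affineLattice Γ.zeroLift) : -x ∈ Γ.affineLattice Γ.zeroLift := by
  intro n n' hn hlt
  have h1 := (hx n n' hn hlt).neg
  have e : (zeroLift Γ).chain n n' = 0 := rfl
  rw [e, neg_zero] at h1
  rw [e]
  simpa [mul_neg, neg_add, add_comm] using h1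

theorem sum_mem_affineLattice (T : Finset Γ.Node) (j : Γ.Node → ℕ) {v : Γ.Node → Γ.Node → ℤ}
    (hv : ∀ n, v n ∈ Γ.affineLattice Γ.zeroLift) :
    ∑ n ∈ T, j n • v n ∈ Γ.affineLattice Γ.zeroLift := by
  have h0 : (0 : Γ.Node → ℤ) ∈ Γ.affineLattice Γ.zeroLift := by
    intro n n' _ _
    simp [zeroLift]
  refine Finset.sum_induction _ (fun x => x ∈ Γ.affineLattice Γ.zeroLift)
    (fun _ _ h h' => Γ.add_mem_affineLattice h h') h0 fun n _ => ?_
  induction j n with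
  | zero => rwa [zero_smul]
  | succ i ih => rw [succ_nsmul]; exact Γ.add_mem_affineLattice ih (hv n)

variable {Γ}
variable {a : Γ.LiftData} {v : Γ.Node → Γ.Node → ℤ}

theorem IsGenerating.toQ_mem_orbCone {κ : ℚ} (hv : Γ.IsGenerating a κ v) (n : Γ.Node) :
    Γ.toQ (v n) ∈ Γ.orbCone := by
  rw [← hv.2.1]
  refine ⟨fun m => if m = n then 1 else 0, fun m => by dsimp only; split_ifs <;> norm_num, ?_⟩
  simp

theorem IsGenerating.add_mem_normModule {κ : ℚ} (hv : Γ.IsGenerating a κ v) {l : Γ.Node → ℤ}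
    (hl : l ∈ Γ.normModule a) (n : Γ.Node) : l + v n ∈ Γ.normModule a := by
  rw [mem_normModule_iff] at hl ⊢
  refine ⟨Γ.add_mem_affineLattice hl.1 (hv.1 n).1, fun m => ?_⟩
  change 0 ≤ Γ.orb _ m
  rw [toQ_add, ← add_assoc, map_add]
  exact add_nonneg (hl.2 m) (hv.toQ_mem_orbCone n m)

theorem IsGenerating.add_nsmul (hv : Γ.IsGenerating a 1 v) {l : Γ.Node → ℤ}
    (hl : l ∈ Γ.normModule a) (n : Γ.Node) (j : ℕ) : l + j • v n ∈ Γ.normModule a ∧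
      (∀ n' ≠ n, Γ.quasi a (l + j • v n) n' = Γ.quasi a l n') ∧
      (j = 0 ∨ 1 ≤ Γ.quasi a (l + j • v n) n) := by
  induction j with
  | zero => exact ⟨by simpa using hl, fun n' _ => by simp, Or.inl rfl⟩
  | succ j ih =>
    have e : l + (j + 1) • v n = (l + j • v n) + v n := by rw [succ_nsmul, add_assoc]
    rw [e]
    obtain ⟨h1, h2⟩ := hv.2.2 _ ih.1 n
    exact ⟨hv.add_mem_normModule ih.1 n, fun n' hn => (h1 n' hn).trans (ih.2.1 n' hn), Or.inr h2⟩

/-- Each 𝔳_m affects N_a at m alone and the normalization is stable under all of them, so the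
translations can be applied one after the other without interfering. -/
theorem IsGenerating.add_sum (hv : Γ.IsGenerating a 1 v) {l : Γ.Node → ℤ}
    (hl : l ∈ Γ.normModule a) (j : Γ.Node → ℕ) (T : Finset Γ.Node) :
    l + ∑ n ∈ T, j n • v n ∈ Γ.normModule a ∧
      ∀ n, ((n ∉ T ∨ j n = 0) → Γ.quasi a (l + ∑ n ∈ T, j n • v n) n = Γ.quasi a l n) ∧
        (n ∈ T → 1 ≤ j n → 1 ≤ Γ.quasi a (l + ∑ n ∈ T, j n • v n) n) := by
  induction T using Finset.induction_on with
  | empty => simpa using hl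
  | insert m T hm ih =>
    rw [Finset.sum_insert hm, add_comm (j m • v m), ← add_assoc]
    obtain ⟨h1, h2, h3⟩ := hv.add_nsmul ih.1 m (j m)
    refine ⟨h1, fun n => ⟨fun hn => ?_, fun hn hj => ?_⟩⟩
    · rcases eq_or_ne n m with rfl | hne
      · have h0 : j n = 0 := hn.resolve_left fun h => h (Finset.mem_insert_self _ _)
        rw [h0, zero_smul, add_zero]
        exact (ih.2 n).1 (Or.inr h0)
      · rw [h2 n hne]
        exact (ih.2 n).1 (hn.imp_left fun h h' => h (Finset.mem_insert_of_mem h'))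
    · rcases eq_or_ne n m with rfl | hne
      · exact h3.resolve_left (by omega)
      · rw [h2 n hne]
        exact (ih.2 n).2 (Finset.mem_of_mem_insert_of_ne hn hne) hj

/-- Adding multiples of 𝔳_n never changes N_a at n', and N̄_a exceeds N_a by at most the number of
legs; so the linear growth of N̄_a at n' must vanish. A starting point in the normalization is
needed. -/
theorem IsGenerating.orb_eq_zero (hv : Γ.IsGenerating a 1 v) (hne : (Γ.normModule a).Nonempty)
    {n n' : Γ.Node} (hn : n' ≠ n) : Γ.orb (Γ.toQ (v n)) n' = 0 := by
  obtain ⟨l, hl⟩ := hne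
  refine le_antisymm ?_ (hv.toQ_mem_orbCone n n')
  by_contra! hpos
  obtain ⟨j, hj⟩ := exists_nat_gt (((Γ.leaves n').card : ℚ) / Γ.orb (Γ.toQ (v n)) n')
  rw [div_lt_iff₀ hpos] at hj
  obtain ⟨-, h2, -⟩ := hv.add_nsmul hl n j
  have h3 := Γ.linear_le_quasi a (l + j • v n) n'
  have h4 := Γ.quasi_le_linear a l n'
  rw [h2 n' hn] at h3
  have h5 : Γ.toQ (j • v n) = (j : ℚ) • Γ.toQ (v n) := by
    funext m
    simp [toQ]
  rw [linear_eq_orb] at h3 h4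
  rw [toQ_add, h5, ← add_assoc, map_add, map_smul, Pi.add_apply, Pi.smul_apply, smul_eq_mul] at h3
  linarith

theorem IsGenerating.orb_sum (hv : Γ.IsGenerating a 1 v) (hne : (Γ.normModule a).Nonempty)
    (τ : Γ.Node → ℚ) (n : Γ.Node) :
    Γ.orb (∑ m, τ m • Γ.toQ (v m)) n = τ n * Γ.orb (Γ.toQ (v n)) n := by
  rw [map_sum, Finset.sum_apply, Finset.sum_eq_single n]
  · rw [map_smul]; rfl
  · intro m _ hm
    rw [map_smul, Pi.smul_apply, hv.orb_eq_zero hne hm.symm, smul_zero]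
  · exact fun h => absurd (Finset.mem_univ n) h

/-- π_𝒩(E_n^*) lies in the cone and has coordinate 1 at n; among the generators only 𝔳_n can supply
it. -/
theorem IsGenerating.orb_pos (hv : Γ.IsGenerating a 1 v) (hne : (Γ.normModule a).Nonempty)
    (n : Γ.Node) : 0 < Γ.orb (Γ.toQ (v n)) n := by
  have h1 : Γ.res (Γ.dualVec n) ∈ Γ.orbCone := by
    intro m
    change 0 ≤ Γ.orb _ m
    rw [orb_dualVec_node]
    split_ifs <;> norm_num
  rw [← hv.2.1] at h1
  obtain ⟨τ, -, e⟩ := h1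
  have h2 := Γ.orb_dualVec_node n n
  rw [e, hv.orb_sum hne, if_pos rfl] at h2
  refine lt_of_le_of_ne (hv.toQ_mem_orbCone n n) fun h => ?_
  rw [← h, mul_zero] at h2
  exact zero_ne_one h2

theorem IsGenerating.posWeights (hv : Γ.IsGenerating a 1 v) (hne : (Γ.normModule a).Nonempty)
    (S : Finset Γ.Node) : Γ.PosWeights v S := by
  intro n _
  refine ⟨_, hv.orb_pos hne n, ?_⟩
  conv_lhs => rw [Γ.eq_sum_orb (Γ.toQ (v n))]
  rw [Finset.sum_eq_single n]
  · rfl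
  · intro m _ hm
    rw [hv.orb_eq_zero hne hm, zero_smul]
  · exact fun h => absurd (Finset.mem_univ n) h

/-! ### The graded pieces of the module of holes -/

theorem IsGenerating.gradedHoles_subset {κ : ℚ} {k : Γ.Node → ℕ}
    (hv : Γ.IsGenerating (Γ.subLift a k) κ v) (I : Finset Γ.Node) :
    Γ.gradedHoles v a k I ⊆ Γ.normModule (Γ.subLift a k) := by
  rintro l ⟨h1, ⟨τ, hτ, e⟩, -, -⟩
  refine (Γ.mem_normModule_iff).2 ⟨h1, ?_⟩
  rw [← hv.2.1]
  exact ⟨τ, fun n => (hτ n).1, by rw [add_comm, e]⟩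

theorem gradedHoles_finite (v : Γ.Node → Γ.Node → ℤ) (a : Γ.LiftData) (k : Γ.Node → ℕ)
    (I : Finset Γ.Node) : (Γ.gradedHoles v a k I).Finite := by
  refine (Set.finite_Icc (fun n => ⌊-Γ.shift (Γ.subLift a k) n - ∑ m, |(v m n : ℚ)|⌋)
    (fun n => ⌈-Γ.shift (Γ.subLift a k) n + ∑ m, |(v m n : ℚ)|⌉)).subset ?_
  rintro l ⟨-, ⟨τ, hτ, e⟩, -⟩
  have key : ∀ n, |Γ.toQ l n + Γ.shift (Γ.subLift a k) n| ≤ ∑ m, |(v m n : ℚ)| := by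
    intro n
    have e1 := congrFun e n
    rw [Pi.add_apply, Finset.sum_apply] at e1
    rw [e1]
    refine (Finset.abs_sum_le_sum_abs _ _).trans (Finset.sum_le_sum fun m _ => ?_)
    rw [Pi.smul_apply, smul_eq_mul, abs_mul]
    refine mul_le_of_le_one_left (abs_nonneg _) ?_
    rw [abs_of_nonneg (hτ m).1]
    exact (hτ m).2.le
  constructor
  · intro n
    have h1 := (abs_le.1 (key n)).1
    have h2 := Int.floor_le (-Γ.shift (Γ.subLift a k) n - ∑ m, |(v m n : ℚ)|)
    have h3 : ((⌊-Γ.shift (Γ.subLift a k) n - ∑ m, |(v m n : ℚ)|⌋ : ℤ) : ℚ) ≤ (l n : ℚ) := by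
      have : Γ.toQ l n = (l n : ℚ) := rfl
      linarith
    exact_mod_cast h3
  · intro n
    have h1 := (abs_le.1 (key n)).2
    have h2 := Int.le_ceil (-Γ.shift (Γ.subLift a k) n + ∑ m, |(v m n : ℚ)|)
    have h3 : (l n : ℚ) ≤ ((⌈-Γ.shift (Γ.subLift a k) n + ∑ m, |(v m n : ℚ)|⌉ : ℤ) : ℚ) := by
      have : Γ.toQ l n = (l n : ℚ) := rfl
      linarith
    exact_mod_cast h3

end Order
end PlumbingTree
end
-- Geometric series of simplicial cones
noncomputable section
open scoped Classical
universe u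

namespace LaurentDivision
variable {G ι : Type*} [AddCommGroup G]

/-- The characteristic function of `x + ∑_{m ∈ T} ℕ u_m`. -/
def coneInd (u : ι → G) (T : Finset ι) (x y : G) : ℤ :=
  if ∃ j : ι → ℕ, y = x + ∑ m ∈ T, j m • u m then 1 else 0

/-- The geometric series of a simplicial cone. -/
theorem act_den_coneInd (u : ι → G) (T : Finset ι) (lam : ι → G →+ ℚ)
    (h0 : ∀ m m', m ≠ m' → lam m (u m') = 0) (h1 : ∀ m, 0 < lam m (u m)) (x : G) :
    act (den u T) (coneInd u T x) = (mon x).coeff := by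
  induction T using Finset.induction_on with
  | empty =>
    rw [den, Finset.prod_empty, act_one]
    funext y
    simp [coneInd, mon, AddMonoidAlgebra.coeff_single, Finsupp.single_apply, eq_comm]
  | insert m T hm ih =>
    rw [den_insert u hm, mul_comm, act_mul, ← ih]
    congr 1
    funext y
    have e : act (1 - mon (u m)) (coneInd u (insert m T) x) y =
        coneInd u (insert m T) x y - coneInd u (insert m T) x (y - u m) := by
      rw [sub_eq_add_neg, act_add, act_one]
      have : -mon (u m) = AddMonoidAlgebra.single (u m) (-1 : ℤ) := by
        rw [AddMonoidAlgebra.single_neg]; rfl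
      rw [this, Pi.add_apply, act_single]
      ring
    rw [e]
    have hz : ∀ j : ι → ℕ, lam m (∑ i ∈ T, j i • u i) = 0 := fun j => by
      rw [map_sum]
      refine Finset.sum_eq_zero fun i hi => ?_
      rw [map_nsmul, h0 m i (by rintro rfl; exact hm hi), smul_zero]
    have hupd : ∀ (j : ι → ℕ) (c : ℕ), ∑ i ∈ T, Function.update j m c i • u i =
        ∑ i ∈ T, j i • u i := fun j c => Finset.sum_congr rfl fun i hi => by
      rw [Function.update_of_ne]; rintro rfl; exact hm hi
    have hins : ∀ z, (∃ j : ι → ℕ, z = x + ∑ i ∈ insert m T, j i • u i) ↔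
        ∃ (c : ℕ) (j : ι → ℕ), z = x + c • u m + ∑ i ∈ T, j i • u i := by
      intro z
      constructor
      · rintro ⟨j, rfl⟩
        exact ⟨j m, j, by rw [Finset.sum_insert hm, add_assoc]⟩
      · rintro ⟨c, j, rfl⟩
        exact ⟨Function.update j m c, by
          rw [Finset.sum_insert hm, hupd, Function.update_self, add_assoc]⟩
    simp only [coneInd, hins]
    -- Multiplying by 1 - t^{u_m} telescopes over the multiplicity c of u_m and leaves the layer c =
    -- 0. The form `lam m` vanishes on the other generators, so a point of this layer is not also in
    -- the cone shifted by u_m.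
    by_cases hT : ∃ j : ι → ℕ, y = x + ∑ i ∈ T, j i • u i
    · obtain ⟨j, hj⟩ := hT
      rw [if_pos ⟨0, j, by rw [zero_smul, add_zero, hj]⟩, if_neg, if_pos ⟨j, hj⟩, sub_zero]
      rintro ⟨c, j', e'⟩
      have e1 : ∑ i ∈ T, j i • u i = (c + 1) • u m + ∑ i ∈ T, j' i • u i := by
        rw [hj, sub_eq_iff_eq_add] at e'
        rw [succ_nsmul]
        refine add_left_cancel (a := x) ?_
        rw [e']
        abel
      have e2 := congrArg (lam m) e1
      rw [map_add, hz, hz, map_nsmul, add_zero] at e2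
      have := h1 m
      have h3 : 0 < (c + 1) • lam m (u m) := nsmul_pos this (Nat.succ_ne_zero _)
      exact h3.ne e2
    · rw [if_neg hT, sub_eq_zero]
      refine if_congr ⟨?_, ?_⟩ rfl rfl
      · rintro ⟨c, j, e'⟩
        rcases c with - | c
        · exact absurd ⟨j, by rw [e', zero_smul, add_zero]⟩ hT
        · refine ⟨c, j, ?_⟩
          rw [e', succ_nsmul]
          abel
      · rintro ⟨c, j, e'⟩
        refine ⟨c + 1, j, ?_⟩
        rw [sub_eq_iff_eq_add] at e'
        rw [e', succ_nsmul]
        abel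

/-- Expand the product of the t^{u_m} = 1 - (1 - t^{u_m}): this is the inclusion–exclusion behind
the alternating sum over 𝓘. -/
theorem mon_add_sum (u : ι → G) (N : Finset ι) (x : G) :
    mon (x + ∑ m ∈ N, u m) =
      ∑ J ∈ N.powerset, (-1 : ℤ) ^ J.card • (mon x * den u J) := by
  have h1 : mon (x + ∑ m ∈ N, u m) = mon x * ∏ m ∈ N, mon (u m) := by
    rw [← mon_mul]
    congr 1
    induction N using Finset.induction_on with
    | empty => rfl
    | insert m N hm ih => rw [Finset.sum_insert hm, Finset.prod_insert hm, ← mon_mul, ih]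
  have h2 : ∏ m ∈ N, mon (u m) = ∏ m ∈ N, (-(1 - mon (u m)) + 1) :=
    Finset.prod_congr rfl fun m _ => by ring
  rw [h1, h2, Finset.prod_add_one, Finset.mul_sum]
  refine Finset.sum_congr rfl fun J _ => ?_
  have h3 : ∏ m ∈ J, -(1 - mon (u m)) = (-1 : ℤ) ^ J.card • den u J := by
    rw [Finset.prod_neg, den, zsmul_eq_mul]
    push_cast
    rfl
  rw [h3, mul_smul_comm]

end LaurentDivision

/-! ### The reduced series as a sum of cones -/

namespace PlumbingTree
open LaurentDivision
variable {V : Type u} [Fintype V] [DecidableEq V] (Γ : PlumbingTree V)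

/-- The sign and binomial coefficient of the level `k`. -/
def levelCoeff (k : Γ.Node → ℕ) : ℤ :=
  ∏ n ∈ Γ.hatNodes, (-1 : ℤ) ^ k n * ((Γ.nodeValency n - 2).choose (k n) : ℤ)

section Order
variable [PartialOrder Γ.Node]

/-- The points at which `N_a` takes the values `k_n` on the nodes of valency at least two and
nonnegative values on the other nodes. -/
def levelSet (a : Γ.LiftData) (k : Γ.Node → ℕ) : Set (Γ.Node → ℤ) :=
  {l | l ∈ Γ.affineLattice a ∧ (∀ n ∈ Γ.hatNodes, Γ.quasi a l n = k n) ∧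
    ∀ n ∉ Γ.hatNodes, 0 ≤ Γ.quasi a l n}

/-- If all N_a(ℓ, n) are nonnegative, the only level that can contribute is the one agreeing with
N_a on 𝒩̂, and `levelCoeff` is then the product of the node coefficients. Otherwise both sides
vanish. -/
theorem reducedSeries_eq_sum_levels [Nonempty Γ.Node]
    (hord : ∀ n, ∀ n' ∈ Γ.nbrs n, n < n' ∨ n' < n) (hval : ∀ n, 1 ≤ Γ.nodeValency n)
    {h : Γ.H} {a : Γ.LiftData} (ha : Γ.IsReducedLift a h) {l : Γ.Node → ℤ}
    (hl : l ∈ Γ.affineLattice a) :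
    Γ.reducedSeries h (Γ.shift a + Γ.toQ l) =
      ∑ k ∈ Γ.levels, Γ.levelCoeff k * if l ∈ Γ.levelSet a k then 1 else 0 := by
  by_cases hneg : ∃ n, Γ.quasi a l n < 0
  · obtain ⟨n, hn⟩ := hneg
    rw [Γ.reducedSeries_eq_zero_of_neg hord ha hl hn]
    refine (Finset.sum_eq_zero fun k _ => ?_).symm
    rw [if_neg, mul_zero]
    rintro ⟨-, h1, h2⟩
    by_cases hh : n ∈ Γ.hatNodes
    · rw [h1 n hh] at hn
      exact not_le.2 hn (Nat.cast_nonneg _)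
    · exact not_le.2 hn (h2 n hh)
  · push Not at hneg
    have hM : ∀ n, ∃ M : ℕ, Γ.quasi a l n = M := by
      intro n
      obtain ⟨k, hk⟩ := Γ.quasi_integral hord a hl n
      have h0 := hneg n
      rw [hk] at h0
      have h1 : 0 ≤ k := by exact_mod_cast h0
      refine ⟨k.toNat, ?_⟩
      rw [hk, ← Int.cast_natCast, Int.toNat_of_nonneg h1]
    choose M hM using hM
    rw [Γ.reducedSeries_eq_prod hord hval ha hl M hM]
    -- On 𝒩̂ a value beyond δ_{n,𝒩} - 2 matches no level, and its binomial coefficient is 0. The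
    -- other nodes contribute 1 whatever the value, with the single level 0.
    have h1 : ∀ n, Γ.nodeCoeff n (M n) =
        ∑ j ∈ (if n ∈ Γ.hatNodes then Finset.range (Γ.nodeValency n - 1) else {0}),
          if n ∈ Γ.hatNodes then (if M n = j then
            (-1) ^ j * ((Γ.nodeValency n - 2).choose j : ℤ) else 0) else 1 := by
      intro n
      by_cases hn : n ∈ Γ.hatNodes
      · simp only [nodeCoeff, if_pos hn, Finset.sum_ite_eq, Finset.mem_range]
        split_ifs with hlt
        · rfl
        · rw [Nat.choose_eq_zero_of_lt (by
            have := (Finset.mem_filter.1 hn).2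
            omega)]
          simp
      · simp [nodeCoeff, if_neg hn]
    simp only [h1]
    rw [Finset.prod_univ_sum]
    refine Finset.sum_congr rfl fun k _ => ?_
    have h2 : ∏ n, (if n ∈ Γ.hatNodes then (if M n = k n then
        (-1) ^ k n * ((Γ.nodeValency n - 2).choose (k n) : ℤ) else 0) else 1) =
        ∏ n ∈ Γ.hatNodes, (if M n = k n then
          (-1) ^ k n * ((Γ.nodeValency n - 2).choose (k n) : ℤ) else 0) := by
      rw [Finset.prod_ite_mem, Finset.univ_inter]
    rw [h2]
    have h3 : l ∈ Γ.levelSet a k ↔ ∀ n ∈ Γ.hatNodes, M n = k n := by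
      constructor
      · rintro ⟨-, h4, -⟩ n hn
        have := h4 n hn
        rw [hM] at this
        exact_mod_cast this
      · exact fun h4 => ⟨hl, fun n hn => by rw [hM, h4 n hn], fun n _ => hneg n⟩
    by_cases hk : l ∈ Γ.levelSet a k
    · rw [if_pos hk, mul_one]
      exact Finset.prod_congr rfl fun n hn => if_pos (h3.1 hk n hn)
    · rw [if_neg hk, mul_zero]
      rw [h3] at hk
      push Not at hk
      obtain ⟨n, hn, hne⟩ := hk
      exact Finset.prod_eq_zero hn (if_neg hne)

/-- The nodes outside `hatNodes` at which `N_a(ℓ, ·)` is negative. -/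
def negNodes (a : Γ.LiftData) (l : Γ.Node → ℤ) : Finset Γ.Node :=
  Γ.hatNodesᶜ.filter fun n => Γ.quasi a l n < 0

theorem sum_negNodes {M : Type*} [AddCommMonoid M] (a : Γ.LiftData) (l : Γ.Node → ℤ)
    (u : Γ.Node → M) (j : Γ.Node → ℕ) :
    ∑ m ∈ Γ.negNodes a l, u m + ∑ m ∈ Γ.hatNodesᶜ, j m • u m =
      ∑ m ∈ Γ.hatNodesᶜ, (j m + if Γ.quasi a l m < 0 then 1 else 0) • u m := by
  rw [negNodes, Finset.sum_filter, add_comm, ← Finset.sum_add_distrib]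
  refine Finset.sum_congr rfl fun m _ => ?_
  split_ifs <;> simp [add_smul]

variable {Γ}
variable {a : Γ.LiftData} {v : Γ.Node → Γ.Node → ℤ} {k : Γ.Node → ℕ}

theorem quasi_add_sum (hv : Γ.IsGenerating (Γ.subLift a k) 1 v) {l : Γ.Node → ℤ}
    (hl : l ∈ Γ.normModule (Γ.subLift a k)) (j : Γ.Node → ℕ) (T : Finset Γ.Node) (n : Γ.Node) :
    ((n ∉ T ∨ j n = 0) → Γ.quasi a (l + ∑ n ∈ T, j n • v n) n = Γ.quasi a l n) ∧
      (n ∈ T → 1 ≤ j n → 1 ≤ Γ.quasi a (l + ∑ n ∈ T, j n • v n) n - k n) := by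
  have h := (hv.add_sum hl j T).2 n
  simpa only [quasi_subLift, sub_left_inj] using h

/-- Starting from a box point ℓ₀, N_a stays negative at m exactly while j_m = 0 and N_a(ℓ₀, m) < 0;
one step makes it positive. So the level set requires j_m ≥ 1 at the negative nodes, and this step
is built into the base point. -/
theorem mem_cone_iff (hv : Γ.IsGenerating (Γ.subLift a k) 1 v) {l₀ l : Γ.Node → ℤ}
    (hl₀ : l₀ ∈ Γ.gradedHoles v a k Γ.hatNodes) :
    (∃ j : Γ.Node → ℕ, Γ.shift a + Γ.toQ l = Γ.shift a + Γ.toQ l₀ +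
      ∑ m ∈ Γ.negNodes a l₀, Γ.toQ (v m) + ∑ m ∈ Γ.hatNodesᶜ, j m • Γ.toQ (v m)) ↔
    l ∈ Γ.levelSet a k ∧ ∃ j : Γ.Node → ℕ, l = l₀ + ∑ m ∈ Γ.hatNodesᶜ, j m • v m := by
  have hmem := hv.gradedHoles_subset _ hl₀
  have heq : ∀ j : Γ.Node → ℕ, (Γ.shift a + Γ.toQ l = Γ.shift a + Γ.toQ l₀ +
      ∑ m ∈ Γ.negNodes a l₀, Γ.toQ (v m) + ∑ m ∈ Γ.hatNodesᶜ, j m • Γ.toQ (v m)) ↔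
      l = l₀ + ∑ m ∈ Γ.hatNodesᶜ, (j m + if Γ.quasi a l₀ m < 0 then 1 else 0) • v m := by
    intro j
    rw [add_assoc, add_assoc, add_right_inj, sum_negNodes, ← toQ_sum, ← toQ_add]
    exact Γ.toQ_injective.eq_iff
  simp only [heq]
  constructor
  · rintro ⟨j, rfl⟩
    refine ⟨⟨Γ.add_mem_affineLattice hl₀.1 (Γ.sum_mem_affineLattice _ _ fun n => (hv.1 n).1),
      fun n hn => ?_, fun n hn => ?_⟩, ⟨_, rfl⟩⟩
    · rw [(quasi_add_sum hv hmem _ _ n).1 (Or.inl (by simpa using hn))]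
      exact hl₀.2.2.2 n hn
    · by_cases hj : (j n + if Γ.quasi a l₀ n < 0 then 1 else 0) = 0
      · rw [(quasi_add_sum hv hmem _ _ n).1 (Or.inr hj)]
        by_contra! hlt
        rw [if_pos hlt] at hj
        omega
      · have h1 := (quasi_add_sum hv hmem
          (fun m => j m + if Γ.quasi a l₀ m < 0 then 1 else 0) _ n).2
          (Finset.mem_compl.2 hn) (Nat.one_le_iff_ne_zero.2 hj)
        have h2 : (0 : ℚ) ≤ k n := Nat.cast_nonneg _
        linarith
  · rintro ⟨⟨-, -, h2⟩, j, rfl⟩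
    refine ⟨fun m => j m - if Γ.quasi a l₀ m < 0 then 1 else 0, ?_⟩
    congr 1
    refine Finset.sum_congr rfl fun m hm => ?_
    congr 1
    by_cases hlt : Γ.quasi a l₀ m < 0
    · have : j m ≠ 0 := by
        intro h0
        have h3 := h2 m (Finset.mem_compl.1 hm)
        rw [(quasi_add_sum hv hmem _ _ m).1 (Or.inr h0)] at h3
        exact not_le.2 hlt h3
      simp only [if_pos hlt]
      omega
    · simp [if_neg hlt]

/-- Subtract the integral parts of the cone coordinates of ℓ + 𝐜_{a-k}; what remains is in the box.
On 𝒩̂ nothing is subtracted, since otherwise N_a would exceed k_n there. -/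
theorem exists_gradedHole (hk : k ∈ Γ.levels) (hv : Γ.IsGenerating (Γ.subLift a k) 1 v)
    {l : Γ.Node → ℤ} (hl : l ∈ Γ.levelSet a k) :
    ∃ l₀ ∈ Γ.gradedHoles v a k Γ.hatNodes, ∃ j : Γ.Node → ℕ,
      l = l₀ + ∑ m ∈ Γ.hatNodesᶜ, j m • v m := by
  obtain ⟨h1, h2, h3⟩ := hl
  have hk0 : ∀ n ∉ Γ.hatNodes, k n = 0 := by
    intro n hn
    have := Fintype.mem_piFinset.1 hk n
    rwa [if_neg hn, Finset.mem_singleton] at this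
  have hq : ∀ n, 0 ≤ Γ.quasi a l n - k n := by
    intro n
    by_cases hn : n ∈ Γ.hatNodes
    · rw [h2 n hn, sub_self]
    · rw [hk0 n hn, Nat.cast_zero, sub_zero]
      exact h3 n hn
  have hmem : l ∈ Γ.normModule (Γ.subLift a k) := ⟨h1, fun n => by
    refine le_trans ?_ (Γ.quasi_le_linear _ _ _)
    rw [quasi_subLift]
    exact hq n⟩
  obtain ⟨-, hcone⟩ := (Γ.mem_normModule_iff).1 hmem
  rw [← hv.2.1] at hcone
  obtain ⟨τ, hτ, e⟩ := hcone
  set j : Γ.Node → ℕ := fun n => ⌊τ n⌋₊ with hj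
  set l₀ := l - ∑ m, j m • v m with hl₀
  have hl' : l = l₀ + ∑ m, j m • v m := by rw [hl₀, sub_add_cancel]
  have haff : l₀ ∈ Γ.affineLattice a := by
    rw [hl₀, sub_eq_add_neg]
    exact Γ.add_mem_affineLattice h1 (Γ.neg_mem_affineLattice
      (Γ.sum_mem_affineLattice _ _ fun n => (hv.1 n).1))
  have hbox : ∃ τ : Γ.Node → ℚ, (∀ n, 0 ≤ τ n ∧ τ n < 1) ∧
      Γ.toQ l₀ + Γ.shift (Γ.subLift a k) = ∑ n, τ n • Γ.toQ (v n) := by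
    refine ⟨fun n => τ n - j n, fun n => ⟨sub_nonneg.2 (Nat.floor_le (hτ n)), ?_⟩, ?_⟩
    · rw [sub_lt_iff_lt_add']
      exact Nat.lt_floor_add_one _
    · simp only [sub_smul, Finset.sum_sub_distrib, Nat.cast_smul_eq_nsmul]
      rw [← e, hl₀, toQ_sub, toQ_sum]
      abel
  have hmem₀ : l₀ ∈ Γ.normModule (Γ.subLift a k) := by
    obtain ⟨σ, hσ, e'⟩ := hbox
    refine (Γ.mem_normModule_iff).2 ⟨haff, ?_⟩
    rw [← hv.2.1]
    exact ⟨σ, fun n => (hσ n).1, by rw [add_comm, e']⟩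
  have hj0 : ∀ n ∈ Γ.hatNodes, j n = 0 := by
    intro n hn
    by_contra h0
    have h4 := (quasi_add_sum hv hmem₀ j Finset.univ n).2 (Finset.mem_univ _)
      (Nat.one_le_iff_ne_zero.2 h0)
    rw [← hl', h2 n hn, sub_self] at h4
    norm_num at h4
  refine ⟨l₀, ⟨haff, hbox, ?_, fun n hn => ?_⟩, j, ?_⟩
  · intro n hn
    simp at hn
  · rw [← (quasi_add_sum hv hmem₀ j Finset.univ n).1 (Or.inr (hj0 n hn)), ← hl']
    exact h2 n hn
  · rw [hl']
    congr 1
    refine (Finset.sum_subset (Finset.subset_univ _) fun n _ hn => ?_).symm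
    rw [hj0 n (by simpa using hn), zero_smul]

/-- The coordinates along the 𝔳_n can be read off by `orb`, and two numbers in [0, 1) that differ by
an integer are equal. -/
theorem gradedHole_unique (hv : Γ.IsGenerating (Γ.subLift a k) 1 v) {l l' : Γ.Node → ℤ}
    {I I' : Finset Γ.Node} (hl : l ∈ Γ.gradedHoles v a k I) (hl' : l' ∈ Γ.gradedHoles v a k I')
    (T : Finset Γ.Node) {j j' : Γ.Node → ℕ}
    (e : l + ∑ m ∈ T, j m • v m = l' + ∑ m ∈ T, j' m • v m) : l = l' := by
  have hne : (Γ.normModule (Γ.subLift a k)).Nonempty := ⟨l, hv.gradedHoles_subset _ hl⟩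
  obtain ⟨-, ⟨τ, hτ, e1⟩, -⟩ := hl
  obtain ⟨-, ⟨σ, hσ, e2⟩, -⟩ := hl'
  have hcombine : ∀ (i : Γ.Node → ℕ) (ρ : Γ.Node → ℚ),
      ∑ n, ρ n • Γ.toQ (v n) + ∑ m ∈ T, i m • Γ.toQ (v m) =
        ∑ n, (ρ n + if n ∈ T then (i n : ℚ) else 0) • Γ.toQ (v n) := by
    intro i ρ
    simp only [add_smul, Finset.sum_add_distrib, ite_smul, zero_smul, Finset.sum_ite_mem,
      Finset.univ_inter, Nat.cast_smul_eq_nsmul]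
  have e3 : ∑ n, (τ n + if n ∈ T then (j n : ℚ) else 0) • Γ.toQ (v n) =
      ∑ n, (σ n + if n ∈ T then (j' n : ℚ) else 0) • Γ.toQ (v n) := by
    rw [← hcombine, ← hcombine, ← e1, ← e2, ← toQ_sum, ← toQ_sum, add_right_comm, ← toQ_add, e,
      toQ_add]
    abel
  have e4 : ∀ n ∈ T, j n = j' n := by
    intro n hn
    have e5 := congrFun (congrArg Γ.orb e3) n
    rw [hv.orb_sum hne, hv.orb_sum hne, if_pos hn, if_pos hn] at e5
    have e6 := mul_right_cancel₀ (hv.orb_pos hne n).ne' e5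
    have t1 := hτ n
    have t2 := hσ n
    have a1 : (j n : ℚ) < (j' n + 1 : ℕ) := by push_cast; linarith
    have a2 : (j' n : ℚ) < (j n + 1 : ℕ) := by push_cast; linarith
    have b1 := Nat.cast_lt.1 a1
    have b2 := Nat.cast_lt.1 a2
    omega
  have e7 : ∑ m ∈ T, j m • v m = ∑ m ∈ T, j' m • v m :=
    Finset.sum_congr rfl fun m hm => by rw [e4 m hm]
  rw [e7] at e
  exact add_right_cancel e

/-- The base point `𝐜_a + ℓ + ∑ 𝔳_n`, the sum being over the `n` with `N_a(ℓ, n) < 0`. -/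
def basePoint (v : Γ.Node → Γ.Node → ℤ) (a : Γ.LiftData) (l : Γ.Node → ℤ) : Γ.Node → ℚ :=
  Γ.shift a + Γ.toQ l + ∑ m ∈ Γ.negNodes a l, Γ.toQ (v m)

theorem sum_coneInd (hk : k ∈ Γ.levels) (hv : Γ.IsGenerating (Γ.subLift a k) 1 v)
    (l : Γ.Node → ℤ) :
    ∑ l₀ ∈ (gradedHoles_finite v a k Γ.hatNodes).toFinset,
      coneInd (fun m => Γ.toQ (v m)) Γ.hatNodesᶜ (basePoint v a l₀) (Γ.shift a + Γ.toQ l) =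
      if l ∈ Γ.levelSet a k then 1 else 0 := by
  split_ifs with hl
  · obtain ⟨l₀, h1, j, h2⟩ := exists_gradedHole hk hv hl
    rw [Finset.sum_eq_single l₀]
    · exact if_pos ((mem_cone_iff hv h1).2 ⟨hl, j, h2⟩)
    · intro l₁ h3 hne
      rw [Set.Finite.mem_toFinset] at h3
      refine if_neg fun h4 => hne ?_
      obtain ⟨-, j', h5⟩ := (mem_cone_iff hv h3).1 h4
      exact (gradedHole_unique hv h1 h3 _ (h2.symm.trans h5)).symm
    · intro h3
      exact absurd ((Set.Finite.mem_toFinset _).2 h1) h3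
  · refine Finset.sum_eq_zero fun l₀ h1 => if_neg fun h2 => hl ?_
    exact ((mem_cone_iff hv ((Set.Finite.mem_toFinset _).1 h1)).1 h2).1

theorem reducedSeries_eq_sum_coneInd [Nonempty Γ.Node]
    (hord : ∀ n, ∀ n' ∈ Γ.nbrs n, n < n' ∨ n' < n) (hval : ∀ n, 1 ≤ Γ.nodeValency n)
    {h : Γ.H} (ha : Γ.IsReducedLift a h)
    (hv : ∀ k ∈ Γ.levels, Γ.IsGenerating (Γ.subLift a k) 1 v) :
    Γ.reducedSeries h = ∑ k ∈ Γ.levels, Γ.levelCoeff k •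
      ∑ l ∈ (gradedHoles_finite v a k Γ.hatNodes).toFinset,
        coneInd (fun m => Γ.toQ (v m)) Γ.hatNodesᶜ (basePoint v a l) := by
  funext x
  simp only [Finset.sum_apply, Pi.smul_apply, smul_eq_mul]
  by_cases hx : ∃ l ∈ Γ.affineLattice a, x = Γ.shift a + Γ.toQ l
  · obtain ⟨l, hl, rfl⟩ := hx
    rw [Γ.reducedSeries_eq_sum_levels hord hval ha hl]
    exact Finset.sum_congr rfl fun k hk => by rw [sum_coneInd hk (hv k hk)]
  · push Not at hx
    rw [Γ.reducedSeries_eq_zero_of_notMem hord ha hx]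
    refine (Finset.sum_eq_zero fun k hk => ?_).symm
    rw [Finset.sum_eq_zero, mul_zero]
    intro l hl
    refine if_neg ?_
    rintro ⟨j, e⟩
    have hv0 := fun n => ((hv k hk).1 n).1
    refine hx (l + ∑ m ∈ Γ.hatNodesᶜ, (j m + if Γ.quasi a l m < 0 then 1 else 0) • v m)
      (Γ.add_mem_affineLattice ((Set.Finite.mem_toFinset _).1 hl).1
        (Γ.sum_mem_affineLattice _ _ hv0)) ?_
    rw [e, toQ_add, toQ_sum, ← sum_negNodes, basePoint]
    abel

end Order
end PlumbingTree
end
noncomputable section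
open scoped Classical
universe u
namespace PlumbingTree
open LaurentDivision
variable {V : Type u} [Fintype V] [DecidableEq V] (Γ : PlumbingTree V)

/-! ### The elementary fractions -/

theorem nonneg_of_mem_orbCone {x : Γ.Node → ℚ} (hx : x ∈ Γ.orbCone) (n : Γ.Node) : 0 ≤ x n := by
  rw [Γ.eq_sum_orb x, Finset.sum_apply]
  exact Finset.sum_nonneg fun m _ => mul_nonneg (hx m) (Γ.dualVec_pos m n).le

/-- A point of the cone is a nonnegative combination of the π_𝒩(E_m^*), each of which lies on one of
the two rays of the plane. -/
theorem planeDet_nonneg_of_mem_orbCone {n n' : Γ.Node} (h : n' ∈ Γ.nbrs n) {x : Γ.Node → ℚ}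
    (hx : x ∈ Γ.orbCone) : 0 ≤ Γ.planeDet n n' x := by
  rw [Γ.eq_sum_orb x, map_sum]
  refine Finset.sum_nonneg fun m _ => ?_
  rw [map_rat_smul]
  refine mul_nonneg (hx m) ?_
  rcases Γ.mem_side_or h m with hm | hm
  · exact (Γ.planeDet_Estar_pos h hm).le
  · exact (Γ.planeDet_Estar_eq_zero hm).ge

variable {Γ} in
theorem pick_spec {p : Γ.Laurent → Prop} (hp : ∃! P, p P) : p (Γ.pick p) := by
  rw [pick, dif_pos hp.exists]
  exact hp.exists.choose_spec

variable {Γ} in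
theorem coe_coeff_sum {κ : Type*} (s : Finset κ) (F : κ → Γ.Laurent) :
    ⇑(∑ i ∈ s, F i).coeff = ∑ i ∈ s, ⇑(F i).coeff := by
  induction s using Finset.induction_on with
  | empty => rfl
  | insert i s hi ih =>
    rw [Finset.sum_insert hi, Finset.sum_insert hi, AddMonoidAlgebra.coeff_add, Finsupp.coe_add, ih]

section Order
variable [PartialOrder Γ.Node]
variable {Γ}
variable {a : Γ.LiftData} {v : Γ.Node → Γ.Node → ℤ}

theorem existsUnique_nodeDivision (hw : ∀ S, Γ.PosWeights v S) {l : Γ.Node → ℤ}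
    (hl : l ∈ Γ.normModule a) (I : Finset Γ.Node) (n : Γ.Node) :
    ∃! P, Γ.IsNodeDivision n v I (Γ.mono (Γ.shift a + Γ.toQ l)) P := by
  have hc := (Γ.mem_normModule_iff.1 hl).2
  obtain ⟨P, hP⟩ := Γ.exists_nodeDivision n (hw I) (Γ.mono (Γ.shift a + Γ.toQ l)) (suppIn_mon
    ⟨add_mem (Γ.shift_mem_projRange a) (Γ.toQ_mem_projRange l), Γ.nonneg_of_mem_orbCone hc n⟩)
  exact ⟨P, hP, fun Q hQ => Γ.nodeDivision_unique (hw I) (hw I) rfl hQ hP⟩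

theorem existsUnique_chainDivision (hw : ∀ S, Γ.PosWeights v S) {l : Γ.Node → ℤ}
    (hl : l ∈ Γ.normModule a) (I : Finset Γ.Node) {n n' : Γ.Node} (h : n' ∈ Γ.nbrs n) :
    ∃! P, Γ.IsChainDivision n n' v I (Γ.mono (Γ.shift a + Γ.toQ l)) P := by
  have hc := (Γ.mem_normModule_iff.1 hl).2
  obtain ⟨P, hP⟩ := Γ.exists_chainDivision h (hw I) (Γ.mono (Γ.shift a + Γ.toQ l)) (suppIn_mon
    ⟨add_mem (Γ.shift_mem_projRange a) (Γ.toQ_mem_projRange l),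
      Γ.planeDet_nonneg_of_mem_orbCone h hc,
      Γ.planeDet_nonneg_of_mem_orbCone (Γ.nbrs_comm.1 h) hc⟩)
  exact ⟨P, hP, fun Q hQ => Γ.chainDivision_unique h (hw I) (hw I) rfl hQ hP⟩

/-! ### The reduced series as a fraction -/

/-- The index set `gr_k 𝓜⁻_{a,I}` as a finite set. -/
def gradedFinset (v : Γ.Node → Γ.Node → ℤ) (a : Γ.LiftData) (k : Γ.Node → ℕ)
    (I : Finset Γ.Node) : Finset (Γ.Node → ℤ) := (gradedHoles_finite v a k I).toFinset

theorem mem_gradedFinset {k : Γ.Node → ℕ} {I : Finset Γ.Node} {l : Γ.Node → ℤ} :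
    l ∈ gradedFinset v a k I ↔ l ∈ Γ.gradedHoles v a k I := Set.Finite.mem_toFinset _

/-- The alternating sum over the index set of the formula. -/
def gradedSum {M : Type*} [AddCommGroup M] (v : Γ.Node → Γ.Node → ℤ) (a : Γ.LiftData)
    (X : Finset Γ.Node → (Γ.Node → ℤ) → M) : M :=
  ∑ I ∈ (Finset.univ : Finset (Finset Γ.Node)).filter (fun I => Γ.hatNodes ⊆ I),
    (-1 : ℤ) ^ (I \ Γ.hatNodes).card • ∑ k ∈ Γ.levels, Γ.levelCoeff k •
      ∑ l ∈ gradedFinset v a k I, X I l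

theorem mem_gradedHoles_iff {k : Γ.Node → ℕ} {I : Finset Γ.Node} {l : Γ.Node → ℤ} :
    l ∈ Γ.gradedHoles v a k I ↔ l ∈ Γ.gradedHoles v a k Γ.hatNodes ∧
      I \ Γ.hatNodes ⊆ Γ.negNodes a l := by
  constructor
  · rintro ⟨h1, h2, h3, h4⟩
    refine ⟨⟨h1, h2, fun n hn => by simp at hn, h4⟩, fun n hn => ?_⟩
    exact Finset.mem_filter.2 ⟨Finset.mem_compl.2 (Finset.mem_sdiff.1 hn).2, h3 n hn⟩
  · rintro ⟨⟨h1, h2, -, h4⟩, h5⟩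
    exact ⟨h1, h2, fun n hn => (Finset.mem_filter.1 (h5 hn)).2, h4⟩

/-- Exchange of summation: a subset J of the nodes where N_a(ℓ, ·) < 0 corresponds to 𝓘 = 𝒩̂ ∪ J,
and then J consists of negative nodes exactly when ℓ belongs to gr_k 𝓜⁻_{a,𝓘}. -/
theorem sum_powerset_negNodes {M : Type*} [AddCommGroup M] (k : Γ.Node → ℕ)
    (Y : (Γ.Node → ℤ) → Finset Γ.Node → M) :
    ∑ l ∈ gradedFinset v a k Γ.hatNodes, ∑ J ∈ (Γ.negNodes a l).powerset, Y l J =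
      ∑ I ∈ (Finset.univ : Finset (Finset Γ.Node)).filter (fun I => Γ.hatNodes ⊆ I),
        ∑ l ∈ gradedFinset v a k I, Y l (I \ Γ.hatNodes) := by
  have h1 : ∀ l, ∑ J ∈ (Γ.negNodes a l).powerset, Y l J =
      ∑ I ∈ (Finset.univ : Finset (Finset Γ.Node)).filter
        (fun I => Γ.hatNodes ⊆ I ∧ I \ Γ.hatNodes ⊆ Γ.negNodes a l), Y l (I \ Γ.hatNodes) := by
    intro l
    have hdis : ∀ J ⊆ Γ.negNodes a l, (J ∪ Γ.hatNodes) \ Γ.hatNodes = J := by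
      intro J hJ
      rw [Finset.union_sdiff_right, Finset.sdiff_eq_self_iff_disjoint]
      refine Finset.disjoint_left.2 fun n hn => ?_
      exact Finset.mem_compl.1 (Finset.mem_filter.1 (hJ hn)).1
    refine Finset.sum_nbij' (fun J => J ∪ Γ.hatNodes) (fun I => I \ Γ.hatNodes) ?_ ?_ ?_ ?_ ?_
    · intro J hJ
      rw [Finset.mem_powerset] at hJ
      refine Finset.mem_filter.2 ⟨Finset.mem_univ _, Finset.subset_union_right, ?_⟩
      rwa [hdis J hJ]
    · intro I hI
      exact Finset.mem_powerset.2 (Finset.mem_filter.1 hI).2.2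
    · intro J hJ
      exact hdis J (Finset.mem_powerset.1 hJ)
    · intro I hI
      exact Finset.sdiff_union_of_subset (Finset.mem_filter.1 hI).2.1
    · intro J hJ
      rw [hdis J (Finset.mem_powerset.1 hJ)]
  simp only [h1]
  refine Finset.sum_comm' fun l I => ?_
  simp only [Finset.mem_filter, Finset.mem_univ, true_and, mem_gradedFinset]
  rw [mem_gradedHoles_iff (I := I)]
  tauto

theorem sum_mon_basePoint :
    ∑ k ∈ Γ.levels, Γ.levelCoeff k • ∑ l ∈ gradedFinset v a k Γ.hatNodes,
      Γ.mono (basePoint v a l) =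
    gradedSum v a fun I l => Γ.mono (Γ.shift a + Γ.toQ l) * Γ.denom v (I \ Γ.hatNodes) := by
  have h1 : ∀ l, Γ.mono (basePoint v a l) = ∑ J ∈ (Γ.negNodes a l).powerset,
      (-1 : ℤ) ^ J.card • (Γ.mono (Γ.shift a + Γ.toQ l) * Γ.denom v J) := fun l =>
    mon_add_sum (fun m => Γ.toQ (v m)) _ _
  simp only [h1, sum_powerset_negNodes, gradedSum, Finset.smul_sum]
  rw [Finset.sum_comm]
  simp only [smul_comm (Γ.levelCoeff _)]

/-- The denominator turns each cone into the monomial of its base point, and `sum_mon_basePoint`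
rewrites these monomials by inclusion–exclusion. -/
theorem isFraction_reducedSeries [Nonempty Γ.Node]
    (hord : ∀ n, ∀ n' ∈ Γ.nbrs n, n < n' ∨ n' < n) (hval : ∀ n, 1 ≤ Γ.nodeValency n)
    {h : Γ.H} (ha : Γ.IsReducedLift a h)
    (hv : ∀ k ∈ Γ.levels, Γ.IsGenerating (Γ.subLift a k) 1 v) (hv0 : Γ.IsGenerating a 1 v)
    (hne : (Γ.normModule a).Nonempty) :
    Γ.IsFraction (Γ.reducedSeries h) v Γ.hatNodesᶜ
      (gradedSum v a fun I l => Γ.mono (Γ.shift a + Γ.toQ l) * Γ.denom v (I \ Γ.hatNodes)) := by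
  refine ⟨hv0.posWeights hne _, fun x => ?_⟩
  have h1 : act (Γ.denom v Γ.hatNodesᶜ) (Γ.reducedSeries h) =
      ⇑(∑ k ∈ Γ.levels, Γ.levelCoeff k • ∑ l ∈ gradedFinset v a k Γ.hatNodes,
      Γ.mono (basePoint v a l)).coeff := by
    rw [reducedSeries_eq_sum_coneInd hord hval ha hv, act_sum_right, coe_coeff_sum]
    refine Finset.sum_congr rfl fun k _ => ?_
    rw [act_smul_right, act_sum_right, AddMonoidAlgebra.coeff_smul, Finsupp.coe_smul, coe_coeff_sum]
    congr 1
    refine Finset.sum_congr rfl fun l _ => ?_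
    -- The forms dual to the generators are the coordinates of -I^orb: 𝔳_{m'} has coordinate 0 at
    -- every m ≠ m'.
    exact act_den_coneInd (fun m => Γ.toQ (v m)) _ (fun m => (Γ.coord m).comp Γ.orb.toAddMonoidHom)
      (fun m m' hm => hv0.orb_eq_zero hne hm) (fun m => hv0.orb_pos hne m) _
  rw [← sum_mon_basePoint]
  exact congrFun h1 x

/-- The elementary fraction of 𝓘 has denominator over the complement of 𝓘. Adding the factors of 𝓘 ∖
𝒩̂ above and below gives a common denominator, over which divisions add up. -/
theorem isNodeDivision_gradedSum (hw : ∀ S, Γ.PosWeights v S) (n : Γ.Node)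
    (hsub : ∀ I k, k ∈ Γ.levels → Γ.gradedHoles v a k I ⊆ Γ.normModule a) :
    Γ.IsNodeDivision n v Γ.hatNodesᶜ
      (gradedSum v a fun I l => Γ.mono (Γ.shift a + Γ.toQ l) * Γ.denom v (I \ Γ.hatNodes))
      (gradedSum v a fun I l =>
        Γ.pick (Γ.IsNodeDivision n v Iᶜ (Γ.mono (Γ.shift a + Γ.toQ l)))) := by
  refine IsNodeDivision.sum Γ _ _ _ _ fun I hI => IsNodeDivision.sum Γ _ _ _ _ fun k hk => ?_
  have h1 := IsNodeDivision.sum Γ (gradedFinset v a k I) (fun _ => 1)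
    (fun l => Γ.mono (Γ.shift a + Γ.toQ l) * Γ.denom v (I \ Γ.hatNodes))
    (fun l => Γ.pick (Γ.IsNodeDivision n v Iᶜ (Γ.mono (Γ.shift a + Γ.toQ l))))
    (n := n) (w := v) (S := Γ.hatNodesᶜ) fun l hl => ?_
  · simpa only [one_smul] using h1
  · have h2 := pick_spec (existsUnique_nodeDivision hw
      (hsub I k hk (mem_gradedFinset.1 hl)) Iᶜ n)
    have h3 := IsNodeDivision.enlarge Γ (T := I \ Γ.hatNodes)
      (disjoint_compl_left.mono_right Finset.sdiff_subset) (hw _) h2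
    have e : Iᶜ ∪ I \ Γ.hatNodes = Γ.hatNodesᶜ := by
      have := (Finset.mem_filter.1 hI).2
      ext m
      have := @this m
      simp only [Finset.mem_union, Finset.mem_compl, Finset.mem_sdiff]
      tauto
    rwa [e] at h3

theorem isChainDivision_gradedSum (hw : ∀ S, Γ.PosWeights v S) {n n' : Γ.Node} (h : n' ∈ Γ.nbrs n)
    (hsub : ∀ I k, k ∈ Γ.levels → Γ.gradedHoles v a k I ⊆ Γ.normModule a) :
    Γ.IsChainDivision n n' v Γ.hatNodesᶜ
      (gradedSum v a fun I l => Γ.mono (Γ.shift a + Γ.toQ l) * Γ.denom v (I \ Γ.hatNodes))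
      (gradedSum v a fun I l =>
        Γ.pick (Γ.IsChainDivision n n' v Iᶜ (Γ.mono (Γ.shift a + Γ.toQ l)))) := by
  refine IsChainDivision.sum Γ _ _ _ _ fun I hI => IsChainDivision.sum Γ _ _ _ _ fun k hk => ?_
  have h1 := IsChainDivision.sum Γ (gradedFinset v a k I) (fun _ => 1)
    (fun l => Γ.mono (Γ.shift a + Γ.toQ l) * Γ.denom v (I \ Γ.hatNodes))
    (fun l => Γ.pick (Γ.IsChainDivision n n' v Iᶜ (Γ.mono (Γ.shift a + Γ.toQ l))))
    (n := n) (n' := n') (w := v) (S := Γ.hatNodesᶜ) fun l hl => ?_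
  · simpa only [one_smul] using h1
  · have h2 := pick_spec (existsUnique_chainDivision hw
      (hsub I k hk (mem_gradedFinset.1 hl)) Iᶜ h)
    have h3 := IsChainDivision.enlarge Γ h (T := I \ Γ.hatNodes)
      (disjoint_compl_left.mono_right Finset.sdiff_subset) (hw _) h2
    have e : Iᶜ ∪ I \ Γ.hatNodes = Γ.hatNodesᶜ := by
      have := (Finset.mem_filter.1 hI).2
      ext m
      have := @this m
      simp only [Finset.mem_union, Finset.mem_compl, Finset.mem_sdiff]
      tauto
    rwa [e] at h3

/-! ### The polynomial part -/

variable (Γ) in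
theorem assemble_sum {κ : Type*} (s : Finset κ) (c : κ → ℤ)
    (A₂ : κ → Γ.Node → Γ.Node → Γ.Laurent) (A₁ : κ → Γ.Node → Γ.Laurent) :
    Γ.assemble (fun n n' => ∑ i ∈ s, c i • A₂ i n n') (fun n => ∑ i ∈ s, c i • A₁ i n) =
      ∑ i ∈ s, c i • Γ.assemble (A₂ i) (A₁ i) := by
  simp only [assemble, smul_sub, Finset.sum_sub_distrib, Finset.smul_sum]
  congr 1
  · rw [Finset.sum_comm]
    refine Finset.sum_congr rfl fun n _ => ?_
    rw [Finset.sum_comm]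
  · rw [Finset.sum_comm]
    simp only [smul_comm (c _)]

theorem assemble_gradedSum (A₂ : Finset Γ.Node → (Γ.Node → ℤ) → Γ.Node → Γ.Node → Γ.Laurent)
    (A₁ : Finset Γ.Node → (Γ.Node → ℤ) → Γ.Node → Γ.Laurent) :
    Γ.assemble (fun n n' => gradedSum v a fun I l => A₂ I l n n')
      (fun n => gradedSum v a fun I l => A₁ I l n) =
      gradedSum v a fun I l => Γ.assemble (A₂ I l) (A₁ I l) := by
  simp only [gradedSum]
  rw [assemble_sum Γ _ _ (fun I n n' => ∑ k ∈ Γ.levels, Γ.levelCoeff k •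
    ∑ l ∈ gradedFinset v a k I, A₂ I l n n') (fun I n => ∑ k ∈ Γ.levels, Γ.levelCoeff k •
    ∑ l ∈ gradedFinset v a k I, A₁ I l n)]
  refine Finset.sum_congr rfl fun I _ => ?_
  rw [assemble_sum Γ _ _ (fun k n n' => ∑ l ∈ gradedFinset v a k I, A₂ I l n n')
    (fun k n => ∑ l ∈ gradedFinset v a k I, A₁ I l n)]
  congr 1
  refine Finset.sum_congr rfl fun k _ => ?_
  have := assemble_sum Γ (gradedFinset v a k I) (fun _ => 1) (A₂ I) (A₁ I)
  simp only [one_smul] at this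
  rw [this]

theorem assemble_congr {A₂ B₂ : Γ.Node → Γ.Node → Γ.Laurent} {A₁ B₁ : Γ.Node → Γ.Laurent}
    (h2 : ∀ n, ∀ n' ∈ Γ.nbrs n, A₂ n n' = B₂ n n') (h1 : ∀ n, A₁ n = B₁ n) :
    Γ.assemble A₂ A₁ = Γ.assemble B₂ B₁ := by
  simp only [assemble, h1]
  congr 1
  exact Finset.sum_congr rfl fun n _ => Finset.sum_congr rfl fun n' hn =>
    h2 n n' (Finset.mem_filter.1 hn).1

theorem reducedSeries_eq_zero [Nonempty Γ.Node]
    (hord : ∀ n, ∀ n' ∈ Γ.nbrs n, n < n' ∨ n' < n)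
    {h : Γ.H} (ha : Γ.IsReducedLift a h) (hempty : Γ.normModule a = ∅) :
    Γ.reducedSeries h = 0 := by
  funext x
  by_cases hx : ∃ l ∈ Γ.affineLattice a, x = Γ.shift a + Γ.toQ l
  · obtain ⟨l, hl, rfl⟩ := hx
    by_cases hneg : ∃ n, Γ.quasi a l n < 0
    · obtain ⟨n, hn⟩ := hneg
      exact Γ.reducedSeries_eq_zero_of_neg hord ha hl hn
    · push Not at hneg
      have : l ∈ Γ.normModule a := ⟨hl, fun n => (hneg n).trans (Γ.quasi_le_linear a l n)⟩
      rw [hempty] at this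
      exact this.elim
  · push Not at hx
    exact Γ.reducedSeries_eq_zero_of_notMem hord ha hx

/-- The polynomial parts of the reduced series exist and are given by the graded sums. -/
theorem exists_parts [Nonempty Γ.Node]
    (hord : ∀ n, ∀ n' ∈ Γ.nbrs n, n < n' ∨ n' < n) (hval : ∀ n, 1 ≤ Γ.nodeValency n)
    {h : Γ.H} (ha : Γ.IsReducedLift a h)
    (hv : ∀ k ∈ Γ.levels, Γ.IsGenerating (Γ.subLift a k) 1 v) :
    (∀ n, Γ.IsNodePart (Γ.reducedSeries h) n (gradedSum v a fun I l =>
        Γ.pick (Γ.IsNodeDivision n v Iᶜ (Γ.mono (Γ.shift a + Γ.toQ l))))) ∧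
    ∀ n, ∀ n' ∈ Γ.nbrs n, Γ.IsChainPart (Γ.reducedSeries h) n n' (gradedSum v a fun I l =>
        Γ.pick (Γ.IsChainDivision n n' v Iᶜ (Γ.mono (Γ.shift a + Γ.toQ l)))) := by
  have hsub : ∀ I k, k ∈ Γ.levels → Γ.gradedHoles v a k I ⊆ Γ.normModule a := fun I k hk =>
    ((hv k hk).gradedHoles_subset I).trans (Γ.normModule_subLift_subset a k)
  -- Without a point in the normalization the generating condition says nothing about the direction
  -- of the 𝔳_n. But then the series and all graded sums are 0, and the fraction 0/1 serves.
  rcases (Γ.normModule a).eq_empty_or_nonempty with hempty | hne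
  · have hz : ∀ X : Finset Γ.Node → (Γ.Node → ℤ) → Γ.Laurent, gradedSum v a X = 0 := by
      intro X
      refine Finset.sum_eq_zero fun I _ => ?_
      rw [Finset.sum_eq_zero fun k hk => ?_, smul_zero]
      have : gradedFinset v a k I = ∅ := by
        refine Finset.eq_empty_of_forall_notMem fun l hl => ?_
        have := hsub I k hk (mem_gradedFinset.1 hl)
        rwa [hempty] at this
      rw [this, Finset.sum_empty, smul_zero]
    have hfrac : Γ.IsFraction (Γ.reducedSeries h) v ∅ 0 := by
      refine ⟨fun m hm => by simp at hm, fun x => ?_⟩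
      rw [reducedSeries_eq_zero hord ha hempty]
      exact congrFun (act_zero_right _) x
    have h0 : ∀ C, Γ.SupportedOn 0 C := fun C => suppIn_zero _
    refine ⟨fun n => ?_, fun n n' _ => ?_⟩
    · rw [hz]
      exact ⟨v, ∅, 0, hfrac, 0, by simp, h0 _, h0 _⟩
    · rw [hz]
      exact ⟨v, ∅, 0, hfrac, 0, 0, 0, by simp, h0 _, h0 _, h0 _, h0 _⟩
  · have hv0 : Γ.IsGenerating a 1 v := by
      have := hv 0 Γ.zero_mem_levels
      rwa [subLift_zero] at this
    have hf := isFraction_reducedSeries hord hval ha hv hv0 hne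
    exact ⟨fun n => ⟨v, _, _, hf, isNodeDivision_gradedSum (hv0.posWeights hne) n hsub⟩,
      fun n n' hn => ⟨v, _, _, hf, isChainDivision_gradedSum (hv0.posWeights hne) hn hsub⟩⟩

theorem polyPart_eq_gradedSum [Nonempty Γ.Node]
    (hord : ∀ n, ∀ n' ∈ Γ.nbrs n, n < n' ∨ n' < n) (hval : ∀ n, 1 ≤ Γ.nodeValency n)
    {h : Γ.H} (ha : Γ.IsReducedLift a h)
    (hv : ∀ k ∈ Γ.levels, Γ.IsGenerating (Γ.subLift a k) 1 v) :
    Γ.polyPart h = gradedSum v a fun I l => Γ.Pol v (Γ.shift a + Γ.toQ l) Iᶜ := by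
  obtain ⟨h1, h2⟩ := exists_parts hord hval ha hv
  simp only [Pol]
  rw [← assemble_gradedSum (fun I l n n' =>
      Γ.pick (Γ.IsChainDivision n n' v Iᶜ (Γ.mono (Γ.shift a + Γ.toQ l))))
    (fun I l n => Γ.pick (Γ.IsNodeDivision n v Iᶜ (Γ.mono (Γ.shift a + Γ.toQ l)))), polyPart]
  exact assemble_congr
    (fun n n' hn => Γ.pick_eq (h2 n n' hn) fun Q hQ => Γ.chainPart_unique hn hQ (h2 n n' hn))
    fun n => Γ.pick_eq (h1 n) fun Q hQ => Γ.nodePart_unique hQ (h1 n)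

end Order
end PlumbingTree
end
-- The formula for the polynomial part
theorem mainTheorem3 {V : Type*} [Fintype V] [DecidableEq V] (Γ : PlumbingTree V)
    [PartialOrder Γ.Node]
    (hord : ∀ n, ∀ n' ∈ Γ.nbrs n, n < n' ∨ n' < n)
    (hne : Nonempty Γ.Node) (hval : ∀ n, 1 ≤ Γ.nodeValency n)
    (h : Γ.H) (a : Γ.LiftData) (ha : Γ.IsReducedLift a h)
    (v : Γ.Node → Γ.Node → ℤ)
    (hv : ∀ k ∈ Γ.levels, Γ.IsGenerating (Γ.subLift a k) 1 v) :
    -- the coefficients of the reduced series are finite sums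
    (∀ x, (Γ.fiber h x).Finite) ∧
    -- the polynomial parts of the reduced series exist and are unique
    (∀ n, ∃! P, Γ.IsNodePart (Γ.reducedSeries h) n P) ∧
    (∀ n, ∀ n' ∈ Γ.nbrs n, ∃! P, Γ.IsChainPart (Γ.reducedSeries h) n n' P) ∧
    -- the polynomial parts of the elementary fractions exist and are unique
    (∀ l ∈ Γ.normModule a, ∀ I : Finset Γ.Node,
      (∀ n, ∃! P, Γ.IsNodeDivision n v I (Γ.mono (Γ.shift a + Γ.toQ l)) P) ∧
      (∀ n, ∀ n' ∈ Γ.nbrs n,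
        ∃! P, Γ.IsChainDivision n n' v I (Γ.mono (Γ.shift a + Γ.toQ l)) P)) ∧
    -- the index sets of the sum are finite subsets of the normalization
    (∀ I : Finset Γ.Node, Γ.hatNodes ⊆ I → ∀ k ∈ Γ.levels,
      (Γ.gradedHoles v a k I).Finite ∧ Γ.gradedHoles v a k I ⊆ Γ.normModule a) ∧
    -- the formula for the polynomial part
    Γ.polyPart h =
      ∑ I ∈ (Finset.univ : Finset (Finset Γ.Node)).filter (fun I => Γ.hatNodes ⊆ I),
        (-1 : ℤ) ^ (I \ Γ.hatNodes).card •
          ∑ k ∈ Γ.levels,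
            (∏ n ∈ Γ.hatNodes, (-1 : ℤ) ^ k n * ((Γ.nodeValency n - 2).choose (k n) : ℤ)) •
              ∑ᶠ l ∈ Γ.gradedHoles v a k I, Γ.Pol v (Γ.shift a + Γ.toQ l) Iᶜ := by
  have : Nonempty Γ.Node := hne
  have hsub : ∀ I k, k ∈ Γ.levels → Γ.gradedHoles v a k I ⊆ Γ.normModule a := fun I k hk =>
    ((hv k hk).gradedHoles_subset I).trans (Γ.normModule_subLift_subset a k)
  have hv0 : Γ.IsGenerating a 1 v := by
    have := hv 0 Γ.zero_mem_levels
    rwa [PlumbingTree.subLift_zero] at this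
  obtain ⟨h1, h2⟩ := PlumbingTree.exists_parts hord hval ha hv
  refine ⟨Γ.fiber_finite h, fun n => ⟨_, h1 n, fun Q hQ => Γ.nodePart_unique hQ (h1 n)⟩,
    fun n n' hn => ⟨_, h2 n n' hn, fun Q hQ => Γ.chainPart_unique hn hQ (h2 n n' hn)⟩,
    fun l hl I => ⟨PlumbingTree.existsUnique_nodeDivision (hv0.posWeights ⟨l, hl⟩) hl I,
      fun n n' hn => PlumbingTree.existsUnique_chainDivision (hv0.posWeights ⟨l, hl⟩) hl I hn⟩,
    fun I _ k hk => ⟨PlumbingTree.gradedHoles_finite v a k I, hsub I k hk⟩, ?_⟩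
  rw [PlumbingTree.polyPart_eq_gradedSum hord hval ha hv, PlumbingTree.gradedSum]
  refine Finset.sum_congr rfl fun I _ => ?_
  congr 1
  refine Finset.sum_congr rfl fun k _ => ?_
  rw [finsum_mem_eq_finite_toFinset_sum _ (PlumbingTree.gradedHoles_finite v a k I)]
  rfl
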